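/- Let $G$ be a group. Monoids, semi-rings and rings are commutative with unit, and their homomorphisms preserve $1$ (and $0$). For a set $\mathcal C$ of subgroups of $G$, let ${}_G\mathrm{Set}_{\mathcal C}$ be the category of (possibly infinite) $G$-sets $X$ all of whose stabilizers $G_x$ lie in $\mathcal C$. **Tambara systems.** A Mackey system $(\mathcal C,\mathcal O)$ is a set $\mathcal C$ of subgroups closed under conjugation and finite intersections, with sets $\mathcal O(H)\subseteq\{U\in\mathcal C: U\le H\}$ $(H\in\mathcal C)$ such that for $U\in\mathcal O(H)$, $V\in\mathcal C$, $V\le H$ and $g\in G$: $[H:U]<\infty$, $\mathcal O(U)\subseteq\mathcal O(H)$, $\mathcal O(gHg^{-1})=g\mathcal O(H)g^{-1}$ and $U\cap V\in\mathcal O(V)$. Its morphisms $\mathcal O(X,Y)$ are the equivariant maps $f:X\to Y$ in ${}_G\mathrm{Set}_{\mathcal C}$ with finite fibres and $G_x\in\mathcal O(G_{f(x)})$ for all $x$. A Tambara system is given by a set of subsets of $G$ closed under left and right translations, finite intersections and finite unions, and a Mackey system $(\mathcal C,\mathcal O_\bullet)$, where $\mathcal C$ is the set of subgroups in that set of subsets,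 with $H\in\mathcal O_\bullet(H)$ for all $H\in\mathcal C$. Put $\mathcal O_{\mathcal C}(H)=\{U\in\mathcal C: U\le H,\ [H:U]<\infty\}$. Fix a Tambara system. **Functors.** A semi-Mackey functor on $(\mathcal C,\mathcal O)$ assigns to each object $X$ a monoid $M(X)$, with contravariant functorial homomorphisms $M^*(f)$ for all equivariant $f$ and covariant functorial homomorphisms $M_*(g)$ for $g$ in $\mathcal O(X,Y)$, satisfying $M^*(f)M_*(g)=M_*(g')M^*(f')$ for every pull-back square $fg'=gf'$ with $g$ in $\mathcal O(X,Y)$, and $M(\coprod_\lambda X_\lambda)\cong\prod_\lambda M(X_\lambda)$ for arbitrary disjoint unions. $\mathit{SMack}$ is the category of semi-Mackey functors on $(\mathcal C,\mathcal O_\bullet)$ and natural families of monoid homomorphisms. For $\eta\in\mathcal O_\bullet(X,Y)$ and $p\in\mathcal O_{\mathcal C}(A,X)$ let $\Pi_\eta(A)$ be the set of pairs $(y,\sigma)$ with $y\in Y$ and $\sigma:\eta^{-1}(y)\to A$ a map with $p\sigma=\mathrm{id}$, with its maps $\pi:\Pi_\eta(A)\to Y$, $\rho:X\times_Y\Pi_\eta(A)\to\Pi_\eta(A)$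 and $\lambda:X\times_Y\Pi_\eta(A)\to A$, $\lambda(x,(y,\sigma))=\sigma(x)$. A semi-Tambara functor $T$ assigns to each $X$ a semi-ring $T(X)$ with maps $f^*$, $\xi_+$, $\eta_\bullet$ ($\xi\in\mathcal O_{\mathcal C}(X,Y)$, $\eta\in\mathcal O_\bullet(X,Y)$) making the additive monoids with $(\,^*,{}_+)$ and the multiplicative monoids with $(\,^*,{}_\bullet)$ semi-Mackey functors on $(\mathcal C,\mathcal O_{\mathcal C})$ and $(\mathcal C,\mathcal O_\bullet)$, such that $\eta_\bullet\, p_+=\pi_+\,\rho_\bullet\,\lambda^*$ for all $\eta,p$ as above (and hence for all isomorphic diagrams). Morphisms are families of semi-ring homomorphisms compatible with all structure maps; this gives the category $\mathit{STam}$, and $\mathit{Tam}$ is its full subcategory of those $T$ for which all $T(X)$ are rings. Let $\mathcal U:\mathit{Tam}\to\mathit{STam}$ be the inclusion and $\mu:\mathit{STam}\to\mathit{SMack}$ the functor taking the multiplicative part. **The functors $\mathcal S$ and $\gamma$.** For $M\in\mathit{SMack}$, $\mathcal S_M(X)$ is the semi-ring of isomorphism classes of pairs $(A\xrightarrow{p}X,\,m)$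 with $p\in\mathcal O_{\mathcal C}(A,X)$ and $m\in M(A)$ (isomorphisms being equivariant bijections over $X$ compatible with $m$), with sum $(A\amalg B\to X,\,m\amalg n)$ and product $(A\times_XB\to X,\,m\star n)$; here $m\amalg n$ corresponds to $(m,n)$ under $M(A\amalg B)\cong M(A)\times M(B)$, and $m\star n=M^*(\varpi_A)(m)\cdot M^*(\varpi_B)(n)$ with $\varpi_A,\varpi_B$ the projections of $A\times_XB$. Its structure maps are: $f^*$ is pull-back along $f$; $\xi_+(A\xrightarrow{p}X,m)=(A\xrightarrow{\xi p}Y,m)$; and $\eta_\bullet(A\xrightarrow{p}X,m)=(\Pi_\eta(A)\xrightarrow{\pi}Y,\,M_*(\rho)M^*(\lambda)(m))$. A morphism $\varphi$ acts by $(p,m)\mapsto(p,\varphi_A(m))$. For $T\in\mathit{STam}$, $(\gamma T)(X)=K_0(T(X))$ is the ring completion of $T(X)$, with the structure maps, and the action on morphisms, extending those of $\mathit{STam}$ along the canonical maps $T(X)\to K_0(T(X))$. **Statement.** These constructions define functors $\mathcal S:\mathit{SMack}\to\mathit{STam}$ and $\gamma:\mathit{STam}\to\mathit{Tam}$, and the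 composite $\mathcal T=\gamma\circ\mathcal S:\mathit{SMack}\to\mathit{Tam}$ is left adjoint to $\mu\circ\mathcal U:\mathit{Tam}\to\mathit{SMack}$. If moreover $G$ is trivial and $\mathcal C=\{G\}$, then evaluation at the one-point $G$-set gives equivalences of categories from $\mathit{SMack}$ to the category of monoids and from $\mathit{Tam}$ to the category of rings, and under these equivalences $\mathcal T$ is isomorphic to the monoid-ring functor $Q\mapsto\mathbb Z[Q]$. -/

import Mathlib

open CategoryTheory

universe u

namespace BiTam

section Systems

variable {G : Type u} [Group G]

/-- For a set `C` of subgroups of `G`, the family `H ↦ {U ∈ C | U ≤ H, [H : U] < ∞}`. -/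
def finIndexFamily (C : Set (Subgroup G)) (H : Subgroup G) : Set (Subgroup G) :=
  {U | U ∈ C ∧ U ≤ H ∧ U.relIndex H ≠ 0}

/-- The pair `(C, O)` is a Mackey system on `G`. Only the values `O H` with `H ∈ C` matter. -/
structure IsMackeySystem (C : Set (Subgroup G)) (O : Subgroup G → Set (Subgroup G)) : Prop where
  conj_mem : ∀ H ∈ C, ∀ g : G, H.map (MulAut.conj g).toMonoidHom ∈ C
  inf_mem : ∀ H ∈ C, ∀ K ∈ C, H ⊓ K ∈ C
  sub : ∀ H ∈ C, ∀ U ∈ O H, U ∈ C ∧ U ≤ H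
  finite_index : ∀ H ∈ C, ∀ U ∈ O H, U.relIndex H ≠ 0
  trans : ∀ H ∈ C, ∀ U ∈ O H, O U ⊆ O H
  conj : ∀ H ∈ C, ∀ g : G, O (H.map (MulAut.conj g).toMonoidHom) =
    (fun U : Subgroup G => U.map (MulAut.conj g).toMonoidHom) '' O H
  inf : ∀ H ∈ C, ∀ U ∈ O H, ∀ V ∈ C, V ≤ H → U ⊓ V ∈ O V

variable (G) in
/-- A Tambara system on `G`: a set `sets` of subsets of `G` closed under translations, finite
intersections and finite unions, and a family `O` (usually written `𝒪_•`) which, together with the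
set `C` of all subgroups lying in `sets`, is a Mackey system with `H ∈ O H` for all `H ∈ C`. -/
structure TambaraSystem where
  sets : Set (Set G)
  left_mem : ∀ s ∈ sets, ∀ g : G, (fun x => g * x) '' s ∈ sets
  right_mem : ∀ s ∈ sets, ∀ g : G, (fun x => x * g) '' s ∈ sets
  inter_mem : ∀ s ∈ sets, ∀ t ∈ sets, s ∩ t ∈ sets
  union_mem : ∀ s ∈ sets, ∀ t ∈ sets, s ∪ t ∈ sets
  O : Subgroup G → Set (Subgroup G)
  mackey : IsMackeySystem {H : Subgroup G | (H : Set G) ∈ sets} O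
  self_mem : ∀ H : Subgroup G, (H : Set G) ∈ sets → H ∈ O H

/-- The set of subgroups underlying a Tambara system. -/
def TambaraSystem.C (TS : TambaraSystem G) : Set (Subgroup G) :=
  {H : Subgroup G | (H : Set G) ∈ TS.sets}

/-- `G`-sets all of whose stabilizers lie in `C`. -/
structure GSet (C : Set (Subgroup G)) where
  carrier : Type u
  [act : MulAction G carrier]
  stab_mem : ∀ x : carrier, MulAction.stabilizer G x ∈ C

instance (C : Set (Subgroup G)) : CoeSort (GSet C) (Type u) := ⟨GSet.carrier⟩

instance (C : Set (Subgroup G)) (X : GSet C) : MulAction G X := X.act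

/-- Equivariant maps with finite fibres such that `G_x ∈ O (G_{f x})` for all `x`: the morphisms
of the subcategory of `G`-sets determined by `O`. -/
def InO (O : Subgroup G → Set (Subgroup G)) {X Y : Type u} [MulAction G X] [MulAction G Y]
    (f : X →[G] Y) : Prop :=
  (∀ y : Y, {x : X | f x = y}.Finite) ∧
    ∀ x : X, MulAction.stabilizer G x ∈ O (MulAction.stabilizer G (f x))

/-- The square `f ∘ g' = g ∘ f'` is a pull-back square of `G`-sets. -/
def IsPullbackSquare {X' Y' X Y : Type u} [MulAction G X'] [MulAction G Y'] [MulAction G X]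
    [MulAction G Y] (g' : X' →[G] Y') (f' : X' →[G] X) (f : Y' →[G] Y) (g : X →[G] Y) : Prop :=
  (∀ x', f (g' x') = g (f' x')) ∧
    ∀ (x : X) (y' : Y'), g x = f y' → ∃! x' : X', f' x' = x ∧ g' x' = y'

/-- The morphisms `i l : F l → X` exhibit `X` as the direct sum (disjoint union) of the `F l`. -/
def IsDirectSum {C : Set (Subgroup G)} {L : Type u} {X : GSet C} (F : L → GSet C)
    (i : ∀ l, F l →[G] X) : Prop :=
  Function.Bijective (fun z : Σ l, F l => i z.1 z.2)

end Systems

section SemiMackey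

variable {G : Type u} [Group G]

/-- Semi-Mackey functors on `(C, O)`: `pull` is the contravariant part (defined for all equivariant
maps), `push` is the covariant part (defined for the maps satisfying `InO O`). -/
structure SemiMackey (C : Set (Subgroup G)) (O : Subgroup G → Set (Subgroup G)) where
  obj : GSet C → Type u
  [commMonoid : ∀ X, CommMonoid (obj X)]
  pull : ∀ {X Y : GSet C}, (X →[G] Y) → (obj Y →* obj X)
  push : ∀ {X Y : GSet C} (g : X →[G] Y), InO O g → (obj X →* obj Y)
  pull_id : ∀ (X : GSet C) (m : obj X), pull (MulActionHom.id G : X →[G] X) m = m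
  pull_comp : ∀ {X Y Z : GSet C} (f : X →[G] Y) (g : Y →[G] Z) (m : obj Z),
    pull (g.comp f) m = pull f (pull g m)
  push_id : ∀ (X : GSet C) (h : InO O (MulActionHom.id G : X →[G] X)) (m : obj X),
    push (MulActionHom.id G : X →[G] X) h m = m
  push_comp : ∀ {X Y Z : GSet C} (f : X →[G] Y) (g : Y →[G] Z) (hf : InO O f) (hg : InO O g)
    (hgf : InO O (g.comp f)) (m : obj X), push (g.comp f) hgf m = push g hg (push f hf m)
  mackey : ∀ {X' Y' X Y : GSet C} (g' : X' →[G] Y') (f' : X' →[G] X) (f : Y' →[G] Y)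
    (g : X →[G] Y) (hg' : InO O g') (hg : InO O g), IsPullbackSquare g' f' f g →
    ∀ m : obj X, pull f (push g hg m) = push g' hg' (pull f' m)
  additive : ∀ {L : Type u} {X : GSet C} (F : L → GSet C) (i : ∀ l, F l →[G] X),
    IsDirectSum F i → Function.Bijective (fun (m : obj X) (l : L) => pull (i l) m)

instance (C : Set (Subgroup G)) (O : Subgroup G → Set (Subgroup G)) (M : SemiMackey C O)
    (X : GSet C) : CommMonoid (M.obj X) := M.commMonoid X

/-- Morphisms of semi-Mackey functors. -/
@[ext]
structure SemiMackey.Hom {C : Set (Subgroup G)} {O : Subgroup G → Set (Subgroup G)}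
    (M N : SemiMackey C O) where
  app : ∀ X : GSet C, M.obj X →* N.obj X
  app_pull : ∀ {X Y : GSet C} (f : X →[G] Y) (m : M.obj Y),
    app X (M.pull f m) = N.pull f (app Y m)
  app_push : ∀ {X Y : GSet C} (g : X →[G] Y) (hg : InO O g) (m : M.obj X),
    app Y (M.push g hg m) = N.push g hg (app X m)

instance (C : Set (Subgroup G)) (O : Subgroup G → Set (Subgroup G)) :
    Category.{u + 1} (SemiMackey C O) where
  Hom M N := SemiMackey.Hom M N
  id M := ⟨fun X => MonoidHom.id _, fun _ _ => rfl, fun _ _ _ => rfl⟩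
  comp φ ψ := ⟨fun X => (ψ.app X).comp (φ.app X),
    fun f m => by simp [φ.app_pull, ψ.app_pull],
    fun g hg m => by simp [φ.app_push, ψ.app_push]⟩

end SemiMackey

section Exponential

variable {G : Type u} [Group G]

/-- The fibre product `A ×_X B` of two maps of `G`-sets. -/
def FibreProd {A B X : Type u} [MulAction G A] [MulAction G B] [MulAction G X]
    (p : A →[G] X) (q : B →[G] X) : Type u :=
  {z : A × B // p z.1 = q z.2}

instance {A B X : Type u} [MulAction G A] [MulAction G B] [MulAction G X]
    (p : A →[G] X) (q : B →[G] X) : MulAction G (FibreProd p q) where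
  smul g z := ⟨(g • z.1.1, g • z.1.2), by
    show p (g • z.1.1) = q (g • z.1.2)
    rw [map_smul, map_smul, z.2]⟩
  one_smul z := Subtype.ext (Prod.ext (one_smul G _) (one_smul G _))
  mul_smul g h z := Subtype.ext (Prod.ext (mul_smul g h _) (mul_smul g h _))

/-- Projection of the fibre product onto its first factor. -/
def FibreProd.fst {A B X : Type u} [MulAction G A] [MulAction G B] [MulAction G X]
    (p : A →[G] X) (q : B →[G] X) : FibreProd p q →[G] A where
  toFun z := z.1.1
  map_smul' _ _ := rfl

/-- Projection of the fibre product onto its second factor. -/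
def FibreProd.snd {A B X : Type u} [MulAction G A] [MulAction G B] [MulAction G X]
    (p : A →[G] X) (q : B →[G] X) : FibreProd p q →[G] B where
  toFun z := z.1.2
  map_smul' _ _ := rfl

theorem FibreProd.stab {A B X : Type u} [MulAction G A] [MulAction G B] [MulAction G X]
    (p : A →[G] X) (q : B →[G] X) (z : FibreProd p q) :
    MulAction.stabilizer G z = MulAction.stabilizer G z.1.1 ⊓ MulAction.stabilizer G z.1.2 := by
  ext g
  simp only [Subgroup.mem_inf, MulAction.mem_stabilizer_iff]
  constructor
  · intro h
    exact ⟨congrArg (fun w : FibreProd p q => w.1.1) h,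
      congrArg (fun w : FibreProd p q => w.1.2) h⟩
  · rintro ⟨h1, h2⟩
    exact Subtype.ext (Prod.ext h1 h2)

/-- `Π_η(A)` for `η : X → Y` and `p : A → X`: pairs `(y, σ)` of a point `y` of `Y` and a map of
sets `σ : η⁻¹(y) → A` with `p ∘ σ = id`. -/
structure PiSet {A X Y : Type u} [MulAction G A] [MulAction G X] [MulAction G Y]
    (η : X →[G] Y) (p : A →[G] X) : Type u where
  pt : Y
  sec : ∀ x : X, η x = pt → A
  p_sec : ∀ (x : X) (h : η x = pt), p (sec x h) = x

namespace PiSet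

variable {A X Y : Type u} [MulAction G A] [MulAction G X] [MulAction G Y]
  {η : X →[G] Y} {p : A →[G] X}

theorem ext' {s t : PiSet η p} (h : s.pt = t.pt)
    (h' : ∀ x (hs : η x = s.pt) (ht : η x = t.pt), s.sec x hs = t.sec x ht) : s = t := by
  obtain ⟨y, σ, hσ⟩ := s
  obtain ⟨y', τ, hτ⟩ := t
  obtain rfl : y = y' := h
  obtain rfl : σ = τ := by
    funext x hx
    exact h' x hx hx
  rfl

theorem sec_congr (s : PiSet η p) {x x' : X} (e : x = x') (h : η x = s.pt) (h' : η x' = s.pt) :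
    s.sec x h = s.sec x' h' := by
  subst e
  rfl

theorem act_aux {g : G} {x : X} {y : Y} (h : η x = g • y) : η (g⁻¹ • x) = y := by
  rw [map_smul, h, inv_smul_smul]

/-- `g • (y, σ) = (g y, x ↦ g σ(g⁻¹ x))`. -/
instance : MulAction G (PiSet η p) where
  smul g s :=
    { pt := g • s.pt
      sec := fun x h => g • s.sec (g⁻¹ • x) (act_aux h)
      p_sec := fun x h => by rw [map_smul, s.p_sec, smul_inv_smul] }
  one_smul s := by
    refine ext' (one_smul G s.pt) fun x hs ht => ?_
    show (1 : G) • s.sec ((1 : G)⁻¹ • x) _ = s.sec x ht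
    rw [one_smul]
    exact sec_congr s (by simp) _ _
  mul_smul g h s := by
    refine ext' (mul_smul g h s.pt) fun x hs ht => ?_
    show (g * h) • s.sec ((g * h)⁻¹ • x) _ = g • h • s.sec (h⁻¹ • g⁻¹ • x) _
    rw [mul_smul]
    exact congrArg _ (congrArg _ (sec_congr s (by simp [mul_smul]) _ _))

variable (η p)

/-- The projection `π : Π_η(A) → Y`. -/
def proj : PiSet η p →[G] Y where
  toFun s := s.pt
  map_smul' _ _ := rfl

/-- The evaluation `l : X ×_Y Π_η(A) → A`, `(x, (y, σ)) ↦ σ(x)`. -/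
def eval : FibreProd η (proj η p) →[G] A where
  toFun z := z.1.2.sec z.1.1 z.2
  map_smul' g z := by
    show g • z.1.2.sec (g⁻¹ • g • z.1.1) _ = g • z.1.2.sec z.1.1 z.2
    exact congrArg _ (sec_congr _ (inv_smul_smul g _) _ _)

/-- The projection `ρ : X ×_Y Π_η(A) → Π_η(A)`. -/
abbrev rho : FibreProd η (proj η p) →[G] PiSet η p := FibreProd.snd η (proj η p)

theorem proj_finite (hη : ∀ y : Y, {x : X | η x = y}.Finite)
    (hp : ∀ x : X, {a : A | p a = x}.Finite) (y : Y) :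
    {s : PiSet η p | proj η p s = y}.Finite := by
  have : Finite {x : X // η x = y} := (hη y).to_subtype
  have (x : X) : Finite {a : A // p a = x} := (hp x).to_subtype
  refine Set.Finite.of_injOn (f := fun (s : PiSet η p) (x : {x : X // η x = y}) =>
      open Classical in
      if h : s.pt = y then
        some (⟨s.sec x.1 (x.2.trans h.symm), s.p_sec _ _⟩ : {a : A // p a = x.1})
      else none) (t := Set.univ) (fun _ _ => Set.mem_univ _) ?_ Set.finite_univ
  intro s hs t ht hst
  have hs' : s.pt = y := hs
  have ht' : t.pt = y := ht
  refine ext' (hs'.trans ht'.symm) fun x h1 h2 => ?_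
  have := congrFun hst ⟨x, h1.trans hs'⟩
  simp only [hs', ht', dif_pos, Option.some.injEq, Subtype.mk.injEq] at this
  exact this

end PiSet

/-- The diagram `X ←ξ– Z ←ζ– X' –η'→ Y' –υ→ Y`, together with `η : X → Y`, is isomorphic to the
canonical diagram `X ← Z ← X ×_Y Π_η(Z) → Π_η(Z) → Y` built from `η` and `ξ`. -/
def IsExponential {X Y Z X' Y' : Type u} [MulAction G X] [MulAction G Y] [MulAction G Z]
    [MulAction G X'] [MulAction G Y'] (η : X →[G] Y) (ξ : Z →[G] X) (ζ : X' →[G] Z)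
    (η' : X' →[G] Y') (υ : Y' →[G] Y) : Prop :=
  ∃ (a : X' →[G] FibreProd η (PiSet.proj η ξ)) (b : Y' →[G] PiSet η ξ),
    Function.Bijective a ∧ Function.Bijective b ∧
    (∀ x', PiSet.eval η ξ (a x') = ζ x') ∧
    (∀ x', PiSet.rho η ξ (a x') = b (η' x')) ∧
    (∀ y', PiSet.proj η ξ (b y') = υ y')

end Exponential

namespace TambaraSystem

variable {G : Type u} [Group G] (TS : TambaraSystem G)

/-- Morphisms carrying an additive transfer. -/
abbrev IsAdd {X Y : Type u} [MulAction G X] [MulAction G Y] (f : X →[G] Y) : Prop :=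
  InO (finIndexFamily TS.C) f

/-- Morphisms carrying a multiplicative transfer. -/
abbrev IsMul {X Y : Type u} [MulAction G X] [MulAction G Y] (f : X →[G] Y) : Prop :=
  InO TS.O f

variable {TS}

theorem inf_mem {H K : Subgroup G} (hH : H ∈ TS.C) (hK : K ∈ TS.C) : H ⊓ K ∈ TS.C :=
  TS.mackey.inf_mem H hH K hK

theorem stab_le {X Y : Type u} [MulAction G X] [MulAction G Y] (f : X →[G] Y) (x : X) :
    MulAction.stabilizer G x ≤ MulAction.stabilizer G (f x) := by
  intro g hg
  rw [MulAction.mem_stabilizer_iff] at hg ⊢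
  rw [← map_smul, hg]

theorem isAdd_of_finite {X Y : Type u} [MulAction G X] [MulAction G Y]
    (hX : ∀ x : X, MulAction.stabilizer G x ∈ TS.C) (f : X →[G] Y)
    (hf : ∀ y : Y, {x : X | f x = y}.Finite) : TS.IsAdd f := by
  refine ⟨hf, fun x => ⟨hX x, stab_le f x, ?_⟩⟩
  have : Finite {x' : X // f x' = f x} := (hf (f x)).to_subtype
  set H := MulAction.stabilizer G (f x)
  set U := MulAction.stabilizer G x
  have key : ∀ h : H, f ((h : G) • x) = f x := fun h => by
    rw [map_smul]
    exact h.2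
  let φ : H ⧸ U.subgroupOf H → {x' : X // f x' = f x} :=
    Quotient.lift (fun h : H => ⟨(h : G) • x, key h⟩) (by
      intro a b hab
      have hab' : a⁻¹ * b ∈ U.subgroupOf H := QuotientGroup.leftRel_apply.1 hab
      rw [Subgroup.mem_subgroupOf, MulAction.mem_stabilizer_iff] at hab'
      refine Subtype.ext ?_
      show (a : G) • x = (b : G) • x
      have h2 : ((a : G)⁻¹ * (b : G)) • x = x := hab'
      rw [mul_smul, inv_smul_eq_iff] at h2
      exact h2.symm)
  have hφ : Function.Injective φ := by
    intro a b
    induction a using Quotient.inductionOn with | _ a => ?_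
    induction b using Quotient.inductionOn with | _ b => ?_
    intro h
    have h1 : (a : G) • x = (b : G) • x := congrArg Subtype.val h
    refine Quotient.sound (QuotientGroup.leftRel_apply.2 ?_)
    rw [Subgroup.mem_subgroupOf, MulAction.mem_stabilizer_iff]
    show ((a : G)⁻¹ * (b : G)) • x = x
    rw [mul_smul, inv_smul_eq_iff]
    exact h1.symm
  have : Finite (H ⧸ U.subgroupOf H) := Finite.of_injective φ hφ
  exact Nat.card_ne_zero.2 ⟨⟨((1 : H) : H ⧸ U.subgroupOf H)⟩, this⟩

theorem isAdd_id (X : GSet TS.C) : TS.IsAdd (MulActionHom.id G : X →[G] X) :=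
  isAdd_of_finite X.stab_mem _ fun y => (Set.finite_singleton y).subset fun _ hx => hx

theorem isAdd_comp {X Y Z : GSet TS.C} {f : X →[G] Y} {g : Y →[G] Z} (hf : TS.IsAdd f)
    (hg : TS.IsAdd g) : TS.IsAdd (g.comp f) := by
  refine isAdd_of_finite X.stab_mem _ fun z => ?_
  refine ((hg.1 z).biUnion fun y _ => hf.1 y).subset fun x hx => ?_
  exact Set.mem_biUnion (x := f x) hx rfl

/-- The fibre product as an object. -/
def fibreProd {A B X : GSet TS.C} (p : A →[G] X) (q : B →[G] X) : GSet TS.C where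
  carrier := FibreProd p q
  stab_mem z := by
    rw [FibreProd.stab]
    exact inf_mem (A.stab_mem _) (B.stab_mem _)

theorem fst_finite {A B X : GSet TS.C} (p : A →[G] X) {q : B →[G] X} (hq : TS.IsAdd q) (a : A) :
    {z : FibreProd p q | FibreProd.fst p q z = a}.Finite := by
  refine Set.Finite.of_injOn (f := fun z => z.1.2) (t := {b : B | q b = p a}) ?_ ?_ (hq.1 _)
  · rintro z rfl
    exact z.2.symm
  · rintro z rfl w hw h
    exact Subtype.ext (Prod.ext hw.symm h)

theorem isAdd_fst {A B X : GSet TS.C} (p : A →[G] X) {q : B →[G] X} (hq : TS.IsAdd q) :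
    TS.IsAdd (FibreProd.fst p q) :=
  isAdd_of_finite (fibreProd p q).stab_mem _ (fst_finite p hq)

theorem isMul_snd {A B X : GSet TS.C} {p : A →[G] X} (hp : TS.IsMul p) (q : B →[G] X) :
    TS.IsMul (FibreProd.snd p q) := by
  constructor
  · intro b
    refine Set.Finite.of_injOn (f := fun z => z.1.1) (t := {a : A | p a = q b}) ?_ ?_ (hp.1 _)
    · rintro z rfl
      exact z.2
    · rintro z rfl w hw h
      exact Subtype.ext (Prod.ext h hw.symm)
  · intro z
    rw [FibreProd.stab]
    have h1 := hp.2 z.1.1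
    have h2 : MulAction.stabilizer G z.1.2 ≤ MulAction.stabilizer G (p z.1.1) := by
      rw [z.2]
      exact stab_le q _
    exact TS.mackey.inf _ (X.stab_mem _) _ h1 _ (B.stab_mem _) h2

theorem transporter_mem {A : GSet TS.C} (a b : A) (g : G) (hg : g • a = b) :
    {h : G | h • a = b} ∈ TS.sets := by
  have := TS.left_mem _ (A.stab_mem a) g
  convert this using 1
  ext h
  constructor
  · intro hh
    refine ⟨g⁻¹ * h, ?_, by simp⟩
    show (g⁻¹ * h) • a = a
    rw [mul_smul, inv_smul_eq_iff]
    exact Eq.trans hh hg.symm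
  · rintro ⟨k, hk, rfl⟩
    show (g * k) • a = b
    have hk' : k • a = a := hk
    rw [mul_smul, hk', hg]

theorem finite_union_mem {ι : Type u} (s : Set ι) (hs : s.Finite) (F : ι → Set G)
    (hF : ∀ i ∈ s, F i = ∅ ∨ F i ∈ TS.sets) :
    (⋃ i ∈ s, F i) = ∅ ∨ (⋃ i ∈ s, F i) ∈ TS.sets := by
  induction s, hs using Set.Finite.induction_on with
  | empty => simp
  | @insert a s _ _ ih =>
    rw [Set.biUnion_insert]
    rcases hF a (Set.mem_insert _ _) with h | h <;>
      rcases ih fun i hi => hF i (Set.mem_insert_of_mem _ hi) with h' | h'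
    · left
      rw [h, h', Set.empty_union]
    · right
      rw [h, Set.empty_union]
      exact h'
    · right
      rw [h', Set.union_empty]
      exact h
    · right
      exact TS.union_mem _ h _ h'

theorem finite_inter_mem {ι : Type u} (s : Set ι) (hs : s.Finite) (F : ι → Set G) (T : Set G)
    (hT : T ∈ TS.sets) (hF : ∀ i ∈ s, F i ∈ TS.sets) : (T ∩ ⋂ i ∈ s, F i) ∈ TS.sets := by
  induction s, hs using Set.Finite.induction_on with
  | empty => simpa using hT
  | @insert a s _ _ ih =>
    rw [Set.biInter_insert, Set.inter_left_comm]
    exact TS.inter_mem _ (hF a (Set.mem_insert _ _)) _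
      (ih fun i hi => hF i (Set.mem_insert_of_mem _ hi))

theorem piSet_stab {A X Y : GSet TS.C} {η : X →[G] Y} (hη : TS.IsMul η) (p : A →[G] X)
    (s : PiSet η p) : MulAction.stabilizer G s ∈ TS.C := by
  have hfin := hη.1 s.pt
  have h1 : ∀ (x : X) (hx : η x = s.pt),
      (⋃ x' ∈ {x' : X | η x' = s.pt}, {g : G | ∃ h' : η x' = s.pt, g • s.sec x hx = s.sec x' h'})
        ∈ TS.sets := by
    intro x hx
    refine (finite_union_mem _ hfin _ fun x' hx' => ?_).resolve_left ?_
    · by_cases hne : ∃ g : G, g • s.sec x hx = s.sec x' hx'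
      · right
        obtain ⟨g, hg⟩ := hne
        convert transporter_mem _ _ g hg using 1
        ext k
        exact ⟨fun ⟨_, h⟩ => h, fun h => ⟨hx', h⟩⟩
      · left
        refine Set.eq_empty_iff_forall_notMem.2 ?_
        rintro g ⟨_, hg⟩
        exact hne ⟨g, hg⟩
    · refine Set.Nonempty.ne_empty ⟨1, ?_⟩
      exact Set.mem_biUnion (x := x) hx ⟨hx, one_smul G _⟩
  have h2 := finite_inter_mem {x : X | η x = s.pt} hfin
    (fun x => ⋃ x' ∈ {x' : X | η x' = s.pt},
      {g : G | ∃ (hx : η x = s.pt) (h' : η x' = s.pt), g • s.sec x hx = s.sec x' h'})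
    (MulAction.stabilizer G s.pt : Set G) (Y.stab_mem s.pt) (by
      intro x hx
      convert h1 x hx using 6
      exact ⟨fun ⟨_, h⟩ => h, fun h => ⟨hx, h⟩⟩)
  show (MulAction.stabilizer G s : Set G) ∈ TS.sets
  convert h2 using 1
  ext g
  simp only [SetLike.mem_coe, MulAction.mem_stabilizer_iff, Set.mem_inter_iff, Set.mem_iInter,
    Set.mem_iUnion, Set.mem_ofPred_eq]
  constructor
  · intro hg
    have hpt : g • s.pt = s.pt := congrArg PiSet.pt hg
    refine ⟨hpt, fun x hx => ?_⟩
    have hgx : η (g • x) = s.pt := by rw [map_smul, hx, hpt]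
    refine ⟨g • x, hgx, hx, hgx, ?_⟩
    have key : ∀ (t : PiSet η p) (_ : t = s) (ht : η (g • x) = t.pt),
        t.sec (g • x) ht = s.sec (g • x) hgx := by
      rintro t rfl ht
      rfl
    have h3 := key (g • s) hg (by rw [map_smul, hx]; rfl)
    rw [← h3]
    show _ = g • s.sec (g⁻¹ • g • x) _
    exact congrArg _ (PiSet.sec_congr s (by simp) _ _)
  · rintro ⟨hpt, h⟩
    refine PiSet.ext' hpt fun x hs ht => ?_
    have hx0 : η (g⁻¹ • x) = s.pt := PiSet.act_aux hs
    obtain ⟨x', _, _, hx', he⟩ := h (g⁻¹ • x) hx0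
    have hxx : x = x' := by
      have := congrArg p he
      rw [map_smul, s.p_sec, s.p_sec, smul_inv_smul] at this
      exact this
    show g • s.sec (g⁻¹ • x) _ = s.sec x ht
    rw [he]
    exact PiSet.sec_congr s hxx.symm _ _

/-- `Π_η(A)` as an object. -/
def piObj {A X Y : GSet TS.C} (η : X →[G] Y) (hη : TS.IsMul η) (p : A →[G] X) : GSet TS.C where
  carrier := PiSet η p
  stab_mem := piSet_stab hη p

theorem isAdd_proj {A X Y : GSet TS.C} {η : X →[G] Y} (hη : TS.IsMul η) {p : A →[G] X}
    (hp : TS.IsAdd p) : TS.IsAdd (PiSet.proj η p) :=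
  isAdd_of_finite (piSet_stab hη p) _ (PiSet.proj_finite η p hη.1 hp.1)

theorem isMul_rho {A X Y : GSet TS.C} {η : X →[G] Y} (hη : TS.IsMul η) (p : A →[G] X) :
    TS.IsMul (PiSet.rho η p) :=
  isMul_snd (B := piObj η hη p) hη (PiSet.proj η p)

/-- The disjoint union of two objects. -/
def sum (A B : GSet TS.C) : GSet TS.C where
  carrier := A ⊕ B
  stab_mem := by
    rintro (a | b)
    · convert A.stab_mem a using 1
      ext g
      simp [MulAction.mem_stabilizer_iff]
    · convert B.stab_mem b using 1
      ext g
      simp [MulAction.mem_stabilizer_iff]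

/-- The inclusion of the first summand. -/
def inl (A B : GSet TS.C) : A →[G] sum A B where
  toFun a := (Sum.inl a : A ⊕ B)
  map_smul' _ _ := rfl

/-- The inclusion of the second summand. -/
def inr (A B : GSet TS.C) : B →[G] sum A B where
  toFun b := (Sum.inr b : A ⊕ B)
  map_smul' _ _ := rfl

/-- The map `p ∪ q : A ⨿ B → X`. -/
def copair {A B X : GSet TS.C} (p : A →[G] X) (q : B →[G] X) : sum A B →[G] X where
  toFun z := Sum.elim (p : A → X) (q : B → X) z
  map_smul' g z := by
    rcases z with a | b
    · exact map_smul p g a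
    · exact map_smul q g b

theorem isAdd_copair {A B X : GSet TS.C} {p : A →[G] X} {q : B →[G] X} (hp : TS.IsAdd p)
    (hq : TS.IsAdd q) : TS.IsAdd (copair p q) := by
  refine isAdd_of_finite (sum A B).stab_mem _ fun x => ?_
  refine (((hp.1 x).image Sum.inl).union ((hq.1 x).image Sum.inr)).subset ?_
  rintro (a | b) h
  · exact Or.inl ⟨a, h, rfl⟩
  · exact Or.inr ⟨b, h, rfl⟩

end TambaraSystem

section Categories

variable {G : Type u} [Group G] (TS : TambaraSystem G)

/-- Semi-Mackey functors on the multiplicative Mackey system `(C, O)` of a Tambara system. -/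
abbrev SMack := SemiMackey TS.C TS.O

/-- Semi-Tambara functors: `pull`, `tr` and `nm` are the restrictions, the additive transfers and
the multiplicative transfers. The additive monoids with `pull` and `tr`, and the multiplicative
monoids with `pull` and `nm`, are semi-Mackey functors (the additivity axiom, a bijectivity
statement about `pull`, is common to both), and exponential diagrams are respected. -/
structure SemiTambara where
  obj : GSet TS.C → Type u
  [commSemiring : ∀ X, CommSemiring (obj X)]
  pull : ∀ {X Y : GSet TS.C}, (X →[G] Y) → (obj Y →+* obj X)
  tr : ∀ {X Y : GSet TS.C} (g : X →[G] Y), TS.IsAdd g → (obj X →+ obj Y)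
  nm : ∀ {X Y : GSet TS.C} (g : X →[G] Y), TS.IsMul g → (obj X →* obj Y)
  pull_id : ∀ (X : GSet TS.C) (m : obj X), pull (MulActionHom.id G : X →[G] X) m = m
  pull_comp : ∀ {X Y Z : GSet TS.C} (f : X →[G] Y) (g : Y →[G] Z) (m : obj Z),
    pull (g.comp f) m = pull f (pull g m)
  tr_id : ∀ (X : GSet TS.C) (h : TS.IsAdd (MulActionHom.id G : X →[G] X)) (m : obj X),
    tr (MulActionHom.id G : X →[G] X) h m = m
  tr_comp : ∀ {X Y Z : GSet TS.C} (f : X →[G] Y) (g : Y →[G] Z) (hf : TS.IsAdd f)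
    (hg : TS.IsAdd g) (hgf : TS.IsAdd (g.comp f)) (m : obj X),
    tr (g.comp f) hgf m = tr g hg (tr f hf m)
  nm_id : ∀ (X : GSet TS.C) (h : TS.IsMul (MulActionHom.id G : X →[G] X)) (m : obj X),
    nm (MulActionHom.id G : X →[G] X) h m = m
  nm_comp : ∀ {X Y Z : GSet TS.C} (f : X →[G] Y) (g : Y →[G] Z) (hf : TS.IsMul f)
    (hg : TS.IsMul g) (hgf : TS.IsMul (g.comp f)) (m : obj X),
    nm (g.comp f) hgf m = nm g hg (nm f hf m)
  tr_mackey : ∀ {X' Y' X Y : GSet TS.C} (g' : X' →[G] Y') (f' : X' →[G] X) (f : Y' →[G] Y)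
    (g : X →[G] Y) (hg' : TS.IsAdd g') (hg : TS.IsAdd g), IsPullbackSquare g' f' f g →
    ∀ m : obj X, pull f (tr g hg m) = tr g' hg' (pull f' m)
  nm_mackey : ∀ {X' Y' X Y : GSet TS.C} (g' : X' →[G] Y') (f' : X' →[G] X) (f : Y' →[G] Y)
    (g : X →[G] Y) (hg' : TS.IsMul g') (hg : TS.IsMul g), IsPullbackSquare g' f' f g →
    ∀ m : obj X, pull f (nm g hg m) = nm g' hg' (pull f' m)
  additive : ∀ {L : Type u} {X : GSet TS.C} (F : L → GSet TS.C) (i : ∀ l, F l →[G] X),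
    IsDirectSum F i → Function.Bijective (fun (m : obj X) (l : L) => pull (i l) m)
  exponential : ∀ {X Y Z X' Y' : GSet TS.C} (η : X →[G] Y) (ξ : Z →[G] X) (ζ : X' →[G] Z)
    (η' : X' →[G] Y') (υ : Y' →[G] Y) (hη : TS.IsMul η) (hξ : TS.IsAdd ξ) (hη' : TS.IsMul η')
    (hυ : TS.IsAdd υ), IsExponential η ξ ζ η' υ →
    ∀ m : obj Z, tr υ hυ (nm η' hη' (pull ζ m)) = nm η hη (tr ξ hξ m)

instance (T : SemiTambara TS) (X : GSet TS.C) : CommSemiring (T.obj X) := T.commSemiring X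

variable {TS} in
/-- Morphisms of semi-Tambara functors. -/
@[ext]
structure SemiTambara.Hom (S T : SemiTambara TS) where
  app : ∀ X : GSet TS.C, S.obj X →+* T.obj X
  app_pull : ∀ {X Y : GSet TS.C} (f : X →[G] Y) (m : S.obj Y),
    app X (S.pull f m) = T.pull f (app Y m)
  app_tr : ∀ {X Y : GSet TS.C} (g : X →[G] Y) (hg : TS.IsAdd g) (m : S.obj X),
    app Y (S.tr g hg m) = T.tr g hg (app X m)
  app_nm : ∀ {X Y : GSet TS.C} (g : X →[G] Y) (hg : TS.IsMul g) (m : S.obj X),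
    app Y (S.nm g hg m) = T.nm g hg (app X m)

instance : Category.{u + 1} (SemiTambara TS) where
  Hom S T := SemiTambara.Hom S T
  id S := ⟨fun X => RingHom.id _, fun _ _ => rfl, fun _ _ _ => rfl, fun _ _ _ => rfl⟩
  comp φ ψ := ⟨fun X => (ψ.app X).comp (φ.app X),
    fun f m => by simp [φ.app_pull, ψ.app_pull],
    fun g hg m => by simp [φ.app_tr, ψ.app_tr],
    fun g hg m => by simp [φ.app_nm, ψ.app_nm]⟩

/-- The category of semi-Tambara functors. -/
abbrev STam := SemiTambara TS

/-- The property of being a Tambara functor: every semi-ring `T(X)` is a ring. -/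
def isTambara : ObjectProperty (STam TS) := fun T =>
  ∀ (X : GSet TS.C) (a : T.obj X), ∃ b : T.obj X, a + b = 0

/-- The category of Tambara functors, a full subcategory of `STam TS`. -/
abbrev Tam := (isTambara TS).FullSubcategory

/-- The inclusion of Tambara functors into semi-Tambara functors. -/
abbrev inclTam : Tam TS ⥤ STam TS := (isTambara TS).ι

/-- The functor `μ` sending a semi-Tambara functor to its multiplicative part. -/
def mulPart : STam TS ⥤ SMack TS where
  obj T :=
    { obj := T.obj
      pull := fun f => (T.pull f).toMonoidHom
      push := fun g hg => T.nm g hg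
      pull_id := T.pull_id
      pull_comp := T.pull_comp
      push_id := T.nm_id
      push_comp := T.nm_comp
      mackey := T.nm_mackey
      additive := T.additive }
  map ψ :=
    { app := fun X => (ψ.app X).toMonoidHom
      app_pull := ψ.app_pull
      app_push := ψ.app_nm }

end Categories

section Construction

variable {G : Type u} [Group G] {TS : TambaraSystem G}

open TambaraSystem

/-- The objects of the category `M-GSet/X`: pairs of `p : A → X` with finite fibres, and an
element `m` of `M(A)`. -/
structure Elt (M : SMack TS) (X : GSet TS.C) where
  A : GSet TS.C
  p : A →[G] X
  isAdd : TS.IsAdd p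
  m : M.obj A

/-- Isomorphism in the category `M-GSet/X`. -/
def Elt.Iso {M : SMack TS} {X : GSet TS.C} (a b : Elt M X) : Prop :=
  ∃ f : a.A →[G] b.A, Function.Bijective f ∧ b.p.comp f = a.p ∧ M.pull f b.m = a.m

theorem exists_glue (M : SMack TS) {A B : GSet TS.C} (m : M.obj A) (n : M.obj B) :
    ∃ k : M.obj (sum A B), M.pull (inl A B) k = m ∧ M.pull (inr A B) k = n := by
  let F : ULift.{u} Bool → GSet TS.C := fun l => if l.down then A else B
  let i : ∀ l, F l →[G] sum A B := fun l => match l with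
    | ⟨true⟩ => inl A B
    | ⟨false⟩ => inr A B
  have hi : IsDirectSum F i := by
    constructor
    · rintro ⟨⟨_ | _⟩, a⟩ ⟨⟨_ | _⟩, b⟩ h
      · obtain rfl : a = b := Sum.inr_injective (α := A) h
        rfl
      · exact (Sum.inr_ne_inl (show (Sum.inr a : A ⊕ B) = Sum.inl b from h)).elim
      · exact (Sum.inl_ne_inr (show (Sum.inl a : A ⊕ B) = Sum.inr b from h)).elim
      · obtain rfl : a = b := Sum.inl_injective (β := B) h
        rfl
    · rintro (a | b)
      · exact ⟨⟨⟨true⟩, a⟩, rfl⟩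
      · exact ⟨⟨⟨false⟩, b⟩, rfl⟩
  obtain ⟨k, hk⟩ := (M.additive F i hi).2 fun l => match l with
    | ⟨true⟩ => m
    | ⟨false⟩ => n
  exact ⟨k, congrFun hk ⟨true⟩, congrFun hk ⟨false⟩⟩

/-- The element `m ⨿ n` of `M(A ⨿ B)` which restricts to `m` on `A` and to `n` on `B`. -/
noncomputable def glue (M : SMack TS) {A B : GSet TS.C} (m : M.obj A) (n : M.obj B) :
    M.obj (sum A B) :=
  (exists_glue M m n).choose

namespace Elt

variable {M N : SMack TS} {X Y : GSet TS.C}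

/-- `(A → X, m) ⨿ (B → X, n) = (A ⨿ B → X, m ⨿ n)`. -/
noncomputable def add (a b : Elt M X) : Elt M X where
  A := sum a.A b.A
  p := copair a.p b.p
  isAdd := isAdd_copair a.isAdd b.isAdd
  m := glue M a.m b.m

/-- `(A → X, m) × (B → X, n) = (A ×_X B → X, m ⋆ n)`, where `m ⋆ n` is the product of the
restrictions of `m` and `n` to `A ×_X B`. -/
def mul (a b : Elt M X) : Elt M X where
  A := fibreProd a.p b.p
  p := a.p.comp (FibreProd.fst a.p b.p)
  isAdd := isAdd_comp (X := fibreProd a.p b.p) (isAdd_fst a.p b.isAdd) a.isAdd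
  m := M.pull (X := fibreProd a.p b.p) (FibreProd.fst a.p b.p) a.m *
    M.pull (X := fibreProd a.p b.p) (FibreProd.snd a.p b.p) b.m

/-- `f^*(A → X, m)`, by pulling back along `f : Y → X`. -/
def pull (f : Y →[G] X) (a : Elt M X) : Elt M Y where
  A := fibreProd f a.p
  p := FibreProd.fst f a.p
  isAdd := isAdd_fst f a.isAdd
  m := M.pull (X := fibreProd f a.p) (FibreProd.snd f a.p) a.m

/-- `ξ_+(A → X, m) = (A → X → Y, m)`. -/
def tr (ξ : X →[G] Y) (hξ : TS.IsAdd ξ) (a : Elt M X) : Elt M Y where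
  A := a.A
  p := ξ.comp a.p
  isAdd := isAdd_comp a.isAdd hξ
  m := a.m

/-- `η_•(A → X, m) = (Π_η(A) → Y, M_*(ρ) M^*(l) m)`, where `l : X ×_Y Π_η(A) → A` and
`ρ : X ×_Y Π_η(A) → Π_η(A)` are the evaluation and the projection. -/
def nm (η : X →[G] Y) (hη : TS.IsMul η) (a : Elt M X) : Elt M Y where
  A := piObj η hη a.p
  p := PiSet.proj η a.p
  isAdd := isAdd_proj hη a.isAdd
  m := M.push (X := fibreProd (B := piObj η hη a.p) η (PiSet.proj η a.p)) (Y := piObj η hη a.p)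
    (PiSet.rho η a.p) (isMul_rho hη a.p)
    (M.pull (X := fibreProd (B := piObj η hη a.p) η (PiSet.proj η a.p)) (PiSet.eval η a.p) a.m)

/-- The map on pairs `(A → X, m)` induced by a morphism of semi-Mackey functors. -/
def map (φ : M ⟶ N) (a : Elt M X) : Elt N X where
  A := a.A
  p := a.p
  isAdd := a.isAdd
  m := SemiMackey.Hom.app φ a.A a.m

end Elt

/-- `S` is the functor `𝒮`: the elements of `(S M)(X)` are the isomorphism classes `cls a` of the
objects `a` of `M-GSet/X`, with the semi-ring operations and the structure morphisms described on
representatives. (The zero is then the class of `∅ → X`, the unit that of `id_X` with `1`.) -/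
structure SemiTambarization (S : SMack TS ⥤ STam TS) where
  cls : ∀ {M : SMack TS} {X : GSet TS.C}, Elt M X → (S.obj M).obj X
  cls_surjective : ∀ {M : SMack TS} {X : GSet TS.C},
    Function.Surjective (cls : Elt M X → (S.obj M).obj X)
  cls_eq_iff : ∀ {M : SMack TS} {X : GSet TS.C} (a b : Elt M X), cls a = cls b ↔ a.Iso b
  cls_add : ∀ {M : SMack TS} {X : GSet TS.C} (a b : Elt M X), cls (a.add b) = cls a + cls b
  cls_mul : ∀ {M : SMack TS} {X : GSet TS.C} (a b : Elt M X), cls (a.mul b) = cls a * cls b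
  cls_pull : ∀ {M : SMack TS} {X Y : GSet TS.C} (f : Y →[G] X) (a : Elt M X),
    cls (a.pull f) = (S.obj M).pull f (cls a)
  cls_tr : ∀ {M : SMack TS} {X Y : GSet TS.C} (ξ : X →[G] Y) (hξ : TS.IsAdd ξ) (a : Elt M X),
    cls (a.tr ξ hξ) = (S.obj M).tr ξ hξ (cls a)
  cls_nm : ∀ {M : SMack TS} {X Y : GSet TS.C} (η : X →[G] Y) (hη : TS.IsMul η) (a : Elt M X),
    cls (a.nm η hη) = (S.obj M).nm η hη (cls a)
  cls_map : ∀ {M N : SMack TS} (φ : M ⟶ N) {X : GSet TS.C} (a : Elt M X),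
    cls (a.map φ) = SemiTambara.Hom.app (S.map φ) X (cls a)

/-- `f : R → A` is the ring completion (Grothendieck ring `K₀`) of the semi-ring `R`: `A` consists
of the formal differences `f x - f y`, and `f x = f y` iff `x + c = y + c` for some `c`. -/
def IsRingCompletion {R A : Type u} [CommSemiring R] [CommSemiring A] (f : R →+* A) : Prop :=
  (∀ a : A, ∃ b : A, a + b = 0) ∧ (∀ a : A, ∃ x y : R, a + f y = f x) ∧
    ∀ x y : R, f x = f y ↔ ∃ c : R, x + c = y + c

/-- `γ` is the functor of ring completion: `(γ T)(X) = K₀(T(X))`, and the structure morphisms of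
`γ T` and the morphisms `γ ψ` extend those of `T` and `ψ` along the canonical maps
`T(X) → K₀(T(X))`. -/
structure RingCompletion (γ : STam TS ⥤ Tam TS) where
  unit : 𝟭 (STam TS) ⟶ γ ⋙ inclTam TS
  isRingCompletion : ∀ (T : STam TS) (X : GSet TS.C),
    IsRingCompletion (SemiTambara.Hom.app (unit.app T) X)

end Construction

section OnePoint

variable {G : Type u} [Group G] (TS : TambaraSystem G)

/-- The one-point `G`-set. -/
def point (h : (⊤ : Subgroup G) ∈ TS.C) : GSet TS.C where
  carrier := PUnit.{u + 1}
  act :=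
    { smul := fun _ x => x
      one_smul := fun _ => rfl
      mul_smul := fun _ _ _ => rfl }
  stab_mem x := by
    convert h
    exact eq_top_iff.2 fun _ _ => rfl

/-- Evaluation of semi-Mackey functors at the one-point `G`-set. -/
def evSMack (h : (⊤ : Subgroup G) ∈ TS.C) : SMack TS ⥤ CommMonCat.{u} where
  obj M := CommMonCat.of (M.obj (point TS h))
  map φ := CommMonCat.ofHom (SemiMackey.Hom.app φ (point TS h))

/-- The ring structure on the value of a Tambara functor. -/
noncomputable abbrev ringOfTambara (T : Tam TS) (X : GSet TS.C) : CommRing (T.obj.obj X) :=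
  { T.obj.commSemiring X with
    neg := fun a => (T.property X a).choose
    zsmul := @zsmulRec _ _ _ ⟨fun a => (T.property X a).choose⟩ nsmulRec
    neg_add_cancel := fun a => (add_comm _ _).trans (T.property X a).choose_spec }

/-- Evaluation of Tambara functors at the one-point `G`-set. -/
noncomputable def evTam (h : (⊤ : Subgroup G) ∈ TS.C) : Tam TS ⥤ CommRingCat.{u} where
  obj T := @CommRingCat.of (T.obj.obj (point TS h)) (ringOfTambara TS T (point TS h))
  map {T T'} ψ := @CommRingCat.ofHom _ _ (ringOfTambara TS T (point TS h))
    (ringOfTambara TS T' (point TS h)) (SemiTambara.Hom.app ψ.hom (point TS h))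

/-- The monoid-ring functor `ℤ[-]`. -/
noncomputable def monoidRing : CommMonCat.{u} ⥤ CommRingCat.{u} where
  obj Q := CommRingCat.of (MonoidAlgebra ℤ Q)
  map f := CommRingCat.ofHom (MonoidAlgebra.mapDomainRingHom ℤ f.hom)
  map_id Q := by
    ext : 1
    apply MonoidAlgebra.ringHom_ext <;> intro <;> simp
  map_comp f g := by
    ext : 1
    apply MonoidAlgebra.ringHom_ext <;> intro <;> simp

end OnePoint

end BiTam

namespace BiTam

section Polynomial

variable {A B C M : Type*} [AddCommMonoid A] [AddCommMonoid B] [AddCommMonoid C] [AddCommMonoid M]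

/-- `f` is a polynomial map of degree at most `n` between commutative monoids; differences
`f (a + b) - f a` are witnessed rather than formed by subtraction. -/
def IsPoly : ℕ → (A → B) → Prop
  | 0, f => ∀ a, f a = f 0
  | n + 1, f => ∀ b, ∃ g : A → B, IsPoly n g ∧ ∀ a, f (a + b) = f a + g a

namespace IsPoly

theorem const (n : ℕ) (c : B) : IsPoly n (fun _ : A => c) := by
  induction n generalizing c with
  | zero => exact fun _ => rfl
  | succ n ih => exact fun _ => ⟨fun _ => 0, ih 0, fun _ => (add_zero c).symm⟩

theorem succ {n : ℕ} {f : A → B} (hf : IsPoly n f) : IsPoly (n + 1) f := by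
  induction n generalizing f with
  | zero => exact fun b => ⟨fun _ => 0, const 0 0, fun a => by rw [hf, hf a, add_zero]⟩
  | succ n ih =>
    intro b
    obtain ⟨g, hg, h⟩ := hf b
    exact ⟨g, ih hg, h⟩

theorem mono {m n : ℕ} (h : m ≤ n) {f : A → B} (hf : IsPoly m f) : IsPoly n f := by
  induction h with
  | refl => exact hf
  | step _ ih => exact ih.succ

theorem add {n : ℕ} {f g : A → B} (hf : IsPoly n f) (hg : IsPoly n g) :
    IsPoly n (fun a => f a + g a) := by
  induction n generalizing f g with
  | zero => exact fun a => by simp only [hf a, hg a]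
  | succ n ih =>
    intro b
    obtain ⟨f', hf', h1⟩ := hf b
    obtain ⟨g', hg', h2⟩ := hg b
    exact ⟨_, ih hf' hg', fun a => by dsimp only; rw [h1, h2, add_add_add_comm]⟩

theorem map {n : ℕ} {f : A → B} (hf : IsPoly n f) (φ : B →+ C) : IsPoly n (fun a => φ (f a)) := by
  induction n generalizing f with
  | zero => exact fun a => by simp only [hf a]
  | succ n ih =>
    intro b
    obtain ⟨g, hg, h⟩ := hf b
    exact ⟨_, ih hg, fun a => by dsimp only; rw [h, map_add]⟩

theorem sub {C : Type*} [AddCommGroup C] {n : ℕ} {f g : A → C} (hf : IsPoly n f)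
    (hg : IsPoly n g) : IsPoly n (fun a => f a - g a) := by
  simp only [sub_eq_add_neg]
  exact hf.add (hg.map (-AddMonoidHom.id C))

theorem comp {n : ℕ} {f : A → B} (hf : IsPoly n f) (φ : M →+ A) : IsPoly n (fun a => f (φ a)) := by
  induction n generalizing f with
  | zero => exact fun a => by dsimp only; rw [hf, hf (φ 0)]
  | succ n ih =>
    intro b
    obtain ⟨g, hg, h⟩ := hf (φ b)
    exact ⟨_, ih hg, fun a => by dsimp only; rw [map_add, h]⟩

theorem translate {n : ℕ} {f : A → B} (hf : IsPoly n f) (c : A) :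
    IsPoly n (fun a => f (a + c)) := by
  induction n generalizing f with
  | zero => exact fun a => by dsimp only; rw [hf, hf (0 + c)]
  | succ n ih =>
    intro b
    obtain ⟨g, hg, h⟩ := hf b
    exact ⟨_, ih hg, fun a => by dsimp only; rw [add_right_comm, h]⟩

theorem addMonoidHom (φ : A →+ B) : IsPoly 1 φ :=
  fun b => ⟨fun _ => φ b, const 0 _, fun a => map_add φ a b⟩

/-- Polynomial maps which agree on `M` agree on its group completion. -/
theorem eq_of_eq [IsCancelAdd B] {n : ℕ} {f g : A → B} (hf : IsPoly n f) (hg : IsPoly n g)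
    (i : M →+ A) (hi : ∀ a, ∃ x y, a + i y = i x) (h : ∀ x, f (i x) = g (i x)) (a : A) :
    f a = g a := by
  induction n generalizing f g a with
  | zero =>
    have := h 0
    rw [map_zero] at this
    rw [hf, hg, this]
  | succ n ih =>
    obtain ⟨x, y, hxy⟩ := hi a
    obtain ⟨f', hf', h1⟩ := hf (i y)
    obtain ⟨g', hg', h2⟩ := hg (i y)
    have key := ih hf' hg' (fun z => by
      have := h (z + y)
      rw [map_add, h1, h2, h] at this
      exact add_left_cancel this) a
    have := h x
    rw [← hxy, h1, h2, key] at this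
    exact add_right_cancel this

/-- Substituting polynomial maps in a map that is polynomial in each variable. -/
theorem exists_subst {C : Type*} [AddCommGroup C] (n j k : ℕ) : ∃ N, ∀ (H : A → B → C) (f : A → B),
    (∀ a, IsPoly j (H a)) → (∀ b, IsPoly k (fun a => H a b)) → IsPoly n f →
      IsPoly N (fun a => H a (f a)) := by
  induction n generalizing j k with
  | zero =>
    refine ⟨k, fun H f _ h2 h3 => ?_⟩
    have : f = fun _ => f 0 := funext h3
    rw [this]
    exact h2 _
  | succ n ihn =>
    induction j generalizing k with
    | zero =>
      refine ⟨k, fun H f h1 h2 _ => ?_⟩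
      have : (fun a => H a (f a)) = fun a => H a 0 := funext fun a => h1 a _
      rw [this]
      exact h2 _
    | succ j ihj =>
      have second : ∀ k, ∃ N₂, ∀ (H : A → B → C) (f h : A → B) (c : A),
          (∀ a, IsPoly (j + 1) (H a)) → (∀ b, IsPoly k (fun a => H a b)) → IsPoly (n + 1) f →
          IsPoly n h → IsPoly N₂ (fun a => H (a + c) (f a + h a) - H (a + c) (f a)) := by
        intro k
        obtain ⟨N', hN'⟩ := ihn (j + 1) k
        obtain ⟨N₂, hN₂⟩ := ihj (max k N')
        refine ⟨N₂, fun H f h c h1 h2 h3 h4 =>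
          hN₂ (fun a b => H (a + c) (b + h a) - H (a + c) b) f (fun a => ?_) (fun b => ?_) h3⟩
        · obtain ⟨g, hg, hh⟩ := h1 (a + c) (h a)
          convert hg using 2 with b
          rw [hh]
          abel
        · have e1 := hN' (fun a u => H (a + c) (b + u)) h
            (fun a => by simpa only [add_comm] using (h1 (a + c)).translate b)
            (fun u => (h2 (b + u)).translate c) h4
          exact sub (e1.mono (le_max_right k N')) (((h2 b).translate c).mono (le_max_left k N'))
      induction k with
      | zero =>
        obtain ⟨N₂, hN₂⟩ := second 0
        refine ⟨N₂ + 1, fun H f h1 h2 h3 c => ?_⟩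
        obtain ⟨h, hh, hf⟩ := h3 c
        refine ⟨_, hN₂ H f h c h1 h2 h3 hh, fun a => ?_⟩
        have e1 : H (a + c) (f a) = H 0 (f a) := h2 (f a) (a + c)
        have e2 : H a (f a) = H 0 (f a) := h2 (f a) a
        dsimp only
        rw [hf, e1, e2]
        abel
      | succ k ihk =>
        obtain ⟨N₁, hN₁⟩ := ihk
        obtain ⟨N₂, hN₂⟩ := second (k + 1)
        refine ⟨max N₁ N₂ + 1, fun H f h1 h2 h3 c => ?_⟩
        obtain ⟨h, hh, hf⟩ := h3 c
        have first := hN₁ (fun a b => H (a + c) b - H a b) f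
          (fun a => sub (h1 (a + c)) (h1 a)) (fun b => by
            obtain ⟨g, hg, e⟩ := h2 b c
            convert hg using 2 with a
            rw [show H (a + c) b = H a b + g a from e a]
            abel) h3
        refine ⟨_, (first.mono (le_max_left _ _)).add
          ((hN₂ H f h c h1 h2 h3 hh).mono (le_max_right _ _)), fun a => ?_⟩
        dsimp only
        rw [hf]
        abel

theorem exists_comp {C : Type*} [AddCommGroup C] {m n : ℕ} {g : B → C} {f : A → B}
    (hg : IsPoly m g) (hf : IsPoly n f) : ∃ N, IsPoly N (fun a => g (f a)) := by
  obtain ⟨N, hN⟩ := exists_subst (A := A) (B := B) (C := C) n m 0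
  exact ⟨N, hN (fun _ => g) f (fun _ => hg) (fun b => const 0 _) hf⟩

/-- A polynomial map extends along group completion. -/
theorem exists_extension {C : Type*} [AddCommGroup C] {n : ℕ} {f : M → C} (hf : IsPoly n f)
    (i : M →+ A) (hi : ∀ a, ∃ x y, a + i y = i x)
    (hi' : ∀ x y, i x = i y → ∃ c, x + c = y + c) :
    ∃ F : A → C, IsPoly n F ∧ ∀ x, F (i x) = f x := by
  induction n generalizing f with
  | zero => exact ⟨fun _ => f 0, const 0 _, fun x => (hf x).symm⟩
  | succ n ih =>
    choose g hg hfg using hf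
    choose D hD hDg using fun y => ih (hg y)
    have hDi : ∀ x y, f (x + y) = f x + D y (i x) := fun x y => by rw [hDg, hfg]
    have cocycle : ∀ y z a, D (y + z) a = D y (a + i z) + D z a := by
      intro y z a
      refine eq_of_eq (f := D (y + z)) (hD _) (((hD y).translate (i z)).add (hD z)) i hi
        (fun x => ?_) a
      have e := hDi x (y + z)
      rw [add_comm y z, ← add_assoc, hDi, hDi, add_assoc, map_add] at e
      rw [add_comm y z, ← add_left_cancel e, add_comm]
    choose X Y hXY using hi
    have key : ∀ a x y, a + i y = i x → f (X a) - D (Y a) a = f x - D y a := by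
      intro a x y h
      obtain ⟨c, hc⟩ := hi' (x + Y a) (X a + y) (by
        rw [map_add, map_add, ← h, ← hXY a, add_right_comm])
      have e : ∀ x y z, a + i y = i x → f (x + z) = f x - D y a + D (z + y) a := by
        intro x y z h
        rw [hDi, ← h, cocycle]
        abel
      have e1 := e x y (Y a + c) h
      have e2 := e (X a) (Y a) (y + c) (hXY a)
      rw [← add_assoc, hc, add_assoc, e2] at e1
      rw [show Y a + c + y = y + c + Y a by abel] at e1
      exact add_right_cancel e1
    refine ⟨fun a => f (X a) - D (Y a) a, fun b => ?_, fun x => ?_⟩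
    · refine ⟨fun a => D (X b) a - D (Y b) (a + b), sub (hD _) ((hD _).translate b), fun a => ?_⟩
      have h1 := key a (X a + X b) (Y a + X b) (by rw [map_add, map_add, ← add_assoc, hXY])
      have h2 := key (a + b) (X a + X b) (Y a + Y b) (by
        rw [map_add, map_add, add_add_add_comm, hXY, hXY])
      dsimp only
      rw [h2, h1, cocycle, cocycle, add_assoc a b, hXY b]
      abel
    · have h0 : D 0 (i x) = 0 := by
        have := hDi x 0
        rwa [add_zero, left_eq_add] at this
      have := key (i x) x 0 (by rw [map_zero, add_zero])
      dsimp only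
      rw [this, h0, sub_zero]

end IsPoly

end Polynomial

section Completion

/-- The Grothendieck ring of a commutative semiring. -/
abbrev K0 (R : Type u) [CommSemiring R] : Type u := TensorProduct ℕ ℤ R

/-- The canonical map from a semiring to its Grothendieck ring. -/
noncomputable def K0.of (R : Type u) [CommSemiring R] : R →+* K0 R :=
  (Algebra.TensorProduct.includeRight : R →ₐ[ℕ] TensorProduct ℕ ℤ R).toRingHom

theorem K0.isRingCompletion (R : Type u) [CommSemiring R] : IsRingCompletion (K0.of R) := by
  refine ⟨fun a => ⟨-a, add_neg_cancel a⟩, fun a => ?_, fun x y => ⟨fun h => ?_, ?_⟩⟩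
  · induction a using TensorProduct.induction_on with
    | zero => exact ⟨0, 0, zero_add _⟩
    | tmul z r =>
      have of_nsmul (n : ℕ) : (n : ℤ) ⊗ₜ[ℕ] r = K0.of R (n • r) := by
        rw [show (n : ℤ) = n • (1 : ℤ) by simp, TensorProduct.smul_tmul]
        rfl
      obtain ⟨n, rfl | rfl⟩ := z.eq_nat_or_neg
      · exact ⟨n • r, 0, by rw [map_zero, add_zero, of_nsmul]⟩
      · exact ⟨0, n • r, by
          rw [map_zero, ← of_nsmul, ← TensorProduct.add_tmul, neg_add_cancel,
            TensorProduct.zero_tmul]⟩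
    | add a b ha hb =>
      obtain ⟨x, y, h⟩ := ha
      obtain ⟨x', y', h'⟩ := hb
      exact ⟨x + x', y + y', by rw [map_add, map_add, add_add_add_comm, h, h']⟩
  · let φ : ℤ →ₗ[ℕ] R →ₗ[ℕ] Algebra.GrothendieckAddGroup R :=
      LinearMap.mk₂ ℕ (fun z r => z • Algebra.GrothendieckAddGroup.of r)
        (fun _ _ _ => add_smul _ _ _) (fun _ _ _ => smul_assoc _ _ _)
        (fun _ _ _ => by rw [map_add, smul_add])
        (fun _ _ _ => by rw [map_nsmul, smul_comm])
    have h1 := congrArg (TensorProduct.lift φ) h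
    have h2 (r : R) : TensorProduct.lift φ (K0.of R r) = Algebra.GrothendieckAddGroup.of r :=
      one_smul ℤ _
    rw [h2, h2] at h1
    obtain ⟨c, hc⟩ := (AddLocalization.addMonoidOf (⊤ : AddSubmonoid R)).eq_iff_exists.1 h1
    exact ⟨c, by rw [add_comm x, add_comm y, hc]⟩
  · rintro ⟨c, hc⟩
    have := congrArg (K0.of R) hc
    rw [map_add, map_add] at this
    exact add_right_cancel this

namespace IsRingCompletion

variable {R A : Type u} [CommSemiring R] [CommSemiring A] {f : R →+* A}

theorem exists_liftAdd {B : Type*} [AddCommGroup B] (h : IsRingCompletion f) (φ : R →+ B) :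
    ∃ ψ : A →+ B, ∀ x, ψ (f x) = φ x := by
  obtain ⟨_, h2, h3⟩ := h
  choose X Y hXY using h2
  have key : ∀ a x y, a + f y = f x → φ (X a) - φ (Y a) = φ x - φ y := by
    intro a x y e
    obtain ⟨c, hc⟩ := (h3 (x + Y a) (X a + y)).1 (by
      rw [map_add, map_add, ← e, ← hXY a, add_right_comm])
    have := congrArg φ hc
    simp only [map_add] at this
    rw [sub_eq_sub_iff_add_eq_add]
    exact (add_right_cancel this).symm
  refine ⟨⟨⟨fun a => φ (X a) - φ (Y a), ?_⟩, fun a b => ?_⟩, fun x => ?_⟩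
  · rw [key 0 0 0 (by simp)]
    simp
  · dsimp only
    rw [key (a + b) (X a + X b) (Y a + Y b) (by
      rw [map_add, map_add, add_add_add_comm, hXY, hXY]), map_add, map_add]
    abel
  · show φ (X (f x)) - φ (Y (f x)) = φ x
    rw [key (f x) x 0 (by simp)]
    simp

theorem addHom_ext {B : Type*} [AddMonoid B] [IsRightCancelAdd B] (h : IsRingCompletion f)
    {φ ψ : A →+ B} (e : ∀ x, φ (f x) = ψ (f x)) (a : A) : φ a = ψ a := by
  obtain ⟨x, y, hxy⟩ := h.2.1 a
  have h1 := congrArg φ hxy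
  have h2 := congrArg ψ hxy
  rw [map_add, e, e] at h1
  rw [map_add] at h2
  exact add_right_cancel (h1.trans h2.symm)

theorem exists_lift {B : Type*} [CommRing B] (h : IsRingCompletion f) (φ : R →+* B) :
    ∃ ψ : A →+* B, ∀ x, ψ (f x) = φ x := by
  obtain ⟨ψ, hψ⟩ := h.exists_liftAdd φ.toAddMonoidHom
  have h1 : ∀ (x : R) (a : A), ψ (f x * a) = φ x * ψ a := fun x a =>
    h.addHom_ext (φ := ψ.comp (AddMonoidHom.mulLeft (f x)))
      (ψ := (AddMonoidHom.mulLeft (φ x)).comp ψ) (fun y => by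
        show ψ (f x * f y) = φ x * ψ (f y)
        rw [← map_mul, hψ, hψ]
        exact map_mul φ x y) a
  have h2 : ∀ a b : A, ψ (a * b) = ψ a * ψ b := fun a b =>
    h.addHom_ext (φ := ψ.comp (AddMonoidHom.mulRight b))
      (ψ := (AddMonoidHom.mulRight (ψ b)).comp ψ) (fun x => by
        show ψ (f x * b) = ψ (f x) * ψ b
        rw [h1, hψ]
        rfl) a
  refine ⟨{ ψ with map_one' := ?_, map_mul' := h2 }, hψ⟩
  show ψ 1 = 1
  rw [← map_one f, hψ]
  exact map_one φ

theorem ringHom_ext {B : Type*} [CommRing B] (h : IsRingCompletion f) {φ ψ : A →+* B}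
    (e : ∀ x, φ (f x) = ψ (f x)) : φ = ψ :=
  RingHom.ext fun a => h.addHom_ext (φ := φ.toAddMonoidHom) (ψ := ψ.toAddMonoidHom) e a

theorem exists_isPoly_extension {B : Type*} [AddCommGroup B] (h : IsRingCompletion f) {n : ℕ}
    {φ : R → B} (hφ : IsPoly n φ) : ∃ F : A → B, IsPoly n F ∧ ∀ x, F (f x) = φ x :=
  hφ.exists_extension f.toAddMonoidHom h.2.1 fun x y e => (h.2.2 x y).1 e

theorem eq_of_isPoly {B : Type*} [AddCommGroup B] (h : IsRingCompletion f) {m n : ℕ} {φ ψ : A → B}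
    (hφ : IsPoly m φ) (hψ : IsPoly n ψ) (e : ∀ x, φ (f x) = ψ (f x)) (a : A) : φ a = ψ a :=
  (hφ.mono (le_max_left m n)).eq_of_eq (hψ.mono (le_max_right m n)) f.toAddMonoidHom h.2.1 e a

end IsRingCompletion

end Completion

section GSets

variable {G : Type u} [Group G] {C : Set (Subgroup G)} {O : Subgroup G → Set (Subgroup G)}

theorem stabilizer_eq_of_injective {X Y : Type u} [MulAction G X] [MulAction G Y] {f : X →[G] Y}
    (hf : Function.Injective f) (x : X) :
    MulAction.stabilizer G (f x) = MulAction.stabilizer G x := by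
  ext g
  rw [MulAction.mem_stabilizer_iff, MulAction.mem_stabilizer_iff, ← map_smul, hf.eq_iff]

theorem inO_of_injective (hO : ∀ H ∈ C, H ∈ O H) {X : GSet C} {Y : Type u} [MulAction G Y]
    {f : X →[G] Y} (hf : Function.Injective f) : InO O f := by
  refine ⟨fun y => Set.Subsingleton.finite fun a ha b hb => hf (ha.trans hb.symm), fun x => ?_⟩
  rw [stabilizer_eq_of_injective hf]
  exact hO _ (X.stab_mem x)

variable (C) in
/-- The empty `G`-set. -/
def empty : GSet C where
  carrier := PEmpty
  act := { smul := fun _ x => x, one_smul := fun _ => rfl, mul_smul := fun _ _ _ => rfl }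
  stab_mem x := x.elim

instance : IsEmpty (empty C) := inferInstanceAs (IsEmpty PEmpty)

/-- The map out of an empty `G`-set. -/
def ofEmpty (X Y : Type u) [MulAction G X] [MulAction G Y] [IsEmpty X] : X →[G] Y where
  toFun := isEmptyElim
  map_smul' _ := isEmptyElim

theorem inO_of_isEmpty {X Y : Type u} [MulAction G X] [MulAction G Y] [IsEmpty X] (f : X →[G] Y) :
    InO O f :=
  ⟨fun _ => Set.toFinite _, isEmptyElim⟩

theorem IsPullbackSquare.symm {X' Y' X Y : Type u} [MulAction G X'] [MulAction G Y']
    [MulAction G X] [MulAction G Y] {g' : X' →[G] Y'} {f' : X' →[G] X} {f : Y' →[G] Y}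
    {g : X →[G] Y} (h : IsPullbackSquare g' f' f g) : IsPullbackSquare f' g' g f :=
  ⟨fun x' => (h.1 x').symm, fun y' x e => by simpa only [and_comm] using h.2 x y' e.symm⟩

/-- The part of `Y` on which the invariant map `c` takes the value `l`. -/
def part (Y : GSet C) {L : Type*} (c : Y → L) (hc : ∀ (g : G) (y : Y), c (g • y) = c y) (l : L) :
    GSet C where
  carrier := {y : Y // c y = l}
  act :=
    { smul := fun g y => ⟨g • y.1, (hc g y.1).trans y.2⟩
      one_smul := fun y => Subtype.ext (one_smul G y.1)
      mul_smul := fun g h y => Subtype.ext (mul_smul g h y.1) }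
  stab_mem y := by
    convert Y.stab_mem y.1 using 1
    ext g
    exact Subtype.ext_iff

/-- The inclusion of a part. -/
def partIncl (Y : GSet C) {L : Type*} (c : Y → L) (hc : ∀ (g : G) (y : Y), c (g • y) = c y)
    (l : L) : part Y c hc l →[G] Y where
  toFun y := y.1
  map_smul' _ _ := rfl

theorem partIncl_injective (Y : GSet C) {L : Type*} (c : Y → L)
    (hc : ∀ (g : G) (y : Y), c (g • y) = c y) (l : L) :
    Function.Injective (partIncl Y c hc l) :=
  Subtype.val_injective

theorem isDirectSum_part (Y : GSet C) {L : Type u} (c : Y → L)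
    (hc : ∀ (g : G) (y : Y), c (g • y) = c y) :
    IsDirectSum (fun l => part Y c hc l) (partIncl Y c hc) := by
  constructor
  · rintro ⟨l, y, rfl⟩ ⟨l', y', rfl⟩ h
    obtain rfl : y = y' := h
    rfl
  · exact fun y => ⟨⟨c y, y, rfl⟩, rfl⟩

/-- `i` and `j` exhibit `D` as the disjoint union of `A` and `B`. -/
def IsCoprod {A B D : Type u} [MulAction G A] [MulAction G B] [MulAction G D] (i : A →[G] D)
    (j : B →[G] D) : Prop :=
  Function.Bijective (Sum.elim i j)

theorem IsCoprod.injective_left {A B D : Type u} [MulAction G A] [MulAction G B] [MulAction G D]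
    {i : A →[G] D} {j : B →[G] D} (h : IsCoprod i j) : Function.Injective i :=
  fun a b e => Sum.inl_injective (h.1 (a₁ := Sum.inl a) (a₂ := Sum.inl b) e)

theorem IsCoprod.injective_right {A B D : Type u} [MulAction G A] [MulAction G B] [MulAction G D]
    {i : A →[G] D} {j : B →[G] D} (h : IsCoprod i j) : Function.Injective j :=
  fun a b e => Sum.inr_injective (h.1 (a₁ := Sum.inr a) (a₂ := Sum.inr b) e)

theorem IsCoprod.ne {A B D : Type u} [MulAction G A] [MulAction G B] [MulAction G D]
    {i : A →[G] D} {j : B →[G] D} (h : IsCoprod i j) (a : A) (b : B) : i a ≠ j b :=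
  fun e => Sum.inl_ne_inr (h.1 (a₁ := Sum.inl a) (a₂ := Sum.inr b) e)

theorem IsCoprod.cases {A B D : Type u} [MulAction G A] [MulAction G B] [MulAction G D]
    {i : A →[G] D} {j : B →[G] D} (h : IsCoprod i j) (d : D) :
    (∃ a, i a = d) ∨ ∃ b, j b = d := by
  obtain ⟨a | b, rfl⟩ := h.2 d
  · exact Or.inl ⟨a, rfl⟩
  · exact Or.inr ⟨b, rfl⟩

theorem IsCoprod.of {A B D : Type u} [MulAction G A] [MulAction G B] [MulAction G D]
    {i : A →[G] D} {j : B →[G] D} (hi : Function.Injective i) (hj : Function.Injective j)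
    (hij : ∀ a b, i a ≠ j b) (h : ∀ d, (∃ a, i a = d) ∨ ∃ b, j b = d) : IsCoprod i j := by
  refine ⟨hi.sumElim hj hij, fun d => ?_⟩
  rcases h d with ⟨a, rfl⟩ | ⟨b, rfl⟩
  · exact ⟨Sum.inl a, rfl⟩
  · exact ⟨Sum.inr b, rfl⟩

/-- A decomposition into two parts as a family. -/
theorem IsCoprod.exists_isDirectSum {A B D : GSet C} {i : A →[G] D} {j : B →[G] D}
    (h : IsCoprod i j) :
    IsDirectSum (L := ULift.{u} Bool) (X := D) (fun l => if l.down then A else B)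
      (fun l => match l with
        | ⟨true⟩ => i
        | ⟨false⟩ => j) := by
  constructor
  · rintro ⟨⟨_ | _⟩, a⟩ ⟨⟨_ | _⟩, b⟩ e
    · obtain rfl : a = b := h.injective_right e
      rfl
    · exact (h.ne b a e.symm).elim
    · exact (h.ne a b e).elim
    · obtain rfl : a = b := h.injective_left e
      rfl
  · intro d
    rcases h.cases d with ⟨a, rfl⟩ | ⟨b, rfl⟩
    · exact ⟨⟨⟨true⟩, a⟩, rfl⟩
    · exact ⟨⟨⟨false⟩, b⟩, rfl⟩

/-- The parts of a decomposition of `Y` by an invariant predicate. -/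
theorem isCoprod_part (Y : GSet C) (c : Y → Prop) (hc : ∀ (g : G) (y : Y), c (g • y) = c y) :
    IsCoprod (partIncl Y c hc True) (partIncl Y c hc False) := by
  refine IsCoprod.of (partIncl_injective _ _ _ _) (partIncl_injective _ _ _ _) ?_ ?_
  · rintro ⟨a, ha⟩ ⟨b, hb⟩ h
    obtain rfl : a = b := h
    exact true_ne_false (ha.symm.trans hb)
  · intro d
    by_cases h : c d
    · exact Or.inl ⟨⟨d, eq_true h⟩, rfl⟩
    · exact Or.inr ⟨⟨d, eq_false h⟩, rfl⟩

end GSets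

section Mackey

variable {G : Type u} [Group G] {C : Set (Subgroup G)} {O : Subgroup G → Set (Subgroup G)}

namespace SemiMackey

variable (M : SemiMackey C O)

theorem subsingleton_of_isEmpty (X : GSet C) [IsEmpty X] : Subsingleton (M.obj X) := by
  have h := M.additive (L := PEmpty.{u + 1}) (X := X) (fun l => l.elim) (fun l => l.elim)
    ⟨fun z => z.1.elim, isEmptyElim⟩
  exact ⟨fun a b => h.1 (funext fun l => l.elim)⟩

theorem ext_of_isDirectSum {L : Type u} {X : GSet C} {F : L → GSet C} {i : ∀ l, F l →[G] X}
    (h : IsDirectSum F i) {m n : M.obj X} (e : ∀ l, M.pull (i l) m = M.pull (i l) n) : m = n :=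
  (M.additive F i h).1 (funext e)

theorem ext_of_isCoprod {A B D : GSet C} {i : A →[G] D} {j : B →[G] D} (h : IsCoprod i j)
    {m n : M.obj D} (e1 : M.pull i m = M.pull i n) (e2 : M.pull j m = M.pull j n) : m = n := by
  refine M.ext_of_isDirectSum h.exists_isDirectSum ?_
  rintro ⟨_ | _⟩
  · exact e2
  · exact e1

theorem exists_of_isCoprod {A B D : GSet C} {i : A →[G] D} {j : B →[G] D} (h : IsCoprod i j)
    (m : M.obj A) (n : M.obj B) : ∃ k : M.obj D, M.pull i k = m ∧ M.pull j k = n := by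
  obtain ⟨k, hk⟩ := (M.additive _ _ h.exists_isDirectSum).2 fun l => match l with
    | ⟨true⟩ => m
    | ⟨false⟩ => n
  exact ⟨k, congrFun hk ⟨true⟩, congrFun hk ⟨false⟩⟩

theorem pull_push_of_injective {X Y : GSet C} {f : X →[G] Y} (hf : Function.Injective f)
    (h : InO O f) (hid : InO O (MulActionHom.id G : X →[G] X)) (m : M.obj X) :
    M.pull f (M.push f h m) = m := by
  rw [M.mackey (MulActionHom.id G) (MulActionHom.id G) f f hid h
    ⟨fun _ => rfl, fun x y e => ⟨x, ⟨rfl, hf e⟩, fun z hz => hz.1⟩⟩, M.pull_id, M.push_id]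

theorem pull_push_of_disjoint {X Y Z : GSet C} {f : X →[G] Y} {g : Z →[G] Y}
    (h : ∀ x z, f x ≠ g z) (hf : InO O f) (m : M.obj X) : M.pull g (M.push f hf m) = 1 := by
  rw [M.mackey (X' := empty C) (ofEmpty _ _) (ofEmpty _ _) g f (inO_of_isEmpty _) hf
    ⟨isEmptyElim, fun x z e => (h x z e).elim⟩,
    (M.subsingleton_of_isEmpty (empty C)).elim (M.pull _ m) 1, map_one]

theorem push_eq_prod {L : Type u} [Fintype L] {X Y : GSet C} {F : L → GSet C}
    {i : ∀ l, F l →[G] X} (h : IsDirectSum F i) (hi : ∀ l, InO O (i l)) (g : X →[G] Y)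
    (hg : InO O g) (hgi : ∀ l, InO O (g.comp (i l))) (m : M.obj X) :
    M.push g hg m = ∏ l, M.push (g.comp (i l)) (hgi l) (M.pull (i l) m) := by
  classical
  have inj (l : L) : Function.Injective (i l) := fun a b e => by
    have := h.1 (a₁ := ⟨l, a⟩) (a₂ := ⟨l, b⟩) e
    simpa using this
  have key : m = ∏ l, M.push (i l) (hi l) (M.pull (i l) m) := by
    refine M.ext_of_isDirectSum h fun l => ?_
    rw [map_prod, Finset.prod_eq_single l]
    · have hid : InO O (MulActionHom.id G : F l →[G] F l) := by
        refine ⟨fun y => (Set.finite_singleton y).subset fun _ hx => hx, fun x => ?_⟩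
        have := (hi l).2 x
        rwa [stabilizer_eq_of_injective (inj l)] at this
      rw [M.pull_push_of_injective (inj l) _ hid]
    · intro l' _ hl
      refine M.pull_push_of_disjoint (fun x z e => hl ?_) _ _
      exact congrArg Sigma.fst (h.1 (a₁ := ⟨l', x⟩) (a₂ := ⟨l, z⟩) e)
    · exact fun hl => (hl (Finset.mem_univ l)).elim
  conv_lhs => rw [key]
  rw [map_prod]
  exact Finset.prod_congr rfl fun l _ => (M.push_comp _ _ _ _ _ _).symm

theorem push_eq_mul {A B D Y : GSet C} {i : A →[G] D} {j : B →[G] D} (h : IsCoprod i j)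
    (hi : InO O i) (hj : InO O j) (g : D →[G] Y) (hg : InO O g) (hgi : InO O (g.comp i))
    (hgj : InO O (g.comp j)) (m : M.obj D) :
    M.push g hg m = M.push (g.comp i) hgi (M.pull i m) * M.push (g.comp j) hgj (M.pull j m) := by
  rw [M.push_eq_prod h.exists_isDirectSum (by rintro ⟨_ | _⟩ <;> assumption) g hg
    (by rintro ⟨_ | _⟩ <;> assumption)]
  rw [← Equiv.ulift.symm.prod_comp, Fintype.prod_bool]
  rfl

end SemiMackey

end Mackey

section Exponentials

variable {G : Type u} [Group G]

/-- Pointwise description of the diagrams isomorphic to the canonical exponential diagram. -/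
structure IsExp {X Y A X' Y' : Type u} [MulAction G X] [MulAction G Y] [MulAction G A]
    [MulAction G X'] [MulAction G Y'] (η : X →[G] Y) (p : A →[G] X) (ζ : X' →[G] A)
    (η' : X' →[G] Y') (υ : Y' →[G] Y) : Prop where
  comm : ∀ x', η (p (ζ x')) = υ (η' x')
  lift : ∀ x y', η x = υ y' → ∃! x', p (ζ x') = x ∧ η' x' = y'
  sec : ∀ y (σ : ∀ x, η x = y → A), (∀ x h, p (σ x h) = x) →
    ∃! y', υ y' = y ∧ ∀ x' (h : η (p (ζ x')) = y), η' x' = y' → ζ x' = σ (p (ζ x')) h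

variable {X Y A X' Y' : Type u} [MulAction G X] [MulAction G Y] [MulAction G A]
    [MulAction G X'] [MulAction G Y'] {η : X →[G] Y} {p : A →[G] X} {ζ : X' →[G] A}
    {η' : X' →[G] Y'} {υ : Y' →[G] Y}

theorem IsExp.isExponential (h : IsExp η p ζ η' υ) : IsExponential η p ζ η' υ := by
  choose L hL hL' using h.lift
  have L_eq (x' : X') (x y' e) (h1 : p (ζ x') = x) (h2 : η' x' = y') : L x y' e = x' :=
    (hL' x y' e x' ⟨h1, h2⟩).symm
  let b : Y' →[G] PiSet η p :=
    { toFun := fun y' => ⟨υ y', fun x e => ζ (L x y' e), fun x e => (hL x y' e).1⟩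
      map_smul' := fun g y' => by
        refine PiSet.ext' (map_smul υ g y') fun x hs ht => ?_
        show ζ (L x (g • y') _) = g • ζ (L (g⁻¹ • x) y' _)
        rw [← map_smul]
        refine congrArg ζ (L_eq _ _ _ _ ?_ ?_)
        · rw [map_smul, map_smul, (hL _ _ _).1, smul_inv_smul]
        · rw [map_smul, (hL _ _ _).2] }
  let a : X' →[G] FibreProd η (PiSet.proj η p) :=
    { toFun := fun x' => ⟨(p (ζ x'), b (η' x')), h.comm x'⟩
      map_smul' := fun g x' => Subtype.ext (Prod.ext
        (by show p (ζ (g • x')) = g • p (ζ x'); rw [map_smul, map_smul])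
        (by show b (η' (g • x')) = g • b (η' x'); rw [map_smul, map_smul])) }
  have hb : ∀ s : PiSet η p, ∃! y', b y' = s := by
    intro s
    obtain ⟨y', ⟨h1, h2⟩, h3⟩ := h.sec s.pt s.sec s.p_sec
    refine ⟨y', PiSet.ext' h1 fun x hs ht => ?_, fun z hz => h3 z ?_⟩
    · have e := hL x y' hs
      show ζ (L x y' hs) = _
      rw [h2 (L x y' hs) (by rw [e.1, ht]) e.2]
      exact PiSet.sec_congr s e.1 _ _
    · subst hz
      refine ⟨rfl, ?_⟩
      rintro x' hx rfl
      show ζ x' = ζ (L (p (ζ x')) (η' x') hx)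
      rw [L_eq x' _ _ _ rfl rfl]
  refine ⟨a, b, ⟨?_, ?_⟩, ⟨?_, fun s => (hb s).exists⟩, ?_, fun _ => rfl, fun _ => rfl⟩
  · intro x' x'' e
    have e1 : p (ζ x') = p (ζ x'') := congrArg (fun z => z.1.1) e
    have e2 : b (η' x') = b (η' x'') := congrArg (fun z => z.1.2) e
    have e3 := (hb _).unique e2 rfl
    exact (h.lift _ _ (h.comm x'')).unique ⟨e1, e3⟩ ⟨rfl, rfl⟩
  · rintro ⟨⟨x, s⟩, hs⟩
    obtain ⟨y', rfl, -⟩ := hb s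
    have e : η x = υ y' := hs
    refine ⟨L x y' e, Subtype.ext (Prod.ext (hL x y' e).1 ?_)⟩
    show b (η' (L x y' e)) = b y'
    rw [(hL x y' e).2]
  · exact fun y' y'' e => (hb _).unique e rfl
  · intro x'
    show ζ (L (p (ζ x')) (η' x') _) = ζ x'
    exact congrArg ζ (L_eq x' _ _ _ rfl rfl)

theorem IsExponential.isExp (h : IsExponential η p ζ η' υ) : IsExp η p ζ η' υ := by
  obtain ⟨a, b, ha, hb, h1, h2, h3⟩ := h
  have hp (x' : X') : p (ζ x') = (a x').1.1 := by
    rw [← h1]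
    exact (a x').1.2.p_sec _ _
  refine ⟨fun x' => ?_, fun x y' e => ?_, fun y σ hσ => ?_⟩
  · rw [hp, ← h3, ← h2]
    exact (a x').2
  · obtain ⟨x', hx'⟩ := ha.2 ⟨(x, b y'), e.trans (h3 y').symm⟩
    have e2 : ∀ z, PiSet.rho η p (a z) = (a z).1.2 := fun _ => rfl
    refine ⟨x', ⟨?_, hb.1 ?_⟩, ?_⟩
    · rw [hp, hx']
    · rw [← h2, e2, hx']
    · rintro z ⟨rfl, rfl⟩
      refine ha.1 ?_
      rw [hx']
      exact Subtype.ext (Prod.ext (hp z).symm ((e2 z).symm.trans (h2 z)))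
  · obtain ⟨y', hy'⟩ := hb.2 ⟨y, σ, hσ⟩
    refine ⟨y', ⟨by rw [← h3, hy']; rfl, ?_⟩, ?_⟩
    · rintro x' hx rfl
      have e : (a x').1.2 = ⟨y, σ, hσ⟩ := (h2 x').trans hy'
      have key : ∀ (s : PiSet η p) (hs : η (a x').1.1 = s.pt), s = ⟨y, σ, hσ⟩ →
          s.sec (a x').1.1 hs = σ (p (ζ x')) hx := by
        rintro _ hs rfl
        exact PiSet.sec_congr ⟨y, σ, hσ⟩ (hp x').symm _ _
      rw [← key _ (a x').2 e, ← h1 x']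
      rfl
    · rintro z ⟨rfl, hz⟩
      refine hb.1 ?_
      rw [hy']
      refine PiSet.ext' (h3 z) fun x hs ht => ?_
      obtain ⟨x', hx'⟩ := ha.2 ⟨(x, b z), hs⟩
      have e0 : p (ζ x') = x := by rw [hp, hx']
      have e1 : η' x' = z := hb.1 (by rw [← h2, ← show (a x').1.2 = b z by rw [hx']]; rfl)
      calc (b z).sec x hs = PiSet.eval η p (a x') := by rw [hx']; rfl
        _ = σ (p (ζ x')) (by rw [e0]; exact ht) := (h1 x').trans (hz x' (by rw [e0]; exact ht) e1)
        _ = σ x ht := PiSet.sec_congr ⟨υ z, σ, hσ⟩ e0 _ _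

end Exponentials

section Squares

variable {G : Type u} [Group G] {TS : TambaraSystem G}

open TambaraSystem

theorem exists_inverse {X Y : Type u} [MulAction G X] [MulAction G Y] (f : X →[G] Y)
    (hf : Function.Bijective f) : ∃ g : Y →[G] X, f.comp g = MulActionHom.id G ∧
      g.comp f = MulActionHom.id G := by
  let e := Equiv.ofBijective f hf
  refine ⟨f.inverse e.symm e.left_inv e.right_inv, ?_, ?_⟩
  · ext y
    exact e.right_inv y
  · ext x
    exact e.left_inv x

theorem isMul_id (X : GSet TS.C) : TS.IsMul (MulActionHom.id G : X →[G] X) :=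
  inO_of_injective TS.self_mem fun _ _ h => h

theorem isMul_comp {X Y Z : GSet TS.C} {f : X →[G] Y} {g : Y →[G] Z} (hf : TS.IsMul f)
    (hg : TS.IsMul g) : TS.IsMul (g.comp f) := by
  refine ⟨fun z => ((hg.1 z).biUnion fun y _ => hf.1 y).subset fun x hx =>
    Set.mem_biUnion (x := f x) hx rfl, fun x => ?_⟩
  exact TS.mackey.trans _ (Z.stab_mem _) _ (hg.2 (f x)) (hf.2 x)

theorem isMul_of_square {X' Y' X Y : GSet TS.C} {g' : X' →[G] Y'} {f' : X' →[G] X}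
    {f : Y' →[G] Y} {g : X →[G] Y} (h : IsPullbackSquare g' f' f g) (hg : TS.IsMul g) :
    TS.IsMul g' := by
  have inj : ∀ a b, f' a = f' b → g' a = g' b → a = b := fun a b h1 h2 =>
    (h.2 (f' a) (g' a) (h.1 a).symm).unique ⟨rfl, rfl⟩ ⟨h1.symm, h2.symm⟩
  constructor
  · intro y'
    refine Set.Finite.of_injOn (f := f') (t := {x | g x = f y'}) ?_ ?_ (hg.1 _)
    · rintro x' rfl
      exact (h.1 x').symm
    · rintro a rfl b hb e
      exact inj a b e hb.symm
  · intro x'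
    have e : MulAction.stabilizer G x' =
        MulAction.stabilizer G (f' x') ⊓ MulAction.stabilizer G (g' x') := by
      ext k
      simp only [Subgroup.mem_inf, MulAction.mem_stabilizer_iff, ← map_smul]
      exact ⟨fun hk => by rw [hk]; exact ⟨rfl, rfl⟩, fun hk => inj _ _ hk.1 hk.2⟩
    rw [e]
    refine TS.mackey.inf _ (Y.stab_mem _) _ (hg.2 (f' x')) _ (Y'.stab_mem _) ?_
    rw [← h.1]
    exact stab_le f _

theorem isAdd_of_square {X' Y' X Y : GSet TS.C} {g' : X' →[G] Y'} {f' : X' →[G] X}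
    {f : Y' →[G] Y} {g : X →[G] Y} (h : IsPullbackSquare g' f' f g) (hg : TS.IsAdd g) :
    TS.IsAdd g' := by
  refine isAdd_of_finite X'.stab_mem _ fun y' => ?_
  refine Set.Finite.of_injOn (f := f') (t := {x | g x = f y'}) ?_ ?_ (hg.1 _)
  · rintro x' rfl
    exact (h.1 x').symm
  · rintro a rfl b hb e
    exact (h.2 (f' a) (g' a) (h.1 a).symm).unique ⟨rfl, rfl⟩ ⟨e.symm, hb⟩

theorem isAdd_of_injective {X Y : GSet TS.C} {f : X →[G] Y} (hf : Function.Injective f) :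
    TS.IsAdd f :=
  isAdd_of_finite X.stab_mem _ fun _ =>
    Set.Subsingleton.finite fun _ ha _ hb => hf (ha.trans hb.symm)

theorem isMul_of_injective {X Y : GSet TS.C} {f : X →[G] Y} (hf : Function.Injective f) :
    TS.IsMul f :=
  inO_of_injective TS.self_mem hf

theorem isMul_copair {A B X : GSet TS.C} {p : A →[G] X} {q : B →[G] X} (hp : TS.IsMul p)
    (hq : TS.IsMul q) : TS.IsMul (copair p q) := by
  constructor
  · intro x
    refine (((hp.1 x).image Sum.inl).union ((hq.1 x).image Sum.inr)).subset ?_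
    rintro (a | b) h
    · exact Or.inl ⟨a, h, rfl⟩
    · exact Or.inr ⟨b, h, rfl⟩
  · rintro (a | b)
    · show MulAction.stabilizer G (inl A B a) ∈ TS.O (MulAction.stabilizer G (p a))
      rw [stabilizer_eq_of_injective (f := inl A B) Sum.inl_injective]
      exact hp.2 a
    · show MulAction.stabilizer G (inr A B b) ∈ TS.O (MulAction.stabilizer G (q b))
      rw [stabilizer_eq_of_injective (f := inr A B) Sum.inr_injective]
      exact hq.2 b

theorem isCoprod_sum (A B : GSet TS.C) : IsCoprod (inl A B) (inr A B) :=
  IsCoprod.of Sum.inl_injective Sum.inr_injective (fun _ _ => Sum.inl_ne_inr) fun d => by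
    rcases d with a | b
    · exact Or.inl ⟨a, rfl⟩
    · exact Or.inr ⟨b, rfl⟩

/-- The first projection of a fibre product, as a map between objects. -/
def fpFst {A B X : GSet TS.C} (p : A →[G] X) (q : B →[G] X) : fibreProd p q →[G] A :=
  FibreProd.fst p q

/-- The second projection of a fibre product, as a map between objects. -/
def fpSnd {A B X : GSet TS.C} (p : A →[G] X) (q : B →[G] X) : fibreProd p q →[G] B :=
  FibreProd.snd p q

/-- The map into a fibre product with given components. -/
def fpLift {A B X D : GSet TS.C} {p : A →[G] X} {q : B →[G] X} (i : D →[G] A) (j : D →[G] B)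
    (h : ∀ d, p (i d) = q (j d)) : D →[G] fibreProd p q where
  toFun d := ⟨(i d, j d), h d⟩
  map_smul' g d := Subtype.ext (Prod.ext (map_smul i g d) (map_smul j g d))

theorem fp_ext {A B X : GSet TS.C} {p : A →[G] X} {q : B →[G] X} {z w : fibreProd p q}
    (h1 : fpFst p q z = fpFst p q w) (h2 : fpSnd p q z = fpSnd p q w) : z = w :=
  Subtype.ext (Prod.ext h1 h2)

theorem fp_comm {A B X : GSet TS.C} (p : A →[G] X) (q : B →[G] X) (z : fibreProd p q) :
    p (fpFst p q z) = q (fpSnd p q z) :=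
  z.2

theorem isPullbackSquare_fibreProd {A B X : GSet TS.C} (p : A →[G] X) (q : B →[G] X) :
    IsPullbackSquare (fpFst p q) (fpSnd p q) p q :=
  ⟨fp_comm p q, fun b a h => ⟨⟨(a, b), h.symm⟩, ⟨rfl, rfl⟩, fun _ hz => fp_ext hz.2 hz.1⟩⟩

theorem fpLift_bijective {A B X D : GSet TS.C} {p : A →[G] X} {q : B →[G] X} {i : D →[G] A}
    {j : D →[G] B} (h : IsPullbackSquare i j p q) : Function.Bijective (fpLift i j h.1) := by
  constructor
  · intro d d' e
    exact (h.2 (j d) (i d) (h.1 d).symm).unique ⟨rfl, rfl⟩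
      ⟨congrArg (fpSnd p q) e.symm, congrArg (fpFst p q) e.symm⟩
  · intro z
    obtain ⟨d, ⟨h1, h2⟩, -⟩ := h.2 (fpSnd p q z) (fpFst p q z) (fp_comm p q z).symm
    exact ⟨d, fp_ext h2 h1⟩

/-- `π : Π_η(A) → Y`, as a map between objects. -/
def piProj {A X Y : GSet TS.C} (η : X →[G] Y) (hη : TS.IsMul η) (p : A →[G] X) :
    piObj η hη p →[G] Y :=
  PiSet.proj η p

/-- The evaluation `X ×_Y Π_η(A) → A`, as a map between objects. -/
def piEval {A X Y : GSet TS.C} (η : X →[G] Y) (hη : TS.IsMul η) (p : A →[G] X) :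
    fibreProd η (piProj η hη p) →[G] A :=
  PiSet.eval η p

/-- `ρ : X ×_Y Π_η(A) → Π_η(A)`, as a map between objects. -/
def piRho {A X Y : GSet TS.C} (η : X →[G] Y) (hη : TS.IsMul η) (p : A →[G] X) :
    fibreProd η (piProj η hη p) →[G] piObj η hη p :=
  PiSet.rho η p

theorem isExponential_pi {A X Y : GSet TS.C} (η : X →[G] Y) (hη : TS.IsMul η) (p : A →[G] X) :
    IsExponential η p (piEval η hη p) (piRho η hη p) (piProj η hη p) :=
  ⟨MulActionHom.id G, MulActionHom.id G, Function.bijective_id, Function.bijective_id,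
    fun _ => rfl, fun _ => rfl, fun _ => rfl⟩

theorem IsExp.isPullbackSquare {X Y A X' Y' : GSet TS.C} {η : X →[G] Y} {p : A →[G] X}
    {ζ : X' →[G] A} {η' : X' →[G] Y'} {υ : Y' →[G] Y} (h : IsExp η p ζ η' υ) :
    IsPullbackSquare η' (p.comp ζ) υ η :=
  ⟨fun x' => (h.comm x').symm, h.lift⟩

end Squares

section Elements

variable {G : Type u} [Group G] {TS : TambaraSystem G}

open TambaraSystem

namespace Elt

variable {M N : SMack TS} {X Y : GSet TS.C}

theorem Iso.refl (a : Elt M X) : a.Iso a :=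
  ⟨MulActionHom.id G, Function.bijective_id, rfl, M.pull_id _ _⟩

theorem Iso.symm {a b : Elt M X} (h : a.Iso b) : b.Iso a := by
  obtain ⟨f, hf, hp, hm⟩ := h
  obtain ⟨g, h1, h2⟩ := exists_inverse f hf
  refine ⟨g, ⟨fun x y e => ?_, fun x => ⟨f x, DFunLike.congr_fun h2 x⟩⟩, ?_, ?_⟩
  · have := congrArg f e
    rwa [show f (g x) = x from DFunLike.congr_fun h1 x,
      show f (g y) = y from DFunLike.congr_fun h1 y] at this
  · ext x
    rw [← hp]
    exact congrArg b.p (DFunLike.congr_fun h1 x)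
  · rw [← hm, ← M.pull_comp, h1, M.pull_id]

theorem Iso.trans {a b c : Elt M X} (h : a.Iso b) (h' : b.Iso c) : a.Iso c := by
  obtain ⟨f, hf, hp, hm⟩ := h
  obtain ⟨g, hg, hq, hn⟩ := h'
  exact ⟨g.comp f, hg.comp hf, by rw [← hp, ← hq]; rfl, by rw [M.pull_comp, hn, hm]⟩

/-- The inverse image may be computed by any pull-back square. -/
theorem pull_iso {f : Y →[G] X} {a : Elt M X} {A' : GSet TS.C} {q : A' →[G] Y} {k : A' →[G] a.A}
    (h : IsPullbackSquare q k f a.p) (hq : TS.IsAdd q) :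
    Iso ⟨A', q, hq, M.pull k a.m⟩ (a.pull f) :=
  ⟨fpLift q k h.1, fpLift_bijective h, rfl, (M.pull_comp _ (fpSnd f a.p) _).symm⟩

/-- The product may be computed by any pull-back square. -/
theorem mul_iso {a b : Elt M X} {P : GSet TS.C} {i : P →[G] a.A} {j : P →[G] b.A}
    (h : IsPullbackSquare i j a.p b.p) {q : P →[G] X} (hq : TS.IsAdd q) (hqi : a.p.comp i = q) :
    Iso ⟨P, q, hq, M.pull i a.m * M.pull j b.m⟩ (a.mul b) := by
  refine ⟨fpLift i j h.1, fpLift_bijective h, hqi, ?_⟩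
  show M.pull (Y := fibreProd a.p b.p) (fpLift i j h.1)
    (M.pull (fpFst a.p b.p) a.m * M.pull (fpSnd a.p b.p) b.m) = _
  rw [map_mul, ← M.pull_comp, ← M.pull_comp]
  rfl

theorem glue_inl (M : SMack TS) {A B : GSet TS.C} (m : M.obj A) (n : M.obj B) :
    M.pull (inl A B) (glue M m n) = m :=
  (exists_glue M m n).choose_spec.1

theorem glue_inr (M : SMack TS) {A B : GSet TS.C} (m : M.obj A) (n : M.obj B) :
    M.pull (inr A B) (glue M m n) = n :=
  (exists_glue M m n).choose_spec.2

/-- The sum may be computed by any disjoint union. -/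
theorem add_iso {a b : Elt M X} {D : GSet TS.C} {i : a.A →[G] D} {j : b.A →[G] D}
    (h : IsCoprod i j) {q : D →[G] X} (hq : TS.IsAdd q) (hqi : q.comp i = a.p)
    (hqj : q.comp j = b.p) {k : M.obj D} (hi : M.pull i k = a.m) (hj : M.pull j k = b.m) :
    (a.add b).Iso ⟨D, q, hq, k⟩ := by
  refine ⟨copair i j, h, ?_, ?_⟩
  · ext z
    rcases z with z | z
    · exact DFunLike.congr_fun hqi z
    · exact DFunLike.congr_fun hqj z
  · refine M.ext_of_isCoprod (isCoprod_sum a.A b.A) ?_ ?_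
    · exact (M.pull_comp (inl _ _) (copair i j) k).symm.trans
        (hi.trans (glue_inl M a.m b.m).symm)
    · exact (M.pull_comp (inr _ _) (copair i j) k).symm.trans
        (hj.trans (glue_inr M a.m b.m).symm)

/-- The multiplicative transfer may be computed by any exponential diagram. -/
theorem nm_iso {η : X →[G] Y} {hη : TS.IsMul η} {a : Elt M X} {X' Y' : GSet TS.C}
    {ζ : X' →[G] a.A} {η' : X' →[G] Y'} {υ : Y' →[G] Y} (h : IsExponential η a.p ζ η' υ)
    (hη' : TS.IsMul η') (hυ : TS.IsAdd υ) :
    Iso ⟨Y', υ, hυ, M.push η' hη' (M.pull ζ a.m)⟩ (a.nm η hη) := by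
  obtain ⟨α, β, hα, hβ, h1, h2, h3⟩ := h
  refine ⟨β, hβ, MulActionHom.ext h3, ?_⟩
  have sq : IsPullbackSquare (X' := X') (Y' := Y') (X := fibreProd η (piProj η hη a.p))
      (Y := piObj η hη a.p) η' α β (piRho η hη a.p) := by
    refine ⟨fun x' => (h2 x').symm, fun z y' e => ?_⟩
    obtain ⟨x', rfl⟩ := hα.2 z
    refine ⟨x', ⟨rfl, hβ.1 ((h2 x').symm.trans e)⟩, fun w hw => hα.1 hw.1⟩
  refine (M.mackey η' (X := fibreProd η (piProj η hη a.p)) (Y := piObj η hη a.p) α β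
    (piRho η hη a.p) hη' (isMul_rho hη a.p) sq _).trans ?_
  refine congrArg (M.push η' hη') ?_
  refine (M.pull_comp (Y := fibreProd η (piProj η hη a.p)) α (piEval η hη a.p) a.m).symm.trans ?_
  exact congrArg (fun f => M.pull f a.m) (MulActionHom.ext h1)

end Elt

end Elements

section Classes

variable {G : Type u} [Group G] {TS : TambaraSystem G}

open TambaraSystem

/-- Isomorphism of pairs `(A → X, m)`. -/
def eltSetoid (M : SMack TS) (X : GSet TS.C) : Setoid (Elt M X) where
  r a b := a.Iso b
  iseqv := ⟨Elt.Iso.refl, Elt.Iso.symm, Elt.Iso.trans⟩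

instance small_quotient_eltSetoid (M : SMack TS) (X : GSet TS.C) :
    Small.{u} (Quotient (eltSetoid M X)) := by
  let D : Type u := Σ (S : Set (X × ℕ))
    (r : {r : MulAction G S // ∀ x : S, MulAction.stabilizer G x ∈ TS.C})
    (p : letI := r.1; {p : S →[G] X // TS.IsAdd p}),
    M.obj (letI := r.1; (⟨S, r.2⟩ : GSet TS.C))
  refine small_of_surjective (α := D)
    (f := fun d => Quotient.mk _
      ⟨(letI := d.2.1.1; (⟨d.1, d.2.1.2⟩ : GSet TS.C)), d.2.2.1.1, d.2.2.1.2, d.2.2.2⟩) ?_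
  intro q
  induction q using Quotient.inductionOn with | _ a => ?_
  obtain ⟨A, p, hp, m⟩ := a
  have h1 (x : X) : ∃ e : {a : A // p a = x} → ℕ, Function.Injective e :=
    have : Finite {a : A // p a = x} := (hp.1 x).to_subtype
    Countable.exists_injective_nat _
  choose e he using h1
  let k : A → X × ℕ := fun a => (p a, e (p a) ⟨a, rfl⟩)
  have hk : Function.Injective k := by
    intro a b h
    have h2 : p a = p b := congrArg Prod.fst h
    have h3 : e (p a) ⟨a, rfl⟩ = e (p a) ⟨b, h2.symm⟩ := by
      have h4 : e (p a) ⟨a, rfl⟩ = e (p b) ⟨b, rfl⟩ := congrArg Prod.snd h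
      have h5 : ∀ y (h : p b = y), e (p b) ⟨b, rfl⟩ = e y ⟨b, h⟩ := by
        rintro _ rfl
        rfl
      rw [h4, h5 _ h2.symm]
    exact congrArg Subtype.val (he _ h3)
  let E : A ≃ Set.range k := Equiv.ofInjective k hk
  let act : MulAction G (Set.range k) := E.symm.mulAction G
  let f : A →[G] Set.range k :=
    { toFun := E
      map_smul' := fun g a => by
        show E (g • a) = E (g • E.symm (E a))
        rw [E.symm_apply_apply] }
  let f' : Set.range k →[G] A :=
    { toFun := E.symm
      map_smul' := fun g a => E.symm_apply_apply _ }
  have hst : ∀ x : Set.range k, MulAction.stabilizer G x ∈ TS.C := fun x => by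
    rw [← stabilizer_eq_of_injective (f := f') E.symm.injective]
    exact A.stab_mem _
  let S : GSet TS.C := ⟨Set.range k, hst⟩
  have hf' : TS.IsAdd (X := S) (p.comp (X := S) f') :=
    isAdd_comp (X := S) (isAdd_of_injective (X := S) E.symm.injective) hp
  refine ⟨⟨Set.range k, ⟨act, hst⟩, ⟨p.comp f', hf'⟩, M.pull (X := S) f' m⟩, ?_⟩
  exact Quotient.sound ⟨f', E.symm.bijective, rfl, rfl⟩

/-- The set of isomorphism classes of pairs `(A → X, m)`. -/
def EltClass (M : SMack TS) (X : GSet TS.C) : Type u := Shrink.{u} (Quotient (eltSetoid M X))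

/-- The class of a pair. -/
noncomputable def cl {M : SMack TS} {X : GSet TS.C} (a : Elt M X) : EltClass M X :=
  equivShrink _ (Quotient.mk _ a)

variable {M N : SMack TS} {X Y : GSet TS.C}

theorem cl_eq_iff (a b : Elt M X) : cl a = cl b ↔ a.Iso b :=
  (equivShrink _).injective.eq_iff.trans (Quotient.eq (r := eltSetoid M X))

theorem cl_surjective : Function.Surjective (cl : Elt M X → EltClass M X) :=
  (equivShrink _).surjective.comp Quotient.mk_surjective

end Classes

section ClassOps

variable {G : Type u} [Group G] {TS : TambaraSystem G}

open TambaraSystem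

variable {M N : SMack TS} {X Y : GSet TS.C}

theorem cl_eq {A B : GSet TS.C} {p : A →[G] X} {hp : TS.IsAdd p} {m : M.obj A} {q : B →[G] X}
    {hq : TS.IsAdd q} {n : M.obj B} (f : A →[G] B) (hf : Function.Bijective f)
    (hpq : q.comp f = p) (hm : M.pull f n = m) :
    cl (⟨A, p, hp, m⟩ : Elt M X) = cl ⟨B, q, hq, n⟩ :=
  (cl_eq_iff _ _).2 ⟨f, hf, hpq, hm⟩

/-- A representative of a class. -/
noncomputable def EltClass.rep (x : EltClass M X) : Elt M X :=
  (cl_surjective x).choose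

theorem EltClass.cl_rep (x : EltClass M X) : cl x.rep = x :=
  (cl_surjective x).choose_spec

theorem rep_cl_iso (a : Elt M X) : (cl a).rep.Iso a :=
  (cl_eq_iff _ _).1 (EltClass.cl_rep _)

noncomputable instance : Add (EltClass M X) := ⟨fun x y => cl (x.rep.add y.rep)⟩

noncomputable instance : Mul (EltClass M X) := ⟨fun x y => cl (x.rep.mul y.rep)⟩

noncomputable instance : Zero (EltClass M X) :=
  ⟨cl ⟨empty TS.C, ofEmpty _ _, inO_of_isEmpty _, 1⟩⟩

noncomputable instance : One (EltClass M X) := ⟨cl ⟨X, MulActionHom.id G, isAdd_id X, 1⟩⟩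

theorem zero_def : (0 : EltClass M X) = cl ⟨empty TS.C, ofEmpty _ _, inO_of_isEmpty _, 1⟩ := rfl

theorem one_def : (1 : EltClass M X) = cl ⟨X, MulActionHom.id G, isAdd_id X, 1⟩ := rfl

/-- Inverse image of classes. -/
noncomputable def EltClass.pull (f : Y →[G] X) (x : EltClass M X) : EltClass M Y :=
  cl (x.rep.pull f)

/-- Additive transfer of classes. -/
noncomputable def EltClass.tr (f : X →[G] Y) (hf : TS.IsAdd f) (x : EltClass M X) : EltClass M Y :=
  cl (x.rep.tr f hf)

/-- Multiplicative transfer of classes. -/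
noncomputable def EltClass.nm (f : X →[G] Y) (hf : TS.IsMul f) (x : EltClass M X) : EltClass M Y :=
  cl (x.rep.nm f hf)

/-- The map on classes induced by a morphism of semi-Mackey functors. -/
noncomputable def EltClass.map (φ : M ⟶ N) (x : EltClass M X) : EltClass N X :=
  cl (x.rep.map φ)

theorem cl_add (a b : Elt M X) : cl (a.add b) = cl a + cl b := by
  obtain ⟨f, hf, hp, hm⟩ := (rep_cl_iso a).symm
  obtain ⟨g, hg, hq, hn⟩ := (rep_cl_iso b).symm
  refine (cl_eq_iff _ _).2 (Elt.add_iso (i := (inl _ _).comp f) (j := (inr _ _).comp g) ?_ _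
    (MulActionHom.ext fun x => DFunLike.congr_fun hp x)
    (MulActionHom.ext fun x => DFunLike.congr_fun hq x) ?_ ?_)
  · have h : (Sum.elim ((inl (cl a).rep.A (cl b).rep.A).comp f)
        ((inr (cl a).rep.A (cl b).rep.A).comp g)) = Sum.map f g := by
      funext z
      rcases z with z | z <;> rfl
    show Function.Bijective _
    rw [h]
    exact Sum.map_bijective.2 ⟨hf, hg⟩
  · rw [M.pull_comp]
    exact (congrArg (M.pull f) (Elt.glue_inl M _ _)).trans hm
  · rw [M.pull_comp]
    exact (congrArg (M.pull g) (Elt.glue_inr M _ _)).trans hn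

theorem cl_mul (a b : Elt M X) : cl (a.mul b) = cl a * cl b := by
  obtain ⟨f, hf, hp, hm⟩ := (rep_cl_iso a).symm
  obtain ⟨g, hg, hq, hn⟩ := (rep_cl_iso b).symm
  have hp' : ∀ x, (cl a).rep.p (f x) = a.p x := DFunLike.congr_fun hp
  have hq' : ∀ x, (cl b).rep.p (g x) = b.p x := DFunLike.congr_fun hq
  have key := Elt.mul_iso (a := (cl a).rep) (b := (cl b).rep) (P := fibreProd a.p b.p)
    (i := f.comp (fpFst a.p b.p)) (j := g.comp (fpSnd a.p b.p)) (q := a.p.comp (fpFst a.p b.p))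
    ⟨fun z => (hp' _).trans ((fp_comm _ _ z).trans (hq' _).symm), fun y x e => by
      obtain ⟨x, rfl⟩ := hf.2 x
      obtain ⟨y, rfl⟩ := hg.2 y
      exact ⟨⟨(x, y), (hp' x).symm.trans (e.symm.trans (hq' y))⟩, ⟨rfl, rfl⟩,
        fun z hz => fp_ext (hf.1 hz.2) (hg.1 hz.1)⟩⟩
    (isAdd_comp (isAdd_fst a.p b.isAdd) a.isAdd) (MulActionHom.ext fun z => hp' _)
  rw [M.pull_comp, M.pull_comp, hm, hn] at key
  exact (cl_eq_iff _ _).2 key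

theorem cl_pull (f : Y →[G] X) (a : Elt M X) : cl (a.pull f) = (cl a).pull f := by
  obtain ⟨g, hg, hp, hm⟩ := (rep_cl_iso a).symm
  have hp' : ∀ x, (cl a).rep.p (g x) = a.p x := DFunLike.congr_fun hp
  have key := Elt.pull_iso (f := f) (a := (cl a).rep) (A' := fibreProd f a.p) (q := fpFst f a.p)
    (k := g.comp (fpSnd f a.p)) ⟨fun z => (fp_comm _ _ z).trans (hp' _).symm, fun x y e => by
      obtain ⟨x, rfl⟩ := hg.2 x
      exact ⟨⟨(y, x), e.symm.trans (hp' x)⟩, ⟨rfl, rfl⟩, fun z hz => fp_ext hz.2 (hg.1 hz.1)⟩⟩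
    (isAdd_fst f a.isAdd)
  rw [M.pull_comp, hm] at key
  exact (cl_eq_iff _ _).2 key

theorem cl_tr (f : X →[G] Y) (hf : TS.IsAdd f) (a : Elt M X) : cl (a.tr f hf) = (cl a).tr f hf := by
  obtain ⟨g, hg, hp, hm⟩ := (rep_cl_iso a).symm
  exact (cl_eq_iff _ _).2 ⟨g, hg, MulActionHom.ext fun x => congrArg f (DFunLike.congr_fun hp x), hm⟩

theorem p_piEval {A X Y : GSet TS.C} (η : X →[G] Y) (hη : TS.IsMul η) (p : A →[G] X)
    (z : fibreProd η (piProj η hη p)) : p (piEval η hη p z) = fpFst _ _ z :=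
  z.1.2.p_sec _ _

theorem cl_nm (η : X →[G] Y) (hη : TS.IsMul η) (a : Elt M X) :
    cl (a.nm η hη) = (cl a).nm η hη := by
  obtain ⟨g, hg, hp, hm⟩ := (rep_cl_iso a).symm
  have hp' : ∀ x, (cl a).rep.p (g x) = a.p x := DFunLike.congr_fun hp
  have hexp := (isExponential_pi η hη a.p).isExp
  have key := Elt.nm_iso (η := η) (hη := hη) (a := (cl a).rep)
    (ζ := g.comp (piEval η hη a.p)) (η' := piRho η hη a.p) (υ := piProj η hη a.p)
    (IsExp.isExponential ⟨fun x' => by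
        rw [← hexp.comm]
        exact congrArg η (hp' _), fun x y' e => by
        simpa only [MulActionHom.comp_apply, hp'] using hexp.lift x y' e, fun y σ hσ => by
        obtain ⟨g', h1, h2⟩ := exists_inverse g hg
        have h1' : ∀ x, g (g' x) = x := DFunLike.congr_fun h1
        refine (existsUnique_congr fun y' => and_congr Iff.rfl ?_).1
          (hexp.sec y (fun x e => g' (σ x e)) fun x e => by rw [← hp', h1', hσ])
        have aux : ∀ (x x2 : X) (e : x = x2) (h : η x = y) (h' : η x2 = y), σ x h = σ x2 h' := by
          rintro x _ rfl _ _
          rfl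
        refine ⟨fun H x' h e => ?_, fun H x' h e => hg.1 ?_⟩
        · show g (piEval η hη a.p x') = _
          rw [H x' (by rw [← hp']; exact h) e, h1']
          exact aux _ _ (hp' _).symm _ _
        · rw [h1']
          exact (H x' (by rw [← h, ← hp']; rfl) e).trans (aux _ _ (hp' _) _ _)⟩)
    (isMul_rho hη a.p) (isAdd_proj hη a.isAdd)
  rw [M.pull_comp, hm] at key
  exact (cl_eq_iff _ _).2 key

theorem cl_map (φ : M ⟶ N) (a : Elt M X) : cl (a.map φ) = (cl a).map φ := by
  obtain ⟨g, hg, hp, hm⟩ := (rep_cl_iso a).symm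
  exact (cl_eq_iff _ _).2 ⟨g, hg, hp,
    (SemiMackey.Hom.app_pull φ g (cl a).rep.m).symm.trans (congrArg (φ.app a.A) hm)⟩

theorem cl_mk_add {A B D : GSet TS.C} {p : A →[G] X} {hp : TS.IsAdd p} {m : M.obj A}
    {q : B →[G] X} {hq : TS.IsAdd q} {n : M.obj B} {i : A →[G] D} {j : B →[G] D}
    (h : IsCoprod i j) (r : D →[G] X) (hr : TS.IsAdd r) (hri : r.comp i = p) (hrj : r.comp j = q)
    {k : M.obj D} (hi : M.pull i k = m) (hj : M.pull j k = n) :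
    cl ⟨A, p, hp, m⟩ + cl ⟨B, q, hq, n⟩ = cl ⟨D, r, hr, k⟩ := by
  rw [← cl_add, cl_eq_iff]
  exact Elt.add_iso (a := ⟨A, p, hp, m⟩) (b := ⟨B, q, hq, n⟩) h hr hri hrj hi hj

theorem copair_inl {A B : GSet TS.C} (p : A →[G] X) (q : B →[G] X) :
    (copair p q).comp (inl A B) = p :=
  rfl

theorem copair_inr {A B : GSet TS.C} (p : A →[G] X) (q : B →[G] X) :
    (copair p q).comp (inr A B) = q :=
  rfl

theorem cl_mk_add_sum {A B : GSet TS.C} {p : A →[G] X} {hp : TS.IsAdd p} {q : B →[G] X}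
    {hq : TS.IsAdd q} {k : M.obj (sum A B)} :
    cl ⟨A, p, hp, M.pull (inl A B) k⟩ + cl ⟨B, q, hq, M.pull (inr A B) k⟩ =
      cl ⟨sum A B, copair p q, isAdd_copair hp hq, k⟩ :=
  cl_mk_add (isCoprod_sum A B) _ _ (copair_inl p q) (copair_inr p q) rfl rfl

theorem cl_mk_mul {A B P : GSet TS.C} {p : A →[G] X} {hp : TS.IsAdd p} {m : M.obj A}
    {q : B →[G] X} {hq : TS.IsAdd q} {n : M.obj B} {i : P →[G] A} {j : P →[G] B}
    (h : IsPullbackSquare i j p q) (r : P →[G] X) (hr : TS.IsAdd r) (hri : p.comp i = r) :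
    cl ⟨A, p, hp, m⟩ * cl ⟨B, q, hq, n⟩ = cl ⟨P, r, hr, M.pull i m * M.pull j n⟩ := by
  rw [← cl_mul, eq_comm, cl_eq_iff]
  exact Elt.mul_iso (a := ⟨A, p, hp, m⟩) (b := ⟨B, q, hq, n⟩) h hr hri

theorem cl_mk_pull {A A' : GSet TS.C} {p : A →[G] X} {hp : TS.IsAdd p} {m : M.obj A}
    {f : Y →[G] X} {q : A' →[G] Y} {k : A' →[G] A} (h : IsPullbackSquare q k f p)
    (hq : TS.IsAdd q) : (cl ⟨A, p, hp, m⟩).pull f = cl ⟨A', q, hq, M.pull k m⟩ := by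
  rw [← cl_pull, eq_comm, cl_eq_iff]
  exact Elt.pull_iso (a := ⟨A, p, hp, m⟩) h hq

theorem cl_mk_tr {A : GSet TS.C} {p : A →[G] X} {hp : TS.IsAdd p} {m : M.obj A}
    {f : X →[G] Y} {hf : TS.IsAdd f} :
    (cl ⟨A, p, hp, m⟩).tr f hf = cl ⟨A, f.comp p, isAdd_comp hp hf, m⟩ :=
  (cl_tr f hf _).symm

theorem cl_mk_nm {A X' Y' : GSet TS.C} {p : A →[G] X} {hp : TS.IsAdd p} {m : M.obj A}
    {η : X →[G] Y} {hη : TS.IsMul η} {ζ : X' →[G] A} {η' : X' →[G] Y'} {υ : Y' →[G] Y}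
    (h : IsExp η p ζ η' υ) (hη' : TS.IsMul η') (hυ : TS.IsAdd υ) :
    (cl ⟨A, p, hp, m⟩).nm η hη = cl ⟨Y', υ, hυ, M.push η' hη' (M.pull ζ m)⟩ := by
  rw [← cl_nm, eq_comm, cl_eq_iff]
  exact Elt.nm_iso (a := ⟨A, p, hp, m⟩) h.isExponential hη' hυ

theorem exists_cl (x : EltClass M X) :
    ∃ (A : GSet TS.C) (p : A →[G] X) (hp : TS.IsAdd p) (m : M.obj A), x = cl ⟨A, p, hp, m⟩ := by
  obtain ⟨a, rfl⟩ := cl_surjective x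
  exact ⟨a.A, a.p, a.isAdd, a.m, rfl⟩

end ClassOps

section Semiring

variable {G : Type u} [Group G] {TS : TambaraSystem G}

open TambaraSystem

variable {M N : SMack TS} {X Y : GSet TS.C}

theorem isAdd_fpFst {A B X : GSet TS.C} (p : A →[G] X) {q : B →[G] X} (hq : TS.IsAdd q) :
    TS.IsAdd (fpFst p q) :=
  isAdd_fst p hq

/-- Fibre products distribute over disjoint unions. -/
theorem isCoprod_fibreProd {A B D : GSet TS.C} {i : A →[G] D} {j : B →[G] D} (h : IsCoprod i j)
    (f : Y →[G] X) (r : D →[G] X) :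
    IsCoprod (fpLift (p := f) (q := r) (fpFst f (r.comp i)) (i.comp (fpSnd _ _)) (fp_comm _ _))
      (fpLift (p := f) (q := r) (fpFst f (r.comp j)) (j.comp (fpSnd _ _)) (fp_comm _ _)) := by
  refine IsCoprod.of (fun z w e => ?_) (fun z w e => ?_) (fun z w e => ?_) fun z => ?_
  · exact fp_ext (congrArg (fpFst f r) e) (h.injective_left (congrArg (fpSnd f r) e))
  · exact fp_ext (congrArg (fpFst f r) e) (h.injective_right (congrArg (fpSnd f r) e))
  · exact h.ne _ _ (congrArg (fpSnd f r) e)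
  · obtain ⟨⟨y, d⟩, hz⟩ := z
    rcases h.cases d with ⟨a, rfl⟩ | ⟨b, rfl⟩
    · exact Or.inl ⟨⟨(y, a), hz⟩, rfl⟩
    · exact Or.inr ⟨⟨(y, b), hz⟩, rfl⟩

theorem isPullbackSquare_empty {A : GSet TS.C} (p : A →[G] X) :
    IsPullbackSquare (ofEmpty (empty TS.C) A) (MulActionHom.id G) p (ofEmpty (empty TS.C) X) :=
  ⟨isEmptyElim, isEmptyElim⟩

theorem isPullbackSquare_id (f : Y →[G] X) :
    IsPullbackSquare (MulActionHom.id G) f f (MulActionHom.id G) :=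
  ⟨fun _ => rfl, fun _ y e => ⟨y, ⟨e.symm, rfl⟩, fun _ hz => hz.2⟩⟩

theorem ofEmpty_eq {X Y : Type u} [MulAction G X] [MulAction G Y] [IsEmpty X] (f g : X →[G] Y) :
    f = g :=
  MulActionHom.ext isEmptyElim

namespace EltClass

theorem add_comm' (x y : EltClass M X) : x + y = y + x := by
  obtain ⟨a, rfl⟩ := cl_surjective x
  obtain ⟨b, rfl⟩ := cl_surjective y
  rw [← cl_add a b]
  exact (cl_mk_add (IsCoprod.of (isCoprod_sum a.A b.A).injective_right
    (isCoprod_sum a.A b.A).injective_left (fun x y e => (isCoprod_sum a.A b.A).ne _ _ e.symm)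
    fun d => ((isCoprod_sum a.A b.A).cases d).symm) _ _ rfl rfl (Elt.glue_inr M _ _)
    (Elt.glue_inl M _ _)).symm

theorem zero_add' (x : EltClass M X) : 0 + x = x := by
  obtain ⟨A, p, hp, m, rfl⟩ := exists_cl x
  exact cl_mk_add (i := ofEmpty _ A) (j := MulActionHom.id G)
    (IsCoprod.of isEmptyElim (fun _ _ e => e) isEmptyElim fun d => Or.inr ⟨d, rfl⟩) p hp
    (ofEmpty_eq _ _) rfl ((M.subsingleton_of_isEmpty (empty TS.C)).elim _ _) (M.pull_id _ _)

theorem add_assoc' (x y z : EltClass M X) : x + y + z = x + (y + z) := by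
  obtain ⟨A, p, hp, m, rfl⟩ := exists_cl x
  obtain ⟨B, q, hq, n, rfl⟩ := exists_cl y
  obtain ⟨D, r, hr, k, rfl⟩ := exists_cl z
  obtain ⟨u, hu1, hu2⟩ := M.exists_of_isCoprod (isCoprod_sum A B) m n
  obtain ⟨v, hv1, hv2⟩ := M.exists_of_isCoprod (isCoprod_sum B D) n k
  obtain ⟨w, hw1, hw2⟩ := M.exists_of_isCoprod (isCoprod_sum (sum A B) D) u k
  rw [cl_mk_add (isCoprod_sum A B) (copair p q) (isAdd_copair hp hq) (copair_inl p q)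
      (copair_inr p q) hu1 hu2,
    cl_mk_add (isCoprod_sum B D) (copair q r) (isAdd_copair hq hr) (copair_inl q r)
      (copair_inr q r) hv1 hv2,
    cl_mk_add (isCoprod_sum (sum A B) D) (copair (copair p q) r)
      (isAdd_copair (isAdd_copair hp hq) hr) (copair_inl _ r) (copair_inr _ r) hw1 hw2, eq_comm]
  refine cl_mk_add (i := (inl (sum A B) D).comp (inl A B))
    (j := copair ((inl (sum A B) D).comp (inr A B)) (inr (sum A B) D)) ?_ _ _ ?_ ?_ ?_ ?_
  · refine IsCoprod.of (fun a b e => Sum.inl_injective (Sum.inl_injective e)) ?_ ?_ ?_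
    · rintro (a | a) (b | b) e
      · exact congrArg Sum.inl (Sum.inr_injective (Sum.inl_injective e))
      · exact (Sum.inl_ne_inr e).elim
      · exact (Sum.inr_ne_inl e).elim
      · exact congrArg Sum.inr (Sum.inr_injective e)
    · rintro a (b | b) e
      · exact Sum.inl_ne_inr (Sum.inl_injective e)
      · exact Sum.inl_ne_inr e
    · rintro ((a | b) | d)
      · exact Or.inl ⟨a, rfl⟩
      · exact Or.inr ⟨Sum.inl b, rfl⟩
      · exact Or.inr ⟨Sum.inr d, rfl⟩
  · rfl
  · ext z
    rcases z with z | z <;> rfl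
  · rw [M.pull_comp, hw1, hu1]
  · refine M.ext_of_isCoprod (isCoprod_sum B D) ?_ ?_
    · rw [hv1, ← M.pull_comp, ← hu2, ← hw1, ← M.pull_comp]
      rfl
    · rw [hv2, ← M.pull_comp, ← hw2]
      rfl

theorem mul_comm' (x y : EltClass M X) : x * y = y * x := by
  obtain ⟨A, p, hp, m, rfl⟩ := exists_cl x
  obtain ⟨B, q, hq, n, rfl⟩ := exists_cl y
  have h := isPullbackSquare_fibreProd p q
  rw [cl_mk_mul h _ (isAdd_comp (isAdd_fpFst p hq) hp) rfl, cl_mk_mul h.symm _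
    (isAdd_comp (isAdd_fpFst p hq) hp) (MulActionHom.ext fun z => (h.1 z).symm), mul_comm]

theorem one_mul' (x : EltClass M X) : 1 * x = x := by
  obtain ⟨A, p, hp, m, rfl⟩ := exists_cl x
  rw [one_def, cl_mk_mul (isPullbackSquare_id p).symm p hp rfl, map_one, one_mul, M.pull_id]

theorem zero_mul' (x : EltClass M X) : 0 * x = 0 := by
  obtain ⟨A, p, hp, m, rfl⟩ := exists_cl x
  rw [zero_def, cl_mk_mul (isPullbackSquare_empty p).symm _ (inO_of_isEmpty _) rfl]
  exact cl_eq (MulActionHom.id G) Function.bijective_id rfl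
    ((M.subsingleton_of_isEmpty (empty TS.C)).elim _ _)

theorem mul_assoc' (x y z : EltClass M X) : x * y * z = x * (y * z) := by
  obtain ⟨A, p, hp, m, rfl⟩ := exists_cl x
  obtain ⟨B, q, hq, n, rfl⟩ := exists_cl y
  obtain ⟨D, r, hr, k, rfl⟩ := exists_cl z
  have h1 := isAdd_comp (isAdd_fpFst p hq) hp
  rw [cl_mk_mul (isPullbackSquare_fibreProd p q) _ h1 rfl,
    cl_mk_mul (isPullbackSquare_fibreProd q r) _ (isAdd_comp (isAdd_fpFst q hr) hq) rfl,
    cl_mk_mul (isPullbackSquare_fibreProd (p.comp (fpFst p q)) r) _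
      (isAdd_comp (isAdd_fpFst _ hr) h1) rfl,
    cl_mk_mul (P := fibreProd (p.comp (fpFst p q)) r) (i := (fpFst p q).comp (fpFst _ _))
      (j := fpLift ((fpSnd p q).comp (fpFst _ _)) (fpSnd _ _)
        (fun d => ((fp_comm p q _).symm.trans (fp_comm _ _ d))))
      ⟨fun d => fp_comm p q (fpFst _ _ d), fun v a e =>
        ⟨⟨(⟨(a, fpFst q r v), e.symm⟩, fpSnd q r v), e.symm.trans (fp_comm q r v)⟩,
          ⟨rfl, rfl⟩, ?_⟩⟩ _ (isAdd_comp (isAdd_fpFst _ hr) h1) rfl]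
  · simp only [map_mul, ← M.pull_comp, mul_assoc]
    rfl
  · rintro w ⟨rfl, rfl⟩
    rfl

theorem pull_add (f : Y →[G] X) (x y : EltClass M X) :
    (x + y).pull f = x.pull f + y.pull f := by
  obtain ⟨A, p, hp, m, rfl⟩ := exists_cl x
  obtain ⟨B, q, hq, n, rfl⟩ := exists_cl y
  obtain ⟨u, rfl, rfl⟩ := M.exists_of_isCoprod (isCoprod_sum A B) m n
  rw [cl_mk_add_sum,
    cl_mk_pull (isPullbackSquare_fibreProd f p) (isAdd_fpFst f hp),
    cl_mk_pull (isPullbackSquare_fibreProd f q) (isAdd_fpFst f hq),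
    cl_mk_pull (isPullbackSquare_fibreProd f (copair p q)) (isAdd_fpFst f (isAdd_copair hp hq))]
  refine (cl_mk_add (isCoprod_fibreProd (isCoprod_sum A B) f (copair p q)) _ _ rfl rfl ?_ ?_).symm
  · rw [← M.pull_comp, ← M.pull_comp]
    rfl
  · rw [← M.pull_comp, ← M.pull_comp]
    rfl

theorem pull_zero (f : Y →[G] X) : (0 : EltClass M X).pull f = 0 := by
  rw [zero_def, cl_mk_pull (isPullbackSquare_empty f) (inO_of_isEmpty _), M.pull_id]
  rfl

theorem pull_one (f : Y →[G] X) : (1 : EltClass M X).pull f = 1 := by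
  rw [one_def, cl_mk_pull (isPullbackSquare_id f) (isAdd_id Y), map_one]
  rfl

theorem pull_mul (f : Y →[G] X) (x y : EltClass M X) :
    (x * y).pull f = x.pull f * y.pull f := by
  obtain ⟨A, p, hp, m, rfl⟩ := exists_cl x
  obtain ⟨B, q, hq, n, rfl⟩ := exists_cl y
  have h1 := isAdd_comp (isAdd_fpFst p hq) hp
  rw [cl_mk_mul (isPullbackSquare_fibreProd p q) _ h1 rfl,
    cl_mk_pull (isPullbackSquare_fibreProd f p) (isAdd_fpFst f hp),
    cl_mk_pull (isPullbackSquare_fibreProd f q) (isAdd_fpFst f hq),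
    cl_mk_pull (isPullbackSquare_fibreProd f (p.comp (fpFst p q))) (isAdd_fpFst f h1),
    cl_mk_mul (P := fibreProd f (p.comp (fpFst p q)))
      (i := fpLift (fpFst _ _) ((fpFst p q).comp (fpSnd _ _)) (fp_comm _ _))
      (j := fpLift (fpFst _ _) ((fpSnd p q).comp (fpSnd _ _))
        (fun d => (fp_comm _ _ d).trans (fp_comm p q _)))
      ⟨fun d => rfl, ?_⟩ _ (isAdd_fpFst f h1) rfl]
  · simp only [map_mul, ← M.pull_comp]
    rfl
  · rintro ⟨⟨y, b⟩, hb⟩ ⟨⟨y', a⟩, ha⟩ e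
    obtain rfl : y = y' := e
    have ha' : f y = p a := ha
    have hb' : f y = q b := hb
    refine ⟨⟨(y, ⟨(a, b), ha'.symm.trans hb'⟩), ha⟩, ⟨rfl, rfl⟩, fun w hw => ?_⟩
    exact fp_ext (congrArg (fpFst f p) hw.2)
      (fp_ext (congrArg (fpSnd f p) hw.2) (congrArg (fpSnd f q) hw.1))

theorem mul_add' (x y z : EltClass M X) : x * (y + z) = x * y + x * z := by
  obtain ⟨A, p, hp, m, rfl⟩ := exists_cl x
  obtain ⟨B, q, hq, n, rfl⟩ := exists_cl y
  obtain ⟨D, r, hr, k, rfl⟩ := exists_cl z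
  obtain ⟨u, rfl, rfl⟩ := M.exists_of_isCoprod (isCoprod_sum B D) n k
  rw [cl_mk_add_sum,
    cl_mk_mul (isPullbackSquare_fibreProd p q) _ (isAdd_comp (isAdd_fpFst p hq) hp) rfl,
    cl_mk_mul (isPullbackSquare_fibreProd p r) _ (isAdd_comp (isAdd_fpFst p hr) hp) rfl,
    cl_mk_mul (isPullbackSquare_fibreProd p (copair q r)) _
      (isAdd_comp (isAdd_fpFst p (isAdd_copair hq hr)) hp) rfl]
  refine (cl_mk_add (isCoprod_fibreProd (isCoprod_sum B D) p (copair q r)) _ _ rfl rfl ?_ ?_).symm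
  · simp only [map_mul, ← M.pull_comp]
    rfl
  · simp only [map_mul, ← M.pull_comp]
    rfl

end EltClass

noncomputable instance : CommSemiring (EltClass M X) where
  add_assoc := EltClass.add_assoc'
  zero_add := EltClass.zero_add'
  add_zero x := by rw [EltClass.add_comm', EltClass.zero_add']
  add_comm := EltClass.add_comm'
  nsmul := nsmulRec
  left_distrib := EltClass.mul_add'
  right_distrib x y z := by
    rw [EltClass.mul_comm', EltClass.mul_add', EltClass.mul_comm' z, EltClass.mul_comm' z]
  zero_mul := EltClass.zero_mul'
  mul_zero x := by rw [EltClass.mul_comm', EltClass.zero_mul']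
  mul_assoc := EltClass.mul_assoc'
  one_mul := EltClass.one_mul'
  mul_one x := by rw [EltClass.mul_comm', EltClass.one_mul']
  mul_comm := EltClass.mul_comm'

end Semiring

section Transfers

variable {G : Type u} [Group G] {TS : TambaraSystem G}

open TambaraSystem

variable {M N : SMack TS} {X Y Z : GSet TS.C}

namespace EltClass

theorem pull_id (x : EltClass M X) : x.pull (MulActionHom.id G) = x := by
  obtain ⟨A, p, hp, m, rfl⟩ := exists_cl x
  rw [cl_mk_pull (isPullbackSquare_id p).symm hp, M.pull_id]

theorem pull_comp (f : X →[G] Y) (g : Y →[G] Z) (x : EltClass M Z) :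
    x.pull (g.comp f) = (x.pull g).pull f := by
  obtain ⟨A, p, hp, m, rfl⟩ := exists_cl x
  rw [cl_mk_pull (isPullbackSquare_fibreProd g p) (isAdd_fpFst g hp),
    cl_mk_pull (isPullbackSquare_fibreProd f (fpFst g p)) (isAdd_fpFst f (isAdd_fpFst g hp)),
    ← M.pull_comp]
  refine cl_mk_pull (q := fpFst f (fpFst g p)) (k := (fpSnd g p).comp (fpSnd f (fpFst g p)))
    ⟨fun z => ?_, fun a x e => ⟨⟨(x, ⟨(f x, a), e.symm⟩), rfl⟩, ⟨rfl, rfl⟩, ?_⟩⟩ _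
  · exact (congrArg g (fp_comm _ _ z)).trans (fp_comm _ _ (fpSnd f (fpFst g p) z))
  · rintro ⟨⟨x', w⟩, hw⟩ ⟨h1, h2⟩
    obtain rfl : x' = x := h2
    refine fp_ext rfl (fp_ext hw.symm h1)

theorem tr_id (h : TS.IsAdd (MulActionHom.id G : X →[G] X)) (x : EltClass M X) :
    x.tr (MulActionHom.id G) h = x := by
  obtain ⟨A, p, hp, m, rfl⟩ := exists_cl x
  exact cl_mk_tr

theorem tr_comp (f : X →[G] Y) (g : Y →[G] Z) (hf : TS.IsAdd f) (hg : TS.IsAdd g)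
    (hgf : TS.IsAdd (g.comp f)) (x : EltClass M X) :
    x.tr (g.comp f) hgf = (x.tr f hf).tr g hg := by
  obtain ⟨A, p, hp, m, rfl⟩ := exists_cl x
  rw [cl_mk_tr, cl_mk_tr, cl_mk_tr]
  rfl

theorem tr_zero (f : X →[G] Y) (hf : TS.IsAdd f) : (0 : EltClass M X).tr f hf = 0 := by
  rw [zero_def, cl_mk_tr]
  exact cl_eq (MulActionHom.id G) Function.bijective_id (ofEmpty_eq _ _) (M.pull_id _ _)

theorem tr_add (f : X →[G] Y) (hf : TS.IsAdd f) (x y : EltClass M X) :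
    (x + y).tr f hf = x.tr f hf + y.tr f hf := by
  obtain ⟨A, p, hp, m, rfl⟩ := exists_cl x
  obtain ⟨B, q, hq, n, rfl⟩ := exists_cl y
  obtain ⟨u, rfl, rfl⟩ := M.exists_of_isCoprod (isCoprod_sum A B) m n
  rw [cl_mk_add_sum, cl_mk_tr, cl_mk_tr, cl_mk_tr, cl_mk_add_sum]
  refine cl_eq (MulActionHom.id G) Function.bijective_id ?_ (M.pull_id _ _)
  ext z
  rcases z with z | z <;> rfl

theorem tr_mackey {X' Y' X Y : GSet TS.C} (g' : X' →[G] Y') (f' : X' →[G] X) (f : Y' →[G] Y)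
    (g : X →[G] Y) (hg' : TS.IsAdd g') (hg : TS.IsAdd g) (h : IsPullbackSquare g' f' f g)
    (x : EltClass M X) : (x.tr g hg).pull f = (x.pull f').tr g' hg' := by
  obtain ⟨A, p, hp, m, rfl⟩ := exists_cl x
  rw [cl_mk_pull (isPullbackSquare_fibreProd f' p) (isAdd_fpFst f' hp), cl_mk_tr, cl_mk_tr]
  refine cl_mk_pull ⟨fun z => ?_, fun a y e => ?_⟩ _
  · exact (h.1 _).trans (congrArg g (fp_comm _ _ z))
  · obtain ⟨x', ⟨h1, h2⟩, h3⟩ := h.2 (p a) y e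
    refine ⟨⟨(x', a), h1⟩, ⟨rfl, h2⟩, ?_⟩
    rintro ⟨⟨z, b⟩, hz⟩ ⟨e1, e2⟩
    obtain rfl : b = a := e1
    exact fp_ext (h3 z ⟨hz, e2⟩) rfl

/-- A criterion for exponential diagrams based on a fibre product. -/
theorem _root_.BiTam.IsExp.of_fibreProd {A Y' : GSet TS.C} {η : X →[G] Y} {p : A →[G] X}
    {υ : Y' →[G] Y} {ζ : fibreProd η υ →[G] A} (h : ∀ z, p (ζ z) = fpFst η υ z)
    (hs : ∀ y (σ : ∀ x, η x = y → A), (∀ x h, p (σ x h) = x) →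
      ∃! y', ∃ e : υ y' = y, ∀ x (h : η x = y), ζ ⟨(x, y'), h.trans e.symm⟩ = σ x h) :
    IsExp η p ζ (fpSnd η υ) υ where
  comm z := by rw [h, fp_comm]
  lift x y' e := ⟨⟨(x, y'), e⟩, ⟨h _, rfl⟩, fun z hz => fp_ext ((h z).symm.trans hz.1) hz.2⟩
  sec y σ hσ := by
    refine (existsUnique_congr fun y' => ?_).1 (hs y σ hσ)
    have aux : ∀ (x x2 : X) (e : x = x2) (h : η x = y) (h' : η x2 = y), σ x h = σ x2 h' := by
      rintro x _ rfl _ _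
      rfl
    constructor
    · rintro ⟨e, H⟩
      refine ⟨e, ?_⟩
      rintro ⟨⟨x, w⟩, e'⟩ he hw
      obtain rfl : w = y' := hw
      exact (H x (Eq.trans e' e)).trans (aux _ _ (h ⟨(x, w), e'⟩).symm _ _)
    · rintro ⟨e, H⟩
      refine ⟨e, fun x hx => ?_⟩
      have hz := h ⟨(x, y'), hx.trans e.symm⟩
      exact (H ⟨(x, y'), hx.trans e.symm⟩ ((congrArg η hz).trans hx) rfl).trans (aux _ _ hz _ _)

theorem nm_id (h : TS.IsMul (MulActionHom.id G : X →[G] X)) (x : EltClass M X) :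
    x.nm (MulActionHom.id G) h = x := by
  obtain ⟨A, p, hp, m, rfl⟩ := exists_cl x
  rw [cl_mk_nm (ζ := MulActionHom.id G) (η' := MulActionHom.id G) (υ := p) _ (isMul_id A) hp,
    M.push_id, M.pull_id]
  refine ⟨fun _ => rfl, fun x a e => ⟨a, ⟨e.symm, rfl⟩, fun _ h => h.2⟩, fun x σ hσ =>
    ⟨σ x rfl, ⟨hσ x rfl, ?_⟩, ?_⟩⟩
  · rintro a rfl h
    exact h
  · rintro a ⟨rfl, h⟩
    exact h a rfl rfl

theorem nm_one (f : X →[G] Y) (hf : TS.IsMul f) : (1 : EltClass M X).nm f hf = 1 := by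
  rw [one_def, cl_mk_nm (ζ := MulActionHom.id G) (η' := f) (υ := MulActionHom.id G) _ hf
    (isAdd_id Y), map_one, map_one]
  · rfl
  refine ⟨fun _ => rfl, fun x y e => ⟨x, ⟨rfl, e⟩, fun _ h => h.1⟩, fun y σ hσ =>
    ⟨y, ⟨rfl, fun x h _ => ?_⟩, fun z hz => hz.1⟩⟩
  exact (hσ _ _).symm

theorem isAdd_piProj {A : GSet TS.C} {η : X →[G] Y} (hη : TS.IsMul η) {p : A →[G] X}
    (hp : TS.IsAdd p) : TS.IsAdd (piProj η hη p) :=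
  isAdd_proj hη hp

theorem isMul_piRho {A : GSet TS.C} {η : X →[G] Y} (hη : TS.IsMul η) (p : A →[G] X) :
    TS.IsMul (piRho η hη p) :=
  isMul_rho hη p

theorem isMul_fpSnd {A B : GSet TS.C} {p : A →[G] X} (hp : TS.IsMul p) (q : B →[G] X) :
    TS.IsMul (fpSnd p q) :=
  isMul_snd hp q

theorem cl_mk_nm_pi {A : GSet TS.C} {p : A →[G] X} {hp : TS.IsAdd p} {m : M.obj A}
    {η : X →[G] Y} {hη : TS.IsMul η} :
    (cl ⟨A, p, hp, m⟩).nm η hη = cl ⟨piObj η hη p, piProj η hη p, isAdd_piProj hη hp,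
      M.push (piRho η hη p) (isMul_piRho hη p) (M.pull (piEval η hη p) m)⟩ :=
  cl_mk_nm (isExponential_pi η hη p).isExp _ _

/-- Base change of `ρ` along a map to `Π_η(A)`. -/
theorem isPullbackSquare_piRho {A D : GSet TS.C} {η : X →[G] Y} {hη : TS.IsMul η} {p : A →[G] X}
    (t : D →[G] piObj η hη p) (υ : D →[G] Y) (h : ∀ d, υ d = piProj η hη p (t d)) :
    IsPullbackSquare (fpSnd η υ) (fpLift (p := η) (q := piProj η hη p) (fpFst η υ)
      (t.comp (fpSnd η υ)) fun z => (fp_comm _ _ z).trans (h _)) t (piRho η hη p) := by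
  refine ⟨fun _ => rfl, ?_⟩
  rintro ⟨⟨x, s⟩, hx⟩ d e
  obtain rfl : s = t d := e
  have hx' : η x = υ d := hx.trans (h d).symm
  exact ⟨⟨(x, d), hx'⟩, ⟨rfl, rfl⟩, fun z hz => fp_ext (congrArg (fpFst η (piProj η hη p)) hz.1) hz.2⟩

theorem nm_mul (f : X →[G] Y) (hf : TS.IsMul f) (x y : EltClass M X) :
    (x * y).nm f hf = x.nm f hf * y.nm f hf := by
  obtain ⟨A, p, hp, m, rfl⟩ := exists_cl x
  obtain ⟨B, q, hq, n, rfl⟩ := exists_cl y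
  let π₁ := piProj f hf p
  let π₂ := piProj f hf q
  let υ : fibreProd π₁ π₂ →[G] Y := π₁.comp (fpFst π₁ π₂)
  have hυ : TS.IsAdd υ := isAdd_comp (isAdd_fpFst π₁ (isAdd_piProj hf hq)) (isAdd_piProj hf hp)
  let k₁ : fibreProd f υ →[G] fibreProd f π₁ :=
    fpLift (fpFst f υ) ((fpFst π₁ π₂).comp (fpSnd f υ)) (fp_comm f υ)
  let k₂ : fibreProd f υ →[G] fibreProd f π₂ :=
    fpLift (fpFst f υ) ((fpSnd π₁ π₂).comp (fpSnd f υ))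
      fun z => (fp_comm f υ z).trans (fp_comm π₁ π₂ (fpSnd f υ z))
  let ζ : fibreProd f υ →[G] fibreProd p q :=
    fpLift ((piEval f hf p).comp k₁) ((piEval f hf q).comp k₂) fun z =>
      (p_piEval f hf p (k₁ z)).trans (p_piEval f hf q (k₂ z)).symm
  have hexp : IsExp f (p.comp (fpFst p q)) ζ (fpSnd f υ) υ := by
    refine IsExp.of_fibreProd (fun z => p_piEval f hf p _) fun y σ hσ => ?_
    refine ⟨⟨(⟨y, fun x h => fpFst p q (σ x h), hσ⟩, ⟨y, fun x h => fpSnd p q (σ x h),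
      fun x h => (fp_comm p q _).symm.trans (hσ x h)⟩), rfl⟩, ⟨rfl, fun _ _ => rfl⟩, ?_⟩
    rintro ⟨⟨s, t⟩, hst⟩ ⟨e, H⟩
    have e' : t.pt = y := Eq.trans (Eq.symm hst) e
    refine fp_ext (PiSet.ext' e fun x h1 h2 => ?_) (PiSet.ext' e' fun x h1 h2 => ?_)
    · exact congrArg (fpFst p q) (H x h2)
    · exact congrArg (fpSnd p q) (H x h2)
  rw [cl_mk_mul (isPullbackSquare_fibreProd p q) _ (isAdd_comp (isAdd_fpFst p hq) hp) rfl,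
    cl_mk_nm hexp (isMul_fpSnd hf υ) hυ, cl_mk_nm_pi, cl_mk_nm_pi,
    cl_mk_mul (isPullbackSquare_fibreProd π₁ π₂) υ hυ rfl, map_mul, map_mul,
    M.mackey _ _ _ _ (isMul_fpSnd hf υ) _ (isPullbackSquare_piRho (fpFst π₁ π₂) υ fun _ => rfl),
    M.mackey _ _ _ _ (isMul_fpSnd hf υ) _ (isPullbackSquare_piRho (fpSnd π₁ π₂) υ
      (fp_comm π₁ π₂)), ← M.pull_comp, ← M.pull_comp, ← M.pull_comp, ← M.pull_comp]
  rfl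

theorem nm_comp (f : X →[G] Y) (g : Y →[G] Z) (hf : TS.IsMul f) (hg : TS.IsMul g)
    (hgf : TS.IsMul (g.comp f)) (x : EltClass M X) :
    x.nm (g.comp f) hgf = (x.nm f hf).nm g hg := by
  obtain ⟨A, p, hp, m, rfl⟩ := exists_cl x
  let π := piProj f hf p
  let υ := piProj g hg π
  have hυ : TS.IsAdd υ := isAdd_piProj hg (isAdd_piProj hf hp)
  let k₁ : fibreProd (g.comp f) υ →[G] fibreProd g υ :=
    fpLift (f.comp (fpFst _ _)) (fpSnd _ _) (fp_comm _ _)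
  let k₂ : fibreProd (g.comp f) υ →[G] fibreProd f π :=
    fpLift (fpFst _ _) ((piEval g hg π).comp k₁) fun z => (p_piEval g hg π (k₁ z)).symm
  have sq : IsPullbackSquare k₁ k₂ (piEval g hg π) (piRho f hf p) := by
    refine ⟨fun _ => rfl, ?_⟩
    rintro ⟨⟨x, b⟩, hb⟩ ⟨⟨y, d⟩, hd⟩ e
    have hy : f x = y := by
      have e1 : b = piEval g hg π ⟨(y, d), hd⟩ := e
      have e2 : f x = π b := hb
      exact e2.trans ((congrArg π e1).trans (p_piEval g hg π ⟨(y, d), hd⟩))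
    subst hy
    refine ⟨⟨(x, d), hd⟩, ⟨fp_ext rfl e.symm, rfl⟩, fun z hz => ?_⟩
    exact fp_ext (congrArg (fpFst f π) hz.1) (congrArg (fpSnd g υ) hz.2)
  have hexp : IsExp (g.comp f) p ((piEval f hf p).comp k₂) (fpSnd (g.comp f) υ) υ := by
    refine IsExp.of_fibreProd (fun z => p_piEval f hf p _) fun y σ hσ => ?_
    refine ⟨⟨y, fun v hv => ⟨v, fun x hx => σ x ((congrArg g hx).trans hv), fun x _ => hσ x _⟩,
      fun _ _ => rfl⟩, ⟨rfl, fun _ _ => rfl⟩, ?_⟩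
    rintro ⟨z, s, hs⟩ ⟨e, H⟩
    refine PiSet.ext' e fun v h1 h2 => PiSet.ext' (hs v h1) fun x h3 h4 => ?_
    obtain rfl : f x = v := h4
    exact H x h2
  rw [cl_mk_nm hexp (isMul_fpSnd hgf υ) hυ, cl_mk_nm_pi, cl_mk_nm_pi,
    M.mackey _ _ _ _ (isMul_of_square sq (isMul_piRho hf p)) _ sq,
    ← M.push_comp _ _ _ _ (isMul_comp (isMul_of_square sq (isMul_piRho hf p)) (isMul_piRho hg π)),
    ← M.pull_comp]
  rfl

theorem nm_mackey {X' Y' X Y : GSet TS.C} (g' : X' →[G] Y') (f' : X' →[G] X) (f : Y' →[G] Y)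
    (g : X →[G] Y) (hg' : TS.IsMul g') (hg : TS.IsMul g) (h : IsPullbackSquare g' f' f g)
    (x : EltClass M X) : (x.nm g hg).pull f = (x.pull f').nm g' hg' := by
  obtain ⟨A, p, hp, m, rfl⟩ := exists_cl x
  let π := piProj g hg p
  let υ := fpFst f π
  have hυ : TS.IsAdd υ := isAdd_fpFst f (isAdd_piProj hg hp)
  let k : fibreProd g' υ →[G] fibreProd g π :=
    fpLift (f'.comp (fpFst _ _)) ((fpSnd f π).comp (fpSnd _ _)) fun z =>
      (h.1 _).symm.trans ((congrArg f (fp_comm _ _ z)).trans (fp_comm f π _))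
  have sq : IsPullbackSquare (fpSnd g' υ) k (fpSnd f π) (piRho g hg p) := by
    refine ⟨fun _ => rfl, ?_⟩
    rintro ⟨⟨x, s⟩, hs⟩ ⟨⟨y, t⟩, ht⟩ e
    obtain rfl : s = t := e
    obtain ⟨x', ⟨h1, h2⟩, h3⟩ := h.2 x y (Eq.trans hs (Eq.symm ht))
    refine ⟨⟨(x', ⟨(y, s), ht⟩), h2⟩, ⟨fp_ext h1 rfl, rfl⟩, fun z hz => ?_⟩
    refine fp_ext (h3 _ ⟨congrArg (fpFst _ _) hz.1, ?_⟩) hz.2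
    exact (fp_comm _ _ z).trans (congrArg (fpFst f π) hz.2)
  have hexp : IsExp g' (fpFst f' p) (fpLift (fpFst g' υ) ((piEval g hg p).comp k) fun z =>
      (p_piEval g hg p (k z)).symm) (fpSnd g' υ) υ := by
    refine IsExp.of_fibreProd (fun z => rfl) fun y σ hσ => ?_
    have aux : ∀ (x₁ x₂ : X') (e : x₁ = x₂) (h : g' x₁ = y) (h' : g' x₂ = y),
        σ x₁ h = σ x₂ h' := by
      rintro x _ rfl _ _
      rfl
    choose L hL hL' using fun x (e : g x = f y) => h.2 x y e
    refine ⟨⟨(y, ⟨f y, fun x e => fpSnd _ _ (σ (L x e) (hL x e).2), fun x e => ?_⟩), rfl⟩,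
      ⟨rfl, fun x e => ?_⟩, ?_⟩
    · rw [← fp_comm, hσ]
      exact (hL x e).1
    · refine fp_ext (hσ x e).symm ?_
      have e' : g (f' x) = f y := (h.1 x).symm.trans (congrArg f e)
      have e0 := aux _ _ (hL' _ e' x ⟨rfl, e⟩).symm (hL _ e').2 e
      have e1 := congrArg (fpSnd f' p) e0
      exact e1
    · rintro ⟨⟨z, s⟩, hs⟩ ⟨e, H⟩
      obtain rfl : z = y := e
      refine fp_ext rfl (PiSet.ext' hs.symm fun x h1 h2 => ?_)
      have := congrArg (fpSnd f' p) (H (L x h2) (hL x h2).2)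
      refine Eq.trans ?_ this
      exact PiSet.sec_congr s (hL x h2).1.symm _ _
  rw [cl_mk_nm_pi, cl_mk_pull (isPullbackSquare_fibreProd f π) hυ,
    cl_mk_pull (isPullbackSquare_fibreProd f' p) (isAdd_fpFst f' hp),
    cl_mk_nm hexp (isMul_fpSnd hg' υ) hυ, M.mackey _ _ _ _ (isMul_fpSnd hg' υ) _ sq,
    ← M.pull_comp, ← M.pull_comp]
  rfl

theorem exponential {X Y Z X' Y' : GSet TS.C} (η : X →[G] Y) (ξ : Z →[G] X) (ζ : X' →[G] Z)
    (η' : X' →[G] Y') (υ : Y' →[G] Y) (hη : TS.IsMul η) (hξ : TS.IsAdd ξ) (hη' : TS.IsMul η')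
    (hυ : TS.IsAdd υ) (h : IsExponential η ξ ζ η' υ) (x : EltClass M Z) :
    ((x.pull ζ).nm η' hη').tr υ hυ = (x.tr ξ hξ).nm η hη := by
  obtain ⟨A, p, hp, m, rfl⟩ := exists_cl x
  replace h := h.isExp
  let π := piProj η' hη' (fpFst ζ p)
  have hexp : IsExp η (ξ.comp p) ((fpSnd ζ p).comp (piEval η' hη' (fpFst ζ p)))
      (piRho η' hη' (fpFst ζ p)) (υ.comp π) := by
    have key : ∀ w, p (fpSnd ζ p (piEval η' hη' (fpFst ζ p) w)) = ζ (fpFst _ _ w) := fun w => by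
      rw [← fp_comm, p_piEval]
    have key' : ∀ w, ξ (p (fpSnd ζ p (piEval η' hη' (fpFst ζ p) w))) = ξ (ζ (fpFst _ _ w)) :=
      fun w => congrArg ξ (key w)
    refine ⟨fun w => ?_, fun x d e => ?_, fun y σ hσ => ?_⟩
    · refine (congrArg η (key' w)).trans ((h.comm _).trans ?_)
      exact congrArg υ (fp_comm _ _ w)
    · obtain ⟨x', ⟨h1, h2⟩, h3⟩ := h.lift x (π d) e
      refine ⟨⟨(x', d), h2⟩, ⟨(key' _).trans h1, rfl⟩, fun w hw => ?_⟩
      refine fp_ext (h3 _ ⟨(key' w).symm.trans hw.1, ?_⟩) hw.2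
      exact (fp_comm _ _ w).trans (congrArg π hw.2)
    · have aux : ∀ (x₁ x₂ : X) (e : x₁ = x₂) (h : η x₁ = y) (h' : η x₂ = y),
          σ x₁ h = σ x₂ h' := by
        rintro x _ rfl _ _
        rfl
      obtain ⟨y', ⟨h1, h2⟩, h3⟩ := h.sec y (fun x e => p (σ x e)) hσ
      have hy {x'} (e : η' x' = y') : η (ξ (ζ x')) = y := by rw [h.comm, e, h1]
      refine ⟨⟨y', fun x' e => ⟨(x', σ (ξ (ζ x')) (hy e)), h2 x' (hy e) e⟩, fun _ _ => rfl⟩,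
        ⟨h1, ?_⟩, ?_⟩
      · rintro w hw e
        have e1 : η' (fpFst _ _ w) = y' := by
          rw [fp_comm]
          exact congrArg PiSet.pt e
        obtain ⟨⟨x', d⟩, hd⟩ := w
        obtain rfl := show d = _ from e
        exact aux _ _ (key' ⟨(x', _), hd⟩).symm _ _
      · rintro ⟨z, s, hs⟩ ⟨e, H⟩
        have e0 : z = y' := h3 z ⟨e, fun x' hx' e' => by
          have e2 := key ⟨(x', ⟨z, s, hs⟩), e'⟩
          refine e2.symm.trans (congrArg p ((H _ ?_ rfl).trans (aux _ _ (congrArg ξ e2) _ _)))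
          exact (congrArg (fun v => η (ξ v)) e2).trans hx'⟩
        refine PiSet.ext' e0 fun x' h4 h5 => fp_ext (hs x' h4) ?_
        have e2 := key ⟨(x', ⟨z, s, hs⟩), h4⟩
        exact (H ⟨(x', ⟨z, s, hs⟩), h4⟩ ((congrArg (fun v => η (ξ v)) e2).trans (hy h5)) rfl).trans
          (aux _ _ (congrArg ξ e2) _ _)
  rw [cl_mk_pull (isPullbackSquare_fibreProd ζ p) (isAdd_fpFst ζ hp), cl_mk_nm_pi, cl_mk_tr,
    cl_mk_tr, cl_mk_nm hexp (isMul_piRho _ _) (isAdd_comp (isAdd_piProj hη'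
      (isAdd_fpFst ζ hp)) hυ), M.pull_comp]

end EltClass

end Transfers

section DirectSums

variable {G : Type u} [Group G] {C : Set (Subgroup G)}

/-- Maps out of a direct sum can be defined on the summands. -/
theorem IsDirectSum.exists_desc {L : Type u} {X : GSet C} {F : L → GSet C} {i : ∀ l, F l →[G] X}
    (h : IsDirectSum F i) {Y : GSet C} (k : ∀ l, F l →[G] Y) :
    ∃ f : X →[G] Y, ∀ l x, f (i l x) = k l x := by
  choose z hz using h.2
  have hz' : ∀ l x, z (i l x) = ⟨l, x⟩ := fun l x => h.1 (hz _)
  have key : ∀ l x, k (z (i l x)).1 (z (i l x)).2 = k l x := fun l x => by rw [hz']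
  refine ⟨⟨fun x => k (z x).1 (z x).2, fun g x => ?_⟩, key⟩
  obtain ⟨⟨l, x⟩, rfl⟩ := h.2 x
  show k (z (g • i l x)).1 (z (g • i l x)).2 = g • k (z (i l x)).1 (z (i l x)).2
  rw [← map_smul, key, key, map_smul]

/-- The disjoint union of a family of `G`-sets. -/
def sigma {L : Type u} (A : L → GSet C) : GSet C where
  carrier := Σ l, A l
  act :=
    { smul := fun g z => ⟨z.1, g • z.2⟩
      one_smul := fun z => Sigma.ext rfl (heq_of_eq (one_smul G z.2))
      mul_smul := fun g h z => Sigma.ext rfl (heq_of_eq (mul_smul g h z.2)) }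
  stab_mem z := by
    convert (A z.1).stab_mem z.2 using 1
    ext g
    rw [MulAction.mem_stabilizer_iff, MulAction.mem_stabilizer_iff]
    exact ⟨fun h => eq_of_heq (Sigma.ext_iff.1 h).2, fun h => Sigma.ext rfl (heq_of_eq h)⟩

/-- The inclusion of a summand. -/
def sigmaMk {L : Type u} (A : L → GSet C) (l : L) : A l →[G] sigma A where
  toFun a := (⟨l, a⟩ : Σ l, A l)
  map_smul' _ _ := rfl

theorem isDirectSum_sigma {L : Type u} (A : L → GSet C) : IsDirectSum A (sigmaMk A) :=
  ⟨fun _ _ h => h, fun z => ⟨z, rfl⟩⟩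

end DirectSums

section Additivity

variable {G : Type u} [Group G] {TS : TambaraSystem G}

open TambaraSystem

variable {M N : SMack TS} {X Y : GSet TS.C}

theorem isDirectSum_fpSnd {L : Type u} {X A : GSet TS.C} {F : L → GSet TS.C}
    {i : ∀ l, F l →[G] X} (h : IsDirectSum F i) (p : A →[G] X) :
    IsDirectSum (fun l => fibreProd (i l) p) (fun l => fpSnd (i l) p) := by
  constructor
  · rintro ⟨l, ⟨⟨x, a⟩, ha⟩⟩ ⟨l', ⟨⟨x', a'⟩, ha'⟩⟩ e
    obtain rfl : a = a' := e
    have := h.1 (a₁ := ⟨l, x⟩) (a₂ := ⟨l', x'⟩) (Eq.trans ha (Eq.symm ha'))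
    cases this
    rfl
  · intro a
    obtain ⟨⟨l, x⟩, hx⟩ := h.2 (p a)
    exact ⟨⟨l, ⟨(x, a), hx⟩⟩, rfl⟩

namespace EltClass

theorem pull_injective_of_isDirectSum {L : Type u} {X : GSet TS.C} {F : L → GSet TS.C}
    {i : ∀ l, F l →[G] X} (h : IsDirectSum F i) :
    Function.Injective (fun (x : EltClass M X) (l : L) => x.pull (i l)) := by
  intro x y e
  obtain ⟨A, p, hp, m, rfl⟩ := exists_cl x
  obtain ⟨B, q, hq, n, rfl⟩ := exists_cl y
  have e' (l : L) : ∃ f : fibreProd (i l) p →[G] fibreProd (i l) q, Function.Bijective f ∧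
      (fpFst (i l) q).comp f = fpFst (i l) p ∧
      M.pull f (M.pull (fpSnd (i l) q) n) = M.pull (fpSnd (i l) p) m := by
    have := congrFun e l
    dsimp only at this
    rwa [cl_mk_pull (isPullbackSquare_fibreProd _ _) (isAdd_fpFst _ hp),
      cl_mk_pull (isPullbackSquare_fibreProd _ _) (isAdd_fpFst _ hq), cl_eq_iff] at this
  choose f hf hpf hm using e'
  have hp' (l z) : fpFst (i l) q (f l z) = fpFst (i l) p z := DFunLike.congr_fun (hpf l) z
  have hA := isDirectSum_fpSnd h p
  have hB := isDirectSum_fpSnd h q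
  obtain ⟨k, hk⟩ := hA.exists_desc fun l => (fpSnd (i l) q).comp (f l)
  have hk' (l z) : k (fpSnd (i l) p z) = fpSnd (i l) q (f l z) := hk l z
  refine cl_eq k ⟨fun a b e => ?_, fun b => ?_⟩ ?_ ?_
  · obtain ⟨⟨l, z⟩, rfl⟩ := hA.2 a
    obtain ⟨⟨l', z'⟩, rfl⟩ := hA.2 b
    dsimp only at e
    rw [hk', hk'] at e
    have := hB.1 (a₁ := ⟨l, f l z⟩) (a₂ := ⟨l', f l' z'⟩) e
    obtain rfl : l = l' := congrArg Sigma.fst this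
    have e2 : f l z = f l z' := by simpa using this
    rw [(hf l).1 e2]
  · obtain ⟨⟨l, w⟩, rfl⟩ := hB.2 b
    obtain ⟨z, rfl⟩ := (hf l).2 w
    exact ⟨_, hk' l z⟩
  · ext a
    obtain ⟨⟨l, z⟩, rfl⟩ := hA.2 a
    show q (k (fpSnd (i l) p z)) = p (fpSnd (i l) p z)
    rw [hk', ← fp_comm, ← fp_comm, hp']
  · refine M.ext_of_isDirectSum hA fun l => ?_
    rw [← hm l, ← M.pull_comp, ← M.pull_comp]
    exact congrArg (fun f => M.pull f n) (MulActionHom.ext (hk' l))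

theorem pull_surjective_of_isDirectSum {L : Type u} {X : GSet TS.C} {F : L → GSet TS.C}
    {i : ∀ l, F l →[G] X} (h : IsDirectSum F i) :
    Function.Surjective (fun (x : EltClass M X) (l : L) => x.pull (i l)) := by
  intro y
  choose A p hp m hy using fun l => exists_cl (y l)
  have hs := isDirectSum_sigma A
  obtain ⟨k, hk⟩ := (M.additive _ _ hs).2 m
  have hk' : ∀ l, M.pull (sigmaMk A l) k = m l := congrFun hk
  obtain ⟨q, hq⟩ := hs.exists_desc fun l => (i l).comp (p l)
  have hq' (l a) : q (sigmaMk A l a) = i l (p l a) := hq l a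
  have eq_of {l l' x x'} (e : i l x = i l' x') : (⟨l, x⟩ : Σ l, F l) = ⟨l', x'⟩ := h.1 e
  have hqa : TS.IsAdd q := by
    refine isAdd_of_finite (sigma A).stab_mem _ fun x => ?_
    obtain ⟨⟨l, x⟩, rfl⟩ := h.2 x
    refine (((hp l).1 x).image (sigmaMk A l)).subset ?_
    rintro ⟨l', a⟩ ha
    obtain ⟨rfl, e⟩ := Sigma.mk.inj_iff.1 (eq_of ((hq' l' a).symm.trans ha))
    obtain rfl := eq_of_heq e
    exact ⟨a, rfl, rfl⟩
  refine ⟨cl ⟨sigma A, q, hqa, k⟩, funext fun l => ?_⟩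
  dsimp only
  rw [hy l, ← hk' l]
  refine cl_mk_pull ⟨fun a => (hq' l a).symm, ?_⟩ (hp l)
  rintro ⟨l', a⟩ x e
  obtain ⟨rfl, e⟩ := Sigma.mk.inj_iff.1 (eq_of ((hq' l' a).symm.trans e))
  obtain rfl := eq_of_heq e
  exact ⟨a, ⟨rfl, rfl⟩, fun b hb => eq_of_heq (Sigma.ext_iff.1 hb.1).2⟩

end EltClass

/-- The semi-Tambara functor `𝒮_M`. -/
noncomputable def semiTambara (M : SMack TS) : STam TS where
  obj X := EltClass M X
  pull f :=
    { toFun := EltClass.pull f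
      map_one' := EltClass.pull_one f
      map_mul' := EltClass.pull_mul f
      map_zero' := EltClass.pull_zero f
      map_add' := EltClass.pull_add f }
  tr f hf :=
    { toFun := EltClass.tr f hf
      map_zero' := EltClass.tr_zero f hf
      map_add' := EltClass.tr_add f hf }
  nm f hf :=
    { toFun := EltClass.nm f hf
      map_one' := EltClass.nm_one f hf
      map_mul' := EltClass.nm_mul f hf }
  pull_id _ := EltClass.pull_id
  pull_comp := EltClass.pull_comp
  tr_id _ := EltClass.tr_id
  tr_comp := EltClass.tr_comp
  nm_id _ := EltClass.nm_id
  nm_comp := EltClass.nm_comp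
  tr_mackey := EltClass.tr_mackey
  nm_mackey := EltClass.nm_mackey
  additive _ _ h :=
    ⟨EltClass.pull_injective_of_isDirectSum h, EltClass.pull_surjective_of_isDirectSum h⟩
  exponential := EltClass.exponential

theorem cl_mk_map {A : GSet TS.C} {p : A →[G] X} {hp : TS.IsAdd p} {m : M.obj A} (φ : M ⟶ N) :
    (cl ⟨A, p, hp, m⟩).map φ = cl ⟨A, p, hp, SemiMackey.Hom.app φ A m⟩ :=
  (cl_map φ _).symm

/-- The map on classes as a homomorphism of semirings. -/
noncomputable def EltClass.mapRingHom (φ : M ⟶ N) : EltClass M X →+* EltClass N X where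
  toFun := EltClass.map φ
  map_one' := by
    rw [one_def, cl_mk_map, map_one]
    rfl
  map_mul' := fun x y => by
    obtain ⟨A, p, hp, m, rfl⟩ := exists_cl x
    obtain ⟨B, q, hq, n, rfl⟩ := exists_cl y
    rw [cl_mk_mul (isPullbackSquare_fibreProd p q) _ (isAdd_comp (isAdd_fpFst p hq) hp) rfl,
      cl_mk_map, cl_mk_map, cl_mk_map,
      cl_mk_mul (isPullbackSquare_fibreProd p q) _ (isAdd_comp (isAdd_fpFst p hq) hp) rfl,
      map_mul, SemiMackey.Hom.app_pull, SemiMackey.Hom.app_pull]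
  map_zero' := by
    rw [zero_def, cl_mk_map, map_one]
    rfl
  map_add' := fun x y => by
    obtain ⟨A, p, hp, m, rfl⟩ := exists_cl x
    obtain ⟨B, q, hq, n, rfl⟩ := exists_cl y
    obtain ⟨u, rfl, rfl⟩ := M.exists_of_isCoprod (isCoprod_sum A B) m n
    rw [cl_mk_add_sum, cl_mk_map, cl_mk_map, cl_mk_map, SemiMackey.Hom.app_pull,
      SemiMackey.Hom.app_pull, cl_mk_add_sum]

/-- The action of `𝒮` on morphisms. -/
noncomputable def semiTambaraMap (φ : M ⟶ N) : semiTambara M ⟶ semiTambara N :=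
  SemiTambara.Hom.mk (S := semiTambara M) (T := semiTambara N)
    (fun X => EltClass.mapRingHom φ)
    (fun f x => by
      obtain ⟨A, p, hp, m, rfl⟩ := exists_cl x
      show ((cl _).pull f).map φ = ((cl _).map φ).pull f
      rw [cl_mk_pull (isPullbackSquare_fibreProd f p) (isAdd_fpFst f hp), cl_mk_map, cl_mk_map,
        cl_mk_pull (isPullbackSquare_fibreProd f p) (isAdd_fpFst f hp), SemiMackey.Hom.app_pull])
    (fun f hf x => by
      obtain ⟨A, p, hp, m, rfl⟩ := exists_cl x
      show ((cl _).tr f hf).map φ = ((cl _).map φ).tr f hf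
      rw [cl_mk_tr, cl_mk_map, cl_mk_map, cl_mk_tr])
    (fun f hf x => by
      obtain ⟨A, p, hp, m, rfl⟩ := exists_cl x
      show ((cl _).nm f hf).map φ = ((cl _).map φ).nm f hf
      rw [EltClass.cl_mk_nm_pi, cl_mk_map, cl_mk_map, EltClass.cl_mk_nm_pi,
        SemiMackey.Hom.app_push, SemiMackey.Hom.app_pull])

/-- The functor `𝒮`. -/
noncomputable def semiTambaraFunctor (TS : TambaraSystem G) : SMack TS ⥤ STam TS where
  obj := semiTambara
  map := semiTambaraMap
  map_id M := by
    refine SemiTambara.Hom.ext (funext fun X => RingHom.ext fun x => ?_)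
    obtain ⟨A, p, hp, m, rfl⟩ := exists_cl (M := M) x
    exact cl_mk_map (𝟙 M)
  map_comp {M N P} φ ψ := by
    refine SemiTambara.Hom.ext (funext fun X => RingHom.ext fun x => ?_)
    obtain ⟨A, p, hp, m, rfl⟩ := exists_cl (M := M) x
    show (cl _).map (φ ≫ ψ) = ((cl _).map φ).map ψ
    rw [cl_mk_map, cl_mk_map, cl_mk_map]
    rfl

/-- `𝒮` consists of the isomorphism classes of pairs. -/
noncomputable def semiTambarization (TS : TambaraSystem G) :
    SemiTambarization (semiTambaraFunctor TS) where
  cls := cl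
  cls_surjective := cl_surjective
  cls_eq_iff := cl_eq_iff
  cls_add := cl_add
  cls_mul := cl_mul
  cls_pull := cl_pull
  cls_tr := cl_tr
  cls_nm := cl_nm
  cls_map φ _ a := cl_map φ a

end Additivity

section TambaraArithmetic

variable {G : Type u} [Group G] {TS : TambaraSystem G}

open TambaraSystem

/-- The additive part of a semi-Tambara functor. -/
def addPart (T : STam TS) : SemiMackey TS.C (finIndexFamily TS.C) where
  obj X := Multiplicative (T.obj X)
  pull f := AddMonoidHom.toMultiplicative (T.pull f).toAddMonoidHom
  push g hg := AddMonoidHom.toMultiplicative (T.tr g hg)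
  pull_id := T.pull_id
  pull_comp := T.pull_comp
  push_id := T.tr_id
  push_comp := T.tr_comp
  mackey := T.tr_mackey
  additive := T.additive

namespace SemiTambara

variable (T : STam TS) {X Y Z : GSet TS.C}

theorem ext_of_isDirectSum {L : Type u} {X : GSet TS.C} {F : L → GSet TS.C}
    {i : ∀ l, F l →[G] X} (h : IsDirectSum F i) {m n : T.obj X}
    (e : ∀ l, T.pull (i l) m = T.pull (i l) n) : m = n :=
  (T.additive F i h).1 (funext e)

theorem exists_of_isCoprod {A B D : GSet TS.C} {i : A →[G] D} {j : B →[G] D} (h : IsCoprod i j)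
    (m : T.obj A) (n : T.obj B) : ∃ k : T.obj D, T.pull i k = m ∧ T.pull j k = n :=
  (addPart T).exists_of_isCoprod h m n

theorem subsingleton_of_isEmpty (X : GSet TS.C) [IsEmpty X] : Subsingleton (T.obj X) :=
  (addPart T).subsingleton_of_isEmpty X

theorem tr_eq_add {A B D Y : GSet TS.C} {i : A →[G] D} {j : B →[G] D} (h : IsCoprod i j)
    (g : D →[G] Y) (hg : TS.IsAdd g) (hgi : TS.IsAdd (g.comp i)) (hgj : TS.IsAdd (g.comp j))
    (m : T.obj D) :
    T.tr g hg m = T.tr (g.comp i) hgi (T.pull i m) + T.tr (g.comp j) hgj (T.pull j m) :=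
  (addPart T).push_eq_mul h (isAdd_of_injective h.injective_left)
    (isAdd_of_injective h.injective_right) g hg hgi hgj m

theorem nm_eq_mul {A B D Y : GSet TS.C} {i : A →[G] D} {j : B →[G] D} (h : IsCoprod i j)
    (g : D →[G] Y) (hg : TS.IsMul g) (hgi : TS.IsMul (g.comp i)) (hgj : TS.IsMul (g.comp j))
    (m : T.obj D) :
    T.nm g hg m = T.nm (g.comp i) hgi (T.pull i m) * T.nm (g.comp j) hgj (T.pull j m) :=
  ((mulPart TS).obj T).push_eq_mul h (isMul_of_injective h.injective_left)
    (isMul_of_injective h.injective_right) g hg hgi hgj m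

theorem tr_pull_of_bijective {f : X →[G] Y} (hf : Function.Bijective f) (h : TS.IsAdd f)
    (m : T.obj Y) : T.tr f h (T.pull f m) = m := by
  rw [← T.tr_mackey f f (MulActionHom.id G) (MulActionHom.id G) h (isAdd_id Y), T.tr_id, T.pull_id]
  exact ⟨fun _ => rfl, fun y y' e => by
    obtain ⟨x, rfl⟩ := hf.2 y
    exact ⟨x, ⟨rfl, e⟩, fun z hz => hf.1 hz.1⟩⟩

variable (X) in
/-- The fold map `X ⨿ X → X`. -/
abbrev _root_.BiTam.fold : sum X X →[G] X := copair (MulActionHom.id G) (MulActionHom.id G)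

theorem nm_fold (h : TS.IsMul (fold X)) (m : T.obj (sum X X)) :
    T.nm (fold X) h m = T.pull (inl X X) m * T.pull (inr X X) m := by
  rw [T.nm_eq_mul (isCoprod_sum X X) _ h (isMul_id X) (isMul_id X)]
  exact congrArg₂ _ (T.nm_id _ _ _) (T.nm_id _ _ _)

theorem tr_fold (h : TS.IsAdd (fold X)) (m : T.obj (sum X X)) :
    T.tr (fold X) h m = T.pull (inl X X) m + T.pull (inr X X) m := by
  rw [T.tr_eq_add (isCoprod_sum X X) _ h (isAdd_id X) (isAdd_id X)]
  exact congrArg₂ _ (T.tr_id _ _ _) (T.tr_id _ _ _)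

/-- The map `p ⨿ q`. -/
def _root_.BiTam.sumMap {A B X Y : GSet TS.C} (p : A →[G] X) (q : B →[G] Y) :
    sum A B →[G] sum X Y :=
  copair ((inl X Y).comp p) ((inr X Y).comp q)

theorem _root_.BiTam.isAdd_sumMap {A B X Y : GSet TS.C} {p : A →[G] X} {q : B →[G] Y}
    (hp : TS.IsAdd p) (hq : TS.IsAdd q) : TS.IsAdd (sumMap p q) :=
  isAdd_copair (isAdd_comp hp (isAdd_of_injective Sum.inl_injective))
    (isAdd_comp hq (isAdd_of_injective Sum.inr_injective))

theorem pull_inl_tr_sumMap {A B X Y : GSet TS.C} {p : A →[G] X} {q : B →[G] Y}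
    (hp : TS.IsAdd p) (h : TS.IsAdd (sumMap p q)) (m : T.obj (sum A B)) :
    T.pull (inl X Y) (T.tr (sumMap p q) h m) = T.tr p hp (T.pull (inl A B) m) := by
  refine T.tr_mackey _ _ _ _ hp h ⟨fun _ => rfl, ?_⟩ m
  rintro (a | b) x e
  · exact ⟨a, ⟨rfl, Sum.inl_injective e⟩, fun z hz => Sum.inl_injective hz.1⟩
  · exact (Sum.inr_ne_inl e).elim

theorem pull_inr_tr_sumMap {A B X Y : GSet TS.C} {p : A →[G] X} {q : B →[G] Y}
    (hq : TS.IsAdd q) (h : TS.IsAdd (sumMap p q)) (m : T.obj (sum A B)) :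
    T.pull (inr X Y) (T.tr (sumMap p q) h m) = T.tr q hq (T.pull (inr A B) m) := by
  refine T.tr_mackey _ _ _ _ hq h ⟨fun _ => rfl, ?_⟩ m
  rintro (a | b) x e
  · exact (Sum.inl_ne_inr e).elim
  · exact ⟨b, ⟨rfl, Sum.inr_injective e⟩, fun z hz => Sum.inr_injective hz.1⟩

theorem _root_.BiTam.isExp_fold {A B X : GSet TS.C} (p : A →[G] X) (q : B →[G] X) :
    IsExp (fold X) (sumMap p q) (sumMap (fpFst p q) (fpSnd p q)) (fold (fibreProd p q))
      (p.comp (fpFst p q)) := by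
  refine ⟨?_, ?_, ?_⟩
  · rintro (z | z)
    · rfl
    · exact (fp_comm p q z).symm
  · rintro (x | x) z e
    · refine ⟨Sum.inl z, ⟨congrArg Sum.inl e.symm, rfl⟩, ?_⟩
      rintro (w | w) ⟨h1, h2⟩
      · exact congrArg Sum.inl h2
      · exact (Sum.inr_ne_inl h1).elim
    · refine ⟨Sum.inr z, ⟨congrArg Sum.inr ((fp_comm p q z).symm.trans e.symm), rfl⟩, ?_⟩
      rintro (w | w) ⟨h1, h2⟩
      · exact (Sum.inl_ne_inr h1).elim
      · exact congrArg Sum.inr h2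
  · intro x σ hσ
    have h1 : ∃ a, σ (Sum.inl x) rfl = Sum.inl a ∧ p a = x := by
      have h := hσ (Sum.inl x) rfl
      rcases hs : σ (Sum.inl x) rfl with a | b
      · rw [hs] at h
        exact ⟨a, rfl, Sum.inl_injective h⟩
      · rw [hs] at h
        exact (Sum.inr_ne_inl h).elim
    have h2 : ∃ b, σ (Sum.inr x) rfl = Sum.inr b ∧ q b = x := by
      have h := hσ (Sum.inr x) rfl
      rcases hs : σ (Sum.inr x) rfl with a | b
      · rw [hs] at h
        exact (Sum.inl_ne_inr h).elim
      · rw [hs] at h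
        exact ⟨b, rfl, Sum.inr_injective h⟩
    obtain ⟨a, ha, rfl⟩ := h1
    obtain ⟨b, hb, hab⟩ := h2
    have aux : ∀ (x₁ x₂ : sum X X) (e : x₁ = x₂) (h : fold X x₁ = p a) (h' : fold X x₂ = p a),
        σ x₁ h = σ x₂ h' := by
      rintro x _ rfl _ _
      rfl
    refine ⟨⟨(a, b), hab.symm⟩, ⟨rfl, ?_⟩, ?_⟩
    · rintro (w | w) h e
      · obtain rfl : w = ⟨(a, b), hab.symm⟩ := e
        exact ha.symm
      · obtain rfl : w = ⟨(a, b), hab.symm⟩ := e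
        exact hb.symm.trans (aux _ _ (congrArg Sum.inr hab.symm) _ _)
    · rintro w ⟨h3, h4⟩
      have h5 := h4 (Sum.inl w) h3 rfl
      have h6 := h4 (Sum.inr w) ((fp_comm p q w).symm.trans h3) rfl
      refine fp_ext ?_ ?_
      · exact Sum.inl_injective (h5.trans ((aux _ _ (congrArg Sum.inl h3) _ _).trans ha))
      · exact Sum.inr_injective (h6.trans ((aux _ _ (congrArg Sum.inr
          ((fp_comm p q w).symm.trans h3)) _ _).trans hb))

/-- Multiplicativity of transfers (Frobenius reciprocity). -/
theorem tr_mul_tr {A B X : GSet TS.C} {p : A →[G] X} {q : B →[G] X} (hp : TS.IsAdd p)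
    (hq : TS.IsAdd q) (h : TS.IsAdd (p.comp (fpFst p q))) (m : T.obj A) (n : T.obj B) :
    T.tr p hp m * T.tr q hq n =
      T.tr (p.comp (fpFst p q)) h (T.pull (fpFst p q) m * T.pull (fpSnd p q) n) := by
  obtain ⟨u, rfl, rfl⟩ := T.exists_of_isCoprod (isCoprod_sum A B) m n
  have hf : ∀ Z : GSet TS.C, TS.IsMul (fold Z) := fun Z => isMul_copair (isMul_id Z) (isMul_id Z)
  have := T.exponential (fold X) (sumMap p q) (sumMap (fpFst p q) (fpSnd p q))
    (fold (fibreProd p q)) (p.comp (fpFst p q)) (hf _) (isAdd_sumMap hp hq) (hf _) h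
    (isExp_fold p q).isExponential u
  rw [T.nm_fold, T.nm_fold, T.pull_inl_tr_sumMap hp, T.pull_inr_tr_sumMap hq, ← T.pull_comp,
    ← T.pull_comp] at this
  rw [← this, ← T.pull_comp, ← T.pull_comp]
  rfl

end SemiTambara

end TambaraArithmetic

section Adjunction

variable {G : Type u} [Group G] {TS : TambaraSystem G}

open TambaraSystem

variable {M : SMack TS} {T : STam TS} (φ : M ⟶ (mulPart TS).obj T) {X Y : GSet TS.C}

/-- The components of a morphism into a multiplicative part. -/
def mulApp (X : GSet TS.C) : M.obj X →* T.obj X := SemiMackey.Hom.app φ X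

theorem mulApp_pull (f : X →[G] Y) (m : M.obj Y) :
    mulApp φ X (M.pull f m) = T.pull f (mulApp φ Y m) :=
  SemiMackey.Hom.app_pull φ f m

theorem mulApp_push (f : X →[G] Y) (hf : TS.IsMul f) (m : M.obj X) :
    mulApp φ Y (M.push f hf m) = T.nm f hf (mulApp φ X m) :=
  SemiMackey.Hom.app_push φ f hf m

namespace Elt

/-- The value `p_+ φ(m)` of a pair `(p, m)`. -/
def eval (a : Elt M X) : T.obj X := T.tr a.p a.isAdd (mulApp φ a.A a.m)

theorem eval_eq_of_iso {a b : Elt M X} (h : a.Iso b) : a.eval φ = b.eval φ := by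
  obtain ⟨f, hf, hp, hm⟩ := h
  have hfa : TS.IsAdd f := isAdd_of_injective hf.1
  have key : ∀ (p : a.A →[G] X) (hp : TS.IsAdd p) (m : M.obj a.A), b.p.comp f = p →
      M.pull f b.m = m → T.tr p hp (mulApp φ a.A m) = b.eval φ := by
    rintro _ _ _ rfl rfl
    rw [mulApp_pull, T.tr_comp f b.p hfa b.isAdd, T.tr_pull_of_bijective hf]
    rfl
  exact key a.p a.isAdd a.m hp hm

theorem eval_add (a b : Elt M X) : (a.add b).eval φ = a.eval φ + b.eval φ := by
  have key : ∀ k : M.obj (sum a.A b.A), T.tr (copair a.p b.p) (isAdd_copair a.isAdd b.isAdd)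
      (mulApp φ _ k) = T.tr a.p a.isAdd (mulApp φ a.A (M.pull (inl a.A b.A) k)) +
        T.tr b.p b.isAdd (mulApp φ b.A (M.pull (inr a.A b.A) k)) := fun k => by
    rw [mulApp_pull, mulApp_pull]
    exact T.tr_eq_add (isCoprod_sum a.A b.A) (copair a.p b.p) _ _ _ _
  refine (key (glue M a.m b.m)).trans ?_
  rw [glue_inl, glue_inr]
  rfl

theorem eval_mul (a b : Elt M X) : (a.mul b).eval φ = a.eval φ * b.eval φ := by
  refine Eq.trans ?_ (T.tr_mul_tr a.isAdd b.isAdd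
    (isAdd_comp (isAdd_fpFst a.p b.isAdd) a.isAdd) _ _).symm
  rw [← mulApp_pull, ← mulApp_pull, ← map_mul]
  rfl

theorem eval_pull (f : Y →[G] X) (a : Elt M X) : (a.pull f).eval φ = T.pull f (a.eval φ) := by
  refine Eq.trans ?_ (T.tr_mackey _ _ _ _ (isAdd_fpFst f a.isAdd) a.isAdd
    (isPullbackSquare_fibreProd f a.p) _).symm
  rw [← mulApp_pull]
  rfl

theorem eval_tr (f : X →[G] Y) (hf : TS.IsAdd f) (a : Elt M X) :
    (a.tr f hf).eval φ = T.tr f hf (a.eval φ) :=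
  T.tr_comp a.p f a.isAdd hf (isAdd_comp a.isAdd hf) _

theorem eval_nm (f : X →[G] Y) (hf : TS.IsMul f) (a : Elt M X) :
    (a.nm f hf).eval φ = T.nm f hf (a.eval φ) := by
  refine Eq.trans ?_ (T.exponential f a.p (piEval f hf a.p) (piRho f hf a.p) (piProj f hf a.p) hf
    a.isAdd (EltClass.isMul_piRho hf a.p) (EltClass.isAdd_piProj hf a.isAdd)
    (isExponential_pi f hf a.p) _)
  rw [← mulApp_pull, ← mulApp_push]
  rfl

/-- The pair `(id, m)`. -/
def ofVal (m : M.obj X) : Elt M X := ⟨X, MulActionHom.id G, isAdd_id X, m⟩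

theorem eval_ofVal (m : M.obj X) : (ofVal m).eval φ = mulApp φ X m :=
  T.tr_id _ _ _

theorem ofVal_mul_iso (m n : M.obj X) : (ofVal (m * n)).Iso ((ofVal m).mul (ofVal n)) := by
  have : Iso ⟨X, MulActionHom.id G, isAdd_id X,
      M.pull (MulActionHom.id G) m * M.pull (MulActionHom.id G) n⟩ ((ofVal m).mul (ofVal n)) :=
    mul_iso (a := ofVal m) (b := ofVal n) (isPullbackSquare_id (MulActionHom.id G)) (isAdd_id X) rfl
  rwa [M.pull_id, M.pull_id] at this

theorem ofVal_pull_iso (f : Y →[G] X) (m : M.obj X) :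
    (ofVal (M.pull f m)).Iso ((ofVal m).pull f) :=
  pull_iso (a := ofVal m) (isPullbackSquare_id f) (isAdd_id Y)

theorem isExp_id (f : X →[G] Y) :
    IsExp f (MulActionHom.id G) (MulActionHom.id G) f (MulActionHom.id G) :=
  ⟨fun _ => rfl, fun x _ e => ⟨x, ⟨rfl, e⟩, fun _ h => h.1⟩, fun y _ hσ =>
    ⟨y, ⟨rfl, fun _ _ _ => (hσ _ _).symm⟩, fun _ hz => hz.1⟩⟩

theorem ofVal_push_iso (f : X →[G] Y) (hf : TS.IsMul f) (m : M.obj X) :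
    (ofVal (M.push f hf m)).Iso ((ofVal m).nm f hf) := by
  have : Iso ⟨Y, MulActionHom.id G, isAdd_id Y, M.push f hf (M.pull (MulActionHom.id G) m)⟩
      ((ofVal m).nm f hf) :=
    nm_iso (a := ofVal m) (isExp_id f).isExponential hf (isAdd_id Y)
  rwa [M.pull_id] at this

end Elt

namespace SemiTambarization

variable {S : SMack TS ⥤ STam TS} (s : SemiTambarization S)

theorem cls_eq {a b : Elt M X} (h : a.Iso b) : s.cls a = s.cls b :=
  (s.cls_eq_iff a b).2 h

theorem cls_ofVal_one : s.cls (Elt.ofVal (1 : M.obj X)) = 1 := by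
  have key : ∀ x : (S.obj M).obj X, s.cls (Elt.ofVal (1 : M.obj X)) * x = x := by
    intro x
    obtain ⟨a, rfl⟩ := s.cls_surjective x
    rw [← s.cls_mul]
    refine (s.cls_eq ?_).symm
    have := Elt.mul_iso (a := Elt.ofVal (1 : M.obj X)) (b := a) (i := a.p)
      (j := MulActionHom.id G) (isPullbackSquare_id a.p).symm a.isAdd rfl
    rwa [M.pull_id, show (Elt.ofVal (1 : M.obj X)).m = 1 from rfl, map_one, one_mul] at this
  rw [← key 1, mul_one]

theorem cls_empty (h : TS.IsAdd (ofEmpty (empty TS.C) X)) (m : M.obj (empty TS.C)) :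
    s.cls ⟨empty TS.C, ofEmpty _ _, h, m⟩ = 0 := by
  have key : ∀ x : (S.obj M).obj X, s.cls ⟨empty TS.C, ofEmpty _ _, h, m⟩ + x = x := by
    intro x
    obtain ⟨a, rfl⟩ := s.cls_surjective x
    rw [← s.cls_add]
    exact s.cls_eq (Elt.add_iso (a := ⟨empty TS.C, ofEmpty _ _, h, m⟩) (i := ofEmpty _ a.A)
      (j := MulActionHom.id G)
      (IsCoprod.of isEmptyElim (fun _ _ e => e) isEmptyElim fun d => Or.inr ⟨d, rfl⟩) a.isAdd
      (ofEmpty_eq _ _) rfl ((M.subsingleton_of_isEmpty (empty TS.C)).elim _ _) (M.pull_id _ _))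
  rw [← key 0, add_zero]

/-- The unit of the adjunction between `𝒮` and `μ`. -/
def unitHom (M : SMack TS) : M ⟶ (mulPart TS).obj (S.obj M) :=
  SemiMackey.Hom.mk (N := (mulPart TS).obj (S.obj M))
    (fun _ =>
      { toFun := fun m => s.cls (Elt.ofVal m)
        map_one' := s.cls_ofVal_one
        map_mul' := fun m n => (s.cls_eq (Elt.ofVal_mul_iso m n)).trans (s.cls_mul _ _) })
    (fun f m => (s.cls_eq (Elt.ofVal_pull_iso f m)).trans (s.cls_pull f _))
    (fun f hf m => (s.cls_eq (Elt.ofVal_push_iso f hf m)).trans (s.cls_nm f hf _))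

/-- The extension of `φ` to isomorphism classes of pairs. -/
noncomputable def extend {X : GSet TS.C} (x : (S.obj M).obj X) : T.obj X :=
  (s.cls_surjective x).choose.eval φ

theorem extend_cls (a : Elt M X) : s.extend φ (s.cls a) = a.eval φ :=
  Elt.eval_eq_of_iso φ ((s.cls_eq_iff _ _).1 (s.cls_surjective (s.cls a)).choose_spec)

/-- The morphism `𝒮_M → T` with `(p, m) ↦ p_+ φ(m)`. -/
noncomputable def extendHom : S.obj M ⟶ T :=
  SemiTambara.Hom.mk (S := S.obj M)
    (fun X =>
      { toFun := s.extend φ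
        map_one' := by
          rw [← s.cls_ofVal_one, extend_cls, Elt.eval_ofVal, map_one]
        map_mul' := fun x y => by
          obtain ⟨a, rfl⟩ := s.cls_surjective x
          obtain ⟨b, rfl⟩ := s.cls_surjective y
          rw [← s.cls_mul, extend_cls, extend_cls, extend_cls, Elt.eval_mul]
        map_zero' := by
          rw [← s.cls_empty (inO_of_isEmpty _) 1, extend_cls]
          have := T.subsingleton_of_isEmpty (empty TS.C)
          have h : mulApp φ (empty TS.C) 1 = 0 := Subsingleton.elim _ _
          exact (congrArg (T.tr _ _) h).trans (map_zero _)
        map_add' := fun x y => by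
          obtain ⟨a, rfl⟩ := s.cls_surjective x
          obtain ⟨b, rfl⟩ := s.cls_surjective y
          rw [← s.cls_add, extend_cls, extend_cls, extend_cls, Elt.eval_add] })
    (fun f x => by
      obtain ⟨a, rfl⟩ := s.cls_surjective x
      rw [← s.cls_pull]
      exact (s.extend_cls φ _).trans ((Elt.eval_pull φ f a).trans
        (congrArg (T.pull f) (s.extend_cls φ a).symm)))
    (fun f hf x => by
      obtain ⟨a, rfl⟩ := s.cls_surjective x
      rw [← s.cls_tr]
      exact (s.extend_cls φ _).trans ((Elt.eval_tr φ f hf a).trans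
        (congrArg (T.tr f hf) (s.extend_cls φ a).symm)))
    (fun f hf x => by
      obtain ⟨a, rfl⟩ := s.cls_surjective x
      rw [← s.cls_nm]
      exact (s.extend_cls φ _).trans ((Elt.eval_nm φ f hf a).trans
        (congrArg (T.nm f hf) (s.extend_cls φ a).symm)))

theorem extendHom_app_cls (a : Elt M X) :
    SemiTambara.Hom.app (s.extendHom φ) X (s.cls a) = a.eval φ :=
  s.extend_cls φ a

theorem cls_eq_tr (a : Elt M X) :
    s.cls a = (S.obj M).tr a.p a.isAdd (s.cls (Elt.ofVal a.m)) := by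
  rw [← s.cls_tr]
  rfl

theorem hom_ext {f g : S.obj M ⟶ T}
    (h : ∀ (X : GSet TS.C) (m : M.obj X), SemiTambara.Hom.app f X (s.cls (Elt.ofVal m)) =
      SemiTambara.Hom.app g X (s.cls (Elt.ofVal m))) : f = g := by
  refine SemiTambara.Hom.ext (funext fun X => RingHom.ext fun x => ?_)
  obtain ⟨a, rfl⟩ := s.cls_surjective x
  rw [cls_eq_tr, SemiTambara.Hom.app_tr, SemiTambara.Hom.app_tr, h]

/-- `𝒮` is left adjoint to the multiplicative part. -/
noncomputable def adjunction : S ⊣ mulPart TS :=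
  Adjunction.mkOfHomEquiv
    { homEquiv := fun M T =>
        { toFun := fun f => s.unitHom M ≫ (mulPart TS).map f
          invFun := fun φ => s.extendHom φ
          left_inv := fun f => s.hom_ext fun X m => by
            rw [extendHom_app_cls, Elt.eval_ofVal]
            rfl
          right_inv := fun φ => SemiMackey.Hom.ext (funext fun X => MonoidHom.ext fun m =>
            (s.extendHom_app_cls φ (Elt.ofVal m)).trans (Elt.eval_ofVal φ m)) }
      homEquiv_naturality_left_symm := fun {M' M T} f g => s.hom_ext fun X m => by
        refine (s.extendHom_app_cls _ _).trans ?_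
        show _ = SemiTambara.Hom.app (s.extendHom g) X
          (SemiTambara.Hom.app (S.map f) X (s.cls (Elt.ofVal m)))
        rw [← s.cls_map, extendHom_app_cls]
        rfl
      homEquiv_naturality_right := fun {M T T'} f g => rfl }

end SemiTambarization

end Adjunction

section PolynomialNorms

variable {G : Type u} [Group G] {TS : TambaraSystem G}

open TambaraSystem

variable {X Y Z : GSet TS.C}

/-- The sections with values in the first summand. -/
def IsLeftSec (η : X →[G] Y) (hη : TS.IsMul η) (s : piObj η hη (fold X)) : Prop :=
  ∀ x (h : η x = PiSet.pt s), ∃ x' : X, PiSet.sec s x h = inl X X x'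

theorem smul_eq_inl_iff (g : G) (z : sum X X) :
    (∃ x, g • z = inl X X x) ↔ ∃ x, z = inl X X x := by
  constructor
  · rintro ⟨x, hx⟩
    exact ⟨g⁻¹ • x, by rw [map_smul, ← hx, inv_smul_smul]⟩
  · rintro ⟨x, rfl⟩
    exact ⟨g • x, (map_smul _ _ _).symm⟩

theorem isLeftSec_smul {η : X →[G] Y} {hη : TS.IsMul η} (g : G) (s : piObj η hη (fold X)) :
    IsLeftSec η hη (g • s) = IsLeftSec η hη s := by
  refine propext ⟨fun H x h => ?_, fun H x h => ?_⟩
  · have h' : η (g • x) = g • PiSet.pt s := by rw [map_smul, h]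
    have := H (g • x) h'
    have e : PiSet.sec (g • s : PiSet η (fold X)) (g • x) h' = g • PiSet.sec s x h :=
      congrArg _ (PiSet.sec_congr _ (inv_smul_smul g x) _ _)
    rw [← smul_eq_inl_iff g, ← e]
    exact this
  · exact (smul_eq_inl_iff g _).2 (H _ _)

theorem fold_inl (x : X) : fold X (inl X X x) = x := rfl

theorem fold_inr (x : X) : fold X (inr X X x) = x := rfl

/-- The multiplicative transfer along a map with fibres of at most `n` elements is polynomial of
degree at most `n`. -/
theorem isPoly_nm (T : STam TS) (n : ℕ) : ∀ {X Y : GSet TS.C} (η : X →[G] Y) (hη : TS.IsMul η),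
    (∀ y, {x | η x = y}.ncard ≤ n) → IsPoly n (T.nm η hη) := by
  induction n with
  | zero =>
    intro X Y η hη h
    have : IsEmpty X := ⟨fun x => by
      have := (Set.ncard_eq_zero (hη.1 (η x))).1 (Nat.le_zero.1 (h (η x)))
      exact Set.eq_empty_iff_forall_notMem.1 this x rfl⟩
    have := T.subsingleton_of_isEmpty X
    exact fun a => congrArg _ (Subsingleton.elim a 0)
  | succ n ih =>
    intro X Y η hη h b
    let P := piObj η hη (fold X)
    let π : P →[G] Y := piProj η hη (fold X)
    let ev := piEval η hη (fold X)
    have hf : TS.IsAdd (fold X) := isAdd_copair (isAdd_id X) (isAdd_id X)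
    have hπ : TS.IsAdd π := EltClass.isAdd_piProj hη hf
    let c := IsLeftSec η hη
    have hc : ∀ (g : G) (s : P), c (g • s) = c s := isLeftSec_smul
    let i (q : Prop) := partIncl P c hc q
    let υ (q : Prop) := π.comp (i q)
    have hυ (q) : TS.IsAdd (υ q) :=
      isAdd_comp (isAdd_of_injective (partIncl_injective P c hc q)) hπ
    let k (q : Prop) : fibreProd η (υ q) →[G] fibreProd η π :=
      fpLift (fpFst η (υ q)) ((i q).comp (fpSnd η (υ q))) (fp_comm η (υ q))
    have step : ∀ w, T.nm η hη (T.tr (fold X) hf w) =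
        T.tr (υ True) (hυ _) (T.nm (fpSnd η (υ True)) (EltClass.isMul_fpSnd hη _)
          (T.pull (k True) (T.pull ev w))) +
        T.tr (υ False) (hυ _) (T.nm (fpSnd η (υ False)) (EltClass.isMul_fpSnd hη _)
          (T.pull (k False) (T.pull ev w))) := by
      intro w
      rw [← T.exponential η (fold X) ev (piRho η hη (fold X)) π hη hf (EltClass.isMul_piRho hη _) hπ
        (isExponential_pi η hη (fold X)), T.tr_eq_add (isCoprod_part P c hc) π hπ (hυ _) (hυ _),
        T.nm_mackey _ _ _ _ (EltClass.isMul_fpSnd hη (υ True)) _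
          (EltClass.isPullbackSquare_piRho (i True) (υ True) fun _ => rfl),
        T.nm_mackey _ _ _ _ (EltClass.isMul_fpSnd hη (υ False)) _
          (EltClass.isPullbackSquare_piRho (i False) (υ False) fun _ => rfl)]
    have hev : ∀ z, fold X (ev z) = fpFst η π z := p_piEval η hη (fold X)
    have left : ∀ w, T.tr (υ True) (hυ _) (T.nm (fpSnd η (υ True)) (EltClass.isMul_fpSnd hη _)
          (T.pull (k True) (T.pull ev w))) = T.nm η hη (T.pull (inl X X) w) := by
      intro w
      have e1 : ev.comp (k True) = (inl X X).comp (fpFst η (υ True)) := by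
        ext z
        obtain ⟨x, hx⟩ := (eq_iff_iff.1 (fpSnd η (υ True) z).2).2 trivial (fpFst _ _ z)
          (fp_comm _ _ z)
        have hx' : ev (k True z) = inl X X x := hx
        have e2 := hev (k True z)
        rw [hx', fold_inl] at e2
        show ev (k True z) = _
        rw [hx', e2]
        rfl
      have hexp : IsExp η (MulActionHom.id G) (fpFst η (υ True)) (fpSnd η (υ True)) (υ True) := by
        refine IsExp.of_fibreProd (fun _ => rfl) fun y σ hσ => ?_
        let s : PiSet η (fold X) := ⟨y, fun x _ => inl X X x, fun _ _ => rfl⟩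
        refine ⟨⟨s, eq_true fun x _ => ⟨x, rfl⟩⟩, ⟨rfl, fun x h => (hσ x h).symm⟩, ?_⟩
        rintro ⟨t, ht⟩ ⟨e, H⟩
        refine Subtype.ext (PiSet.ext' e fun x h1 h2 => ?_)
        obtain ⟨x', hx'⟩ := (eq_iff_iff.1 ht).2 trivial x h1
        have e2 := t.p_sec x h1
        rw [hx', fold_inl] at e2
        rw [hx', e2]
      have := T.exponential η (MulActionHom.id G) (fpFst η (υ True)) (fpSnd η (υ True)) (υ True) hη
        (isAdd_id X) (EltClass.isMul_fpSnd hη _) (hυ _) hexp.isExponential (T.pull (inl X X) w)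
      rw [T.tr_id, ← T.pull_comp] at this
      rw [← this, ← T.pull_comp, e1]
    let D := fibreProd η (υ False)
    let d : D → Prop := fun z => ∃ x, ev (k False z) = inl X X x
    have hd : ∀ (g : G) (z : D), d (g • z) = d z := fun g z => by
      refine propext ?_
      show (∃ x, ev (k False (g • z)) = inl X X x) ↔ _
      rw [map_smul, map_smul]
      exact smul_eq_inl_iff g _
    let j (q : Prop) := partIncl D d hd q
    let ρ (q : Prop) := (fpSnd η (υ False)).comp (j q)
    have hρ (q) : TS.IsMul (ρ q) :=
      isMul_comp (isMul_of_injective (partIncl_injective D d hd q)) (EltClass.isMul_fpSnd hη _)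
    let r (q : Prop) := (fpFst η (υ False)).comp (j q)
    have eU : (ev.comp (k False)).comp (j True) = (inl X X).comp (r True) := by
      ext z
      obtain ⟨x, hx⟩ := (eq_iff_iff.1 z.2).2 trivial
      have e2 := hev (k False (j True z))
      have hx' : ev (k False (j True z)) = inl X X x := hx
      rw [hx', fold_inl] at e2
      show ev (k False (j True z)) = _
      rw [hx', e2]
      rfl
    have eV : (ev.comp (k False)).comp (j False) = (inr X X).comp (r False) := by
      ext z
      have e2 := hev (k False (j False z))
      rcases (isCoprod_sum X X).cases (ev (k False (j False z))) with ⟨x, hx⟩ | ⟨x, hx⟩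
      · exact ((eq_iff_iff.1 z.2).1 ⟨x, hx.symm⟩).elim
      · rw [← hx, fold_inr] at e2
        show ev (k False (j False z)) = _
        rw [← hx, e2]
        rfl
    let β := T.nm (ρ False) (hρ _) (T.pull (r False) b)
    have hbound : ∀ y, {x | ρ True x = y}.ncard ≤ n := by
      intro y
      have hy : ¬ c y.1 := (eq_iff_iff.1 y.2).1
      simp only [c, IsLeftSec, not_forall] at hy
      obtain ⟨x₀, h₀, hx₀⟩ := hy
      have inj : Set.InjOn (r True) {x | ρ True x = y} := by
        intro z hz z' hz' e
        exact partIncl_injective D d hd True (fp_ext e (Eq.trans hz (Eq.symm hz')))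
      rw [← inj.ncard_image]
      refine Nat.le_of_lt_succ (lt_of_lt_of_le (Set.ncard_lt_ncard ⟨?_, fun hs => ?_⟩ (hη.1 _))
        (h (PiSet.pt y.1)))
      · rintro _ ⟨z, rfl, rfl⟩
        exact fp_comm η (υ False) (j True z)
      · obtain ⟨z, hz, hzx⟩ := hs h₀
        obtain ⟨x, hx⟩ := (eq_iff_iff.1 z.2).2 trivial
        refine hx₀ ⟨x, ?_⟩
        subst hz
        subst hzx
        exact hx
    refine ⟨fun a => T.tr (υ False) (hυ _) (T.nm (ρ True) (hρ _) (T.pull (r True) a) * β),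
      ((ih (ρ True) (hρ True) hbound).comp (T.pull (r True)).toAddMonoidHom).map
        ((T.tr (υ False) (hυ _)).comp (AddMonoidHom.mulRight β)), fun a => ?_⟩
    obtain ⟨w, rfl, rfl⟩ := T.exists_of_isCoprod (isCoprod_sum X X) a b
    have hU : T.pull (j True) (T.pull (k False) (T.pull ev w)) =
        T.pull (r True) (T.pull (inl X X) w) := by
      rw [← T.pull_comp, ← T.pull_comp, ← T.pull_comp]
      exact congrArg (fun f => T.pull f w) eU
    have hV : T.pull (j False) (T.pull (k False) (T.pull ev w)) =
        T.pull (r False) (T.pull (inr X X) w) := by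
      rw [← T.pull_comp, ← T.pull_comp, ← T.pull_comp]
      exact congrArg (fun f => T.pull f w) eV
    rw [← T.tr_fold hf, step, left, T.nm_eq_mul (isCoprod_part D d hd) _ _ (hρ True) (hρ False)]
    exact congrArg _ (congrArg _ (congrArg₂ _ (congrArg _ hU) (congrArg _ hV)))

end PolynomialNorms

section Orbits

variable {G : Type u} [Group G] {C : Set (Subgroup G)}

/-- The orbit `l` of `Y`. -/
abbrev orb (Y : GSet C) (l : MulAction.orbitRel.Quotient G Y) : GSet C :=
  part Y (L := MulAction.orbitRel.Quotient G Y) (Quotient.mk _)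
    (fun g _ => Quotient.sound (MulAction.orbitRel_apply.2 ⟨g, rfl⟩)) l

/-- The inclusion of an orbit. -/
abbrev orbIncl (Y : GSet C) (l : MulAction.orbitRel.Quotient G Y) : orb Y l →[G] Y :=
  partIncl Y _ _ l

theorem isDirectSum_orb (Y : GSet C) : IsDirectSum (orb Y) (orbIncl Y) :=
  isDirectSum_part Y _ _

theorem exists_smul_eq_of_orb {Y : GSet C} {l : MulAction.orbitRel.Quotient G Y} (y z : orb Y l) :
    ∃ g : G, g • orbIncl Y l z = orbIncl Y l y :=
  MulAction.orbitRel_apply.1 (Quotient.exact (y.2.trans z.2.symm))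

theorem ncard_fibre_smul {X Y : GSet C} (f : X →[G] Y) (g : G) (y : Y) :
    {x | f x = g • y}.ncard = {x | f x = y}.ncard := by
  have : {x | f x = g • y} = (fun x => g • x) '' {x | f x = y} := by
    ext x
    constructor
    · intro h
      refine ⟨g⁻¹ • x, ?_, smul_inv_smul g x⟩
      show f (g⁻¹ • x) = y
      rw [map_smul, show f x = g • y from h, inv_smul_smul]
    · rintro ⟨x, rfl, rfl⟩
      exact map_smul f g x
  rw [this, Set.ncard_image_of_injective _ (MulAction.injective g)]

theorem exists_ncard_fibre_le {X Y : GSet C} (f : X →[G] Y)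
    (l : MulAction.orbitRel.Quotient G Y) :
    ∃ n, ∀ y : orb Y l, {x | f x = orbIncl Y l y}.ncard ≤ n := by
  induction l using Quotient.inductionOn with | _ y₀ => ?_
  refine ⟨{x | f x = y₀}.ncard, fun y => ?_⟩
  obtain ⟨g, hg⟩ := exists_smul_eq_of_orb y ⟨y₀, rfl⟩
  rw [← hg, ncard_fibre_smul]
  exact le_rfl

theorem IsPullbackSquare.ncard_fibre_le {X' Y' X Y : Type u} [MulAction G X'] [MulAction G Y']
    [MulAction G X] [MulAction G Y] {g' : X' →[G] Y'} {f' : X' →[G] X} {f : Y' →[G] Y}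
    {g : X →[G] Y} (h : IsPullbackSquare g' f' f g) (y : Y') (hg : {x | g x = f y}.Finite) :
    {x | g' x = y}.ncard ≤ {x | g x = f y}.ncard := by
  refine Set.ncard_le_ncard_of_injOn f' (fun x hx => ?_) (fun a ha b hb e => ?_) hg
  · show g (f' x) = f y
    rw [← h.1, show g' x = y from hx]
  · have hb' : g' b = g' a := Eq.trans hb (Eq.symm ha)
    exact (h.2 (f' a) (g' a) (h.1 a).symm).unique ⟨rfl, rfl⟩ ⟨e.symm, hb'⟩

theorem exists_orb_lift {X Y : GSet C} (f : X →[G] Y) (l : MulAction.orbitRel.Quotient G X) :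
    ∃ (l' : MulAction.orbitRel.Quotient G Y) (h : orb X l →[G] orb Y l'),
      f.comp (orbIncl X l) = (orbIncl Y l').comp h := by
  induction l using Quotient.inductionOn with | _ x₀ => ?_
  refine ⟨Quotient.mk _ (f x₀), ⟨fun x => ⟨f (orbIncl X _ x), ?_⟩, fun g x => ?_⟩, rfl⟩
  · obtain ⟨g, hg⟩ := exists_smul_eq_of_orb x ⟨x₀, rfl⟩
    rw [← hg, map_smul]
    exact Quotient.sound (MulAction.orbitRel_apply.2 ⟨g, rfl⟩)
  · exact Subtype.ext (map_smul (f.comp (orbIncl X _)) g x)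

end Orbits

section RingCompletion

variable {G : Type u} [Group G] {TS : TambaraSystem G}

open TambaraSystem

/-- Multiplicative transfers are polynomial over each orbit of the target. -/
theorem exists_isPoly_pull_nm (T : STam TS) {X Y : GSet TS.C} (η : X →[G] Y) (hη : TS.IsMul η)
    (l : MulAction.orbitRel.Quotient G Y) :
    ∃ n, IsPoly n (fun m => T.pull (orbIncl Y l) (T.nm η hη m)) := by
  obtain ⟨n, hn⟩ := exists_ncard_fibre_le η l
  have sq := isPullbackSquare_fibreProd (orbIncl Y l) η
  have hm := isMul_of_square sq hη
  refine ⟨n, ?_⟩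
  have := (isPoly_nm T n _ hm fun y => (sq.ncard_fibre_le y (hη.1 _)).trans (hn y)).comp
    (T.pull (fpSnd (orbIncl Y l) η)).toAddMonoidHom
  convert this using 2 with m
  exact T.nm_mackey _ _ _ _ hm hη sq m

/-- The value at `X` of the ring completion of `T`. -/
def kObj (T : STam TS) (X : GSet TS.C) : Type u := K0 (T.obj X)

noncomputable instance (T : STam TS) (X : GSet TS.C) : CommRing (kObj T X) :=
  inferInstanceAs (CommRing (K0 (T.obj X)))

section

variable (T : STam TS) {X Y Z X' Y' : GSet TS.C}

/-- The canonical map to the ring completion. -/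
noncomputable def kOf (X : GSet TS.C) : T.obj X →+* kObj T X := K0.of (T.obj X)

theorem isRingCompletion_kOf (X : GSet TS.C) : IsRingCompletion (kOf T X) :=
  K0.isRingCompletion (T.obj X)

/-- The restriction maps of the ring completion. -/
noncomputable def kPull (f : X →[G] Y) : kObj T Y →+* kObj T X :=
  ((isRingCompletion_kOf T Y).exists_lift ((kOf T X).comp (T.pull f))).choose

theorem kPull_kOf (f : X →[G] Y) (m : T.obj Y) : kPull T f (kOf T Y m) = kOf T X (T.pull f m) :=
  ((isRingCompletion_kOf T Y).exists_lift ((kOf T X).comp (T.pull f))).choose_spec m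

/-- The additive transfers of the ring completion. -/
noncomputable def kTr (g : X →[G] Y) (hg : TS.IsAdd g) : kObj T X →+ kObj T Y :=
  ((isRingCompletion_kOf T X).exists_liftAdd
    ((kOf T Y).toAddMonoidHom.comp (T.tr g hg))).choose

theorem kTr_kOf (g : X →[G] Y) (hg : TS.IsAdd g) (m : T.obj X) :
    kTr T g hg (kOf T X m) = kOf T Y (T.tr g hg m) :=
  ((isRingCompletion_kOf T X).exists_liftAdd
    ((kOf T Y).toAddMonoidHom.comp (T.tr g hg))).choose_spec m

theorem kPull_id (a : kObj T X) : kPull T (MulActionHom.id G : X →[G] X) a = a := by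
  refine RingHom.congr_fun ((isRingCompletion_kOf T X).ringHom_ext
    (ψ := RingHom.id _) fun m => ?_) a
  rw [kPull_kOf, T.pull_id]
  rfl

theorem kPull_comp (f : X →[G] Y) (g : Y →[G] Z) (a : kObj T Z) :
    kPull T (g.comp f) a = kPull T f (kPull T g a) := by
  refine RingHom.congr_fun ((isRingCompletion_kOf T Z).ringHom_ext
    (ψ := (kPull T f).comp (kPull T g)) fun m => ?_) a
  rw [RingHom.comp_apply, kPull_kOf, kPull_kOf, kPull_kOf, T.pull_comp]

theorem kTr_id (h : TS.IsAdd (MulActionHom.id G : X →[G] X)) (a : kObj T X) :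
    kTr T (MulActionHom.id G : X →[G] X) h a = a := by
  refine (isRingCompletion_kOf T X).addHom_ext (ψ := AddMonoidHom.id _) (fun m => ?_) a
  rw [kTr_kOf, T.tr_id]
  rfl

theorem kTr_comp (f : X →[G] Y) (g : Y →[G] Z) (hf : TS.IsAdd f) (hg : TS.IsAdd g)
    (hgf : TS.IsAdd (g.comp f)) (a : kObj T X) :
    kTr T (g.comp f) hgf a = kTr T g hg (kTr T f hf a) := by
  refine (isRingCompletion_kOf T X).addHom_ext (ψ := (kTr T g hg).comp (kTr T f hf))
    (fun m => ?_) a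
  rw [AddMonoidHom.comp_apply, kTr_kOf, kTr_kOf, kTr_kOf, T.tr_comp f g hf hg]

theorem kTr_mackey (g' : X' →[G] Y') (f' : X' →[G] X) (f : Y' →[G] Y)
    (g : X →[G] Y) (hg' : TS.IsAdd g') (hg : TS.IsAdd g) (h : IsPullbackSquare g' f' f g)
    (a : kObj T X) : kPull T f (kTr T g hg a) = kTr T g' hg' (kPull T f' a) := by
  refine (isRingCompletion_kOf T X).addHom_ext
    (φ := (kPull T f).toAddMonoidHom.comp (kTr T g hg))
    (ψ := (kTr T g' hg').comp (kPull T f').toAddMonoidHom) (fun m => ?_) a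
  show kPull T f (kTr T g hg _) = kTr T g' hg' (kPull T f' _)
  rw [kTr_kOf, kPull_kOf, kPull_kOf, kTr_kOf, T.tr_mackey _ _ _ _ hg' hg h]

theorem kObj_additive {L : Type u} {X : GSet TS.C} (F : L → GSet TS.C) (i : ∀ l, F l →[G] X)
    (h : IsDirectSum F i) :
    Function.Bijective (fun (a : kObj T X) (l : L) => kPull T (i l) a) := by
  constructor
  · intro a b e
    obtain ⟨-, h2, h3⟩ := isRingCompletion_kOf T X
    obtain ⟨x, y, hx⟩ := h2 a
    obtain ⟨x', y', hx'⟩ := h2 b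
    have key : ∀ l, ∃ c, T.pull (i l) (x + y') + c = T.pull (i l) (x' + y) + c := fun l => by
      refine ((isRingCompletion_kOf T (F l)).2.2 _ _).1 ?_
      rw [← kPull_kOf, ← kPull_kOf, map_add (kOf T X), map_add (kOf T X), ← hx, ← hx', map_add,
        map_add, map_add, map_add, show kPull T (i l) a = kPull T (i l) b from congrFun e l,
        add_right_comm]
    choose c hc using key
    obtain ⟨d, hd⟩ := (T.additive F i h).2 c
    have hd (l : L) : T.pull (i l) d = c l := congrFun hd l
    have := (h3 (x + y') (x' + y)).2 ⟨d, T.ext_of_isDirectSum h fun l => by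
      rw [map_add, hd, map_add _ _ d, hd, hc]⟩
    rw [map_add, map_add, ← hx, ← hx', add_right_comm] at this
    exact add_right_cancel (add_right_cancel this)
  · intro a
    choose x y hxy using fun l => (isRingCompletion_kOf T (F l)).2.1 (a l)
    obtain ⟨x', hx'⟩ := (T.additive F i h).2 x
    obtain ⟨y', hy'⟩ := (T.additive F i h).2 y
    refine ⟨kOf T X x' - kOf T X y', funext fun l => ?_⟩
    have h1 : T.pull (i l) x' = x l := congrFun hx' l
    have h2 : T.pull (i l) y' = y l := congrFun hy' l
    show kPull T (i l) _ = _
    rw [map_sub, kPull_kOf, kPull_kOf, h1, h2, sub_eq_iff_eq_add, hxy]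

theorem kObj_ext {L : Type u} {X : GSet TS.C} {F : L → GSet TS.C} {i : ∀ l, F l →[G] X}
    (h : IsDirectSum F i) {a b : kObj T X} (e : ∀ l, kPull T (i l) a = kPull T (i l) b) : a = b :=
  (kObj_additive T F i h).1 (funext e)

variable {T}

/-- Maps which are polynomial over each orbit of `Y`. -/
def LocPoly {B : Type*} [AddCommMonoid B] (F : B → kObj T Y) : Prop :=
  ∀ l, ∃ n, IsPoly n (fun b => kPull T (orbIncl Y l) (F b))

namespace LocPoly

variable {B B' : Type*} [AddCommMonoid B] [AddCommMonoid B'] {F F' : B → kObj T Y}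

theorem comp (hF : LocPoly F) (φ : B' →+ B) : LocPoly (fun b => F (φ b)) := fun l => by
  obtain ⟨n, hn⟩ := hF l
  exact ⟨n, hn.comp φ⟩

theorem of_isPoly {n : ℕ} (h : IsPoly n F) : LocPoly F := fun l =>
  ⟨n, h.map (kPull T (orbIncl Y l)).toAddMonoidHom⟩

theorem mul_const (hF : LocPoly F) (c : kObj T Y) : LocPoly (fun b => F b * c) := fun l => by
  obtain ⟨n, hn⟩ := hF l
  refine ⟨n, ?_⟩
  convert hn.map (AddMonoidHom.mulRight (kPull T (orbIncl Y l) c)) using 2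
  exact map_mul _ _ _

theorem const_mul (hF : LocPoly F) (c : kObj T Y) : LocPoly (fun b => c * F b) := by
  simpa only [mul_comm c] using hF.mul_const c

theorem pull (hF : LocPoly F) (f : X →[G] Y) : LocPoly (fun b => kPull T f (F b)) := fun l => by
  obtain ⟨l', h, e⟩ := exists_orb_lift f l
  obtain ⟨n, hn⟩ := hF l'
  refine ⟨n, ?_⟩
  convert hn.map (kPull T h).toAddMonoidHom using 2 with b
  show kPull T (orbIncl X l) (kPull T f (F b)) = kPull T h (kPull T (orbIncl Y l') (F b))
  rw [← kPull_comp, ← kPull_comp, e]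

theorem ext {F F' : kObj T X → kObj T Y} (hF : LocPoly F) (hF' : LocPoly F')
    (e : ∀ m, F (kOf T X m) = F' (kOf T X m)) (a : kObj T X) : F a = F' a := by
  refine kObj_ext T (isDirectSum_orb Y) fun l => ?_
  obtain ⟨n, hn⟩ := hF l
  obtain ⟨n', hn'⟩ := hF' l
  exact (isRingCompletion_kOf T X).eq_of_isPoly hn hn' (fun m => by rw [e]) a

end LocPoly

variable (T)

theorem exists_kNm (η : X →[G] Y) (hη : TS.IsMul η) :
    ∃ N : kObj T X → kObj T Y, (∀ m, N (kOf T X m) = kOf T Y (T.nm η hη m)) ∧ LocPoly N := by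
  have key : ∀ l, ∃ E : kObj T X → kObj T (orb Y l), (∃ n, IsPoly n E) ∧
      ∀ m, E (kOf T X m) = kOf T _ (T.pull (orbIncl Y l) (T.nm η hη m)) := fun l => by
    obtain ⟨n, hn⟩ := exists_isPoly_pull_nm T η hη l
    obtain ⟨E, h1, h2⟩ := (isRingCompletion_kOf T X).exists_isPoly_extension
      (hn.map (kOf T (orb Y l)).toAddMonoidHom)
    exact ⟨E, ⟨n, h1⟩, h2⟩
  choose E hE hE' using key
  choose N hN using fun a => (kObj_additive T _ _ (isDirectSum_orb Y)).2 fun l => E l a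
  have hN (l a) : kPull T (orbIncl Y l) (N a) = E l a := congrFun (hN a) l
  refine ⟨N, fun m => kObj_ext T (isDirectSum_orb Y) fun l => ?_, fun l => ?_⟩
  · rw [hN, hE', kPull_kOf]
  · simp only [hN]
    exact hE l

/-- The map underlying a multiplicative transfer of the ring completion. -/
noncomputable def kNmFun (η : X →[G] Y) (hη : TS.IsMul η) : kObj T X → kObj T Y :=
  (exists_kNm T η hη).choose

theorem kNmFun_kOf (η : X →[G] Y) (hη : TS.IsMul η) (m : T.obj X) :
    kNmFun T η hη (kOf T X m) = kOf T Y (T.nm η hη m) :=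
  (exists_kNm T η hη).choose_spec.1 m

theorem locPoly_kNmFun (η : X →[G] Y) (hη : TS.IsMul η) : LocPoly (kNmFun T η hη) :=
  (exists_kNm T η hη).choose_spec.2

theorem isPoly_kNmFun (η : X →[G] Y) (hη : TS.IsMul η) (n : ℕ)
    (hn : ∀ y, {x | η x = y}.ncard ≤ n) : IsPoly n (kNmFun T η hη) := by
  obtain ⟨E, h1, h2⟩ := (isRingCompletion_kOf T X).exists_isPoly_extension
    ((isPoly_nm T n η hη hn).map (kOf T Y).toAddMonoidHom)
  have : kNmFun T η hη = E := funext <| (locPoly_kNmFun T η hη).ext (.of_isPoly h1) fun m => by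
    rw [kNmFun_kOf, h2]
    rfl
  exact this ▸ h1

theorem kNmFun_mackey (g' : X' →[G] Y') (f' : X' →[G] X) (f : Y' →[G] Y)
    (g : X →[G] Y) (hg' : TS.IsMul g') (hg : TS.IsMul g) (h : IsPullbackSquare g' f' f g)
    (a : kObj T X) : kPull T f (kNmFun T g hg a) = kNmFun T g' hg' (kPull T f' a) := by
  refine LocPoly.ext ((locPoly_kNmFun T g hg).pull f)
    ((locPoly_kNmFun T g' hg').comp (kPull T f').toAddMonoidHom) (fun m => ?_) a
  show kPull T f (kNmFun T g hg _) = kNmFun T g' hg' (kPull T f' _)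
  rw [kNmFun_kOf, kPull_kOf, kPull_kOf, kNmFun_kOf, T.nm_mackey _ _ _ _ hg' hg h]

/-- The multiplicative transfers of the ring completion. -/
noncomputable def kNm (η : X →[G] Y) (hη : TS.IsMul η) : kObj T X →* kObj T Y where
  toFun := kNmFun T η hη
  map_one' := by rw [← map_one (kOf T X), kNmFun_kOf, map_one, map_one]
  map_mul' a b := by
    have hN := locPoly_kNmFun T η hη
    refine LocPoly.ext (hN.comp (AddMonoidHom.mulRight b)) (hN.mul_const _) (fun m => ?_) a
    refine LocPoly.ext (hN.comp (AddMonoidHom.mulLeft _)) (hN.const_mul _) (fun m' => ?_) b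
    show kNmFun T η hη (kOf T X m * kOf T X m') = _
    rw [← map_mul, kNmFun_kOf, kNmFun_kOf, kNmFun_kOf, map_mul, map_mul]

theorem kNm_kOf (η : X →[G] Y) (hη : TS.IsMul η) (m : T.obj X) :
    kNm T η hη (kOf T X m) = kOf T Y (T.nm η hη m) :=
  kNmFun_kOf T η hη m

theorem kNm_id (h : TS.IsMul (MulActionHom.id G : X →[G] X)) (a : kObj T X) :
    kNm T (MulActionHom.id G : X →[G] X) h a = a := by
  refine LocPoly.ext (locPoly_kNmFun T _ h) (.of_isPoly (.addMonoidHom (AddMonoidHom.id _)))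
    (fun m => ?_) a
  rw [kNmFun_kOf, T.nm_id]
  rfl

theorem kNm_comp (f : X →[G] Y) (g : Y →[G] Z) (hf : TS.IsMul f) (hg : TS.IsMul g)
    (hgf : TS.IsMul (g.comp f)) (a : kObj T X) :
    kNm T (g.comp f) hgf a = kNm T g hg (kNm T f hf a) := by
  refine LocPoly.ext (locPoly_kNmFun T _ hgf)
    (F' := fun a => kNmFun T g hg (kNmFun T f hf a)) (fun l => ?_) (fun m => ?_) a
  · obtain ⟨n, hn⟩ := exists_ncard_fibre_le g l
    obtain ⟨n', hn'⟩ := exists_ncard_fibre_le (g.comp f) l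
    let k := fpSnd (orbIncl Z l) g
    have sq := isPullbackSquare_fibreProd (orbIncl Z l) g
    have sq' := isPullbackSquare_fibreProd k f
    have hm := isMul_of_square sq hg
    have hm' := isMul_of_square sq' hf
    have p := isPoly_kNmFun T _ hm n fun y => (sq.ncard_fibre_le y (hg.1 _)).trans (hn y)
    have p' := isPoly_kNmFun T _ hm' n' fun y => (sq'.ncard_fibre_le y (hf.1 _)).trans <|
      (Set.ncard_le_ncard (fun x (hx : f x = k y) =>
        (congrArg g hx).trans (sq.1 y).symm) (hgf.1 _)).trans (hn' _)
    obtain ⟨N, hN⟩ := p.exists_comp (p'.comp (kPull T (fpSnd k f)).toAddMonoidHom)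
    have e : (fun b => kPull T (orbIncl Z l) (kNmFun T g hg (kNmFun T f hf b))) =
        fun b => kNmFun T _ hm (kNmFun T _ hm' (kPull T (fpSnd k f) b)) := funext fun b => by
      rw [kNmFun_mackey T _ _ _ _ hm hg sq]
      exact congrArg _ (kNmFun_mackey T _ _ _ _ hm' hf sq' b)
    rw [e]
    exact ⟨N, hN⟩
  · rw [kNmFun_kOf, kNmFun_kOf, kNmFun_kOf, T.nm_comp f g hf hg]

theorem k_exponential (η : X →[G] Y) (ξ : Z →[G] X) (ζ : X' →[G] Z)
    (η' : X' →[G] Y') (υ : Y' →[G] Y) (hη : TS.IsMul η) (hξ : TS.IsAdd ξ) (hη' : TS.IsMul η')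
    (hυ : TS.IsAdd υ) (h : IsExponential η ξ ζ η' υ) (a : kObj T Z) :
    kTr T υ hυ (kNm T η' hη' (kPull T ζ a)) = kNm T η hη (kTr T ξ hξ a) := by
  refine LocPoly.ext (F := fun a => kTr T υ hυ (kNmFun T η' hη' (kPull T ζ a))) (fun l => ?_)
    ((locPoly_kNmFun T η hη).comp (kTr T ξ hξ)) (fun m => ?_) a
  · obtain ⟨n, hn⟩ := exists_ncard_fibre_le η l
    let k := fpSnd (orbIncl Y l) υ
    have sq := isPullbackSquare_fibreProd (orbIncl Y l) υ
    have sq' := isPullbackSquare_fibreProd k η'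
    have sq₀ := h.isExp.isPullbackSquare
    have ha := isAdd_of_square sq hυ
    have hm := isMul_of_square sq' hη'
    have p := isPoly_kNmFun T _ hm n fun y => (sq'.ncard_fibre_le y (hη'.1 _)).trans <|
      (sq₀.ncard_fibre_le (k y) (hη.1 _)).trans (by
        rw [show υ (k y) = orbIncl Y l (fpFst (orbIncl Y l) υ y) from (sq.1 y).symm]
        exact hn _)
    refine ⟨n, ?_⟩
    convert (p.comp ((kPull T (fpSnd k η')).comp (kPull T ζ)).toAddMonoidHom).map
      (kTr T _ ha) using 2 with b
    rw [kTr_mackey T _ _ _ _ ha hυ sq]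
    exact congrArg _ (kNmFun_mackey T _ _ _ _ hm hη' sq' _)
  · rw [kPull_kOf, kNmFun_kOf, kTr_kOf, kTr_kOf, kNmFun_kOf,
      T.exponential η ξ ζ η' υ hη hξ hη' hυ h]

/-- The ring completion of a semi-Tambara functor. -/
noncomputable def ringCompletion : Tam TS where
  obj :=
    { obj := kObj T
      pull := kPull T
      tr := kTr T
      nm := kNm T
      pull_id := fun _ => kPull_id T
      pull_comp := kPull_comp T
      tr_id := fun _ => kTr_id T
      tr_comp := kTr_comp T
      nm_id := fun _ => kNm_id T
      nm_comp := kNm_comp T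
      tr_mackey := kTr_mackey T
      nm_mackey := kNmFun_mackey T
      additive := kObj_additive T
      exponential := k_exponential T }
  property X a := ⟨(-a : kObj T X), add_neg_cancel (a : kObj T X)⟩

/-- The canonical morphism to the ring completion. -/
noncomputable def toRingCompletion : T ⟶ (ringCompletion T).obj where
  app := kOf T
  app_pull f m := (kPull_kOf T f m).symm
  app_tr g hg m := (kTr_kOf T g hg m).symm
  app_nm g hg m := (kNm_kOf T g hg m).symm

end

end RingCompletion

section RingCompletionAdjunction

variable {G : Type u} [Group G] {TS : TambaraSystem G}

open TambaraSystem

variable {T : STam TS} {A R : Tam TS}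

theorem Tam.hom_ext_of_isRingCompletion (u : T ⟶ A.obj)
    (hu : ∀ X, IsRingCompletion (SemiTambara.Hom.app u X)) {f f' : A ⟶ R}
    (h : u ≫ f.hom = u ≫ f'.hom) : f = f' := by
  refine ObjectProperty.hom_ext _ (SemiTambara.Hom.ext (funext fun X => ?_))
  let _ := ringOfTambara TS R X
  exact (hu X).ringHom_ext fun m =>
    congrArg (fun g : T ⟶ R.obj => SemiTambara.Hom.app g X m) h

theorem Tam.exists_lift_of_isRingCompletion (u : T ⟶ A.obj)
    (hu : ∀ X, IsRingCompletion (SemiTambara.Hom.app u X)) (f : T ⟶ R.obj) :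
    ∃ f' : A ⟶ R, u ≫ f'.hom = f := by
  let _ := fun X => ringOfTambara TS R X
  choose F hF using fun X => (hu X).exists_lift (SemiTambara.Hom.app f X)
  have pull {X Y : GSet TS.C} (g : X →[G] Y) (a : A.obj.obj Y) :
      F X (A.obj.pull g a) = R.obj.pull g (F Y a) := by
    refine RingHom.congr_fun ((hu Y).ringHom_ext (φ := (F X).comp (A.obj.pull g))
      (ψ := RingHom.comp (R.obj.pull g) (F Y)) fun m => ?_) a
    show F X (A.obj.pull g _) = R.obj.pull g (F Y _)
    rw [hF, ← f.app_pull, ← hF, u.app_pull]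
  refine ⟨ObjectProperty.homMk ⟨F, pull, fun {X Y} g hg a => ?_, fun {X Y} g hg a => ?_⟩,
    SemiTambara.Hom.ext (funext fun X => RingHom.ext (hF X))⟩
  · refine (hu X).addHom_ext (φ := (F Y).toAddMonoidHom.comp (A.obj.tr g hg))
      (ψ := (R.obj.tr g hg).comp (F X).toAddMonoidHom) (fun m => ?_) a
    show F Y (A.obj.tr g hg _) = R.obj.tr g hg (F X _)
    rw [hF, ← f.app_tr, ← hF, u.app_tr]
  · refine R.obj.ext_of_isDirectSum (isDirectSum_orb Y) fun l => ?_
    obtain ⟨n, hn⟩ := exists_isPoly_pull_nm A.obj g hg l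
    obtain ⟨n', hn'⟩ := exists_isPoly_pull_nm R.obj g hg l
    have e : (fun a => R.obj.pull (orbIncl Y l) (F Y (A.obj.nm g hg a))) =
        fun a => F (orb Y l) (A.obj.pull (orbIncl Y l) (A.obj.nm g hg a)) :=
      funext fun a => (pull _ _).symm
    refine (hu X).eq_of_isPoly (φ := fun a => R.obj.pull (orbIncl Y l) (F Y (A.obj.nm g hg a)))
      (ψ := fun a => R.obj.pull (orbIncl Y l) (R.obj.nm g hg (F X a)))
      (e ▸ hn.map (F (orb Y l)).toAddMonoidHom)
      (hn'.comp (F X).toAddMonoidHom) (fun m => ?_) a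
    rw [hF, ← f.app_nm, ← hF, u.app_nm]

/-- Morphisms out of a ring completion. -/
noncomputable def Tam.homEquiv (u : T ⟶ A.obj)
    (hu : ∀ X, IsRingCompletion (SemiTambara.Hom.app u X)) (R : Tam TS) :
    (A ⟶ R) ≃ (T ⟶ R.obj) :=
  Equiv.ofBijective (fun f => u ≫ f.hom) ⟨fun _ _ => Tam.hom_ext_of_isRingCompletion u hu,
    Tam.exists_lift_of_isRingCompletion u hu⟩

theorem Tam.homEquiv_comp (u : T ⟶ A.obj)
    (hu : ∀ X, IsRingCompletion (SemiTambara.Hom.app u X)) {R R' : Tam TS} (g : R ⟶ R')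
    (f : A ⟶ R) :
    Tam.homEquiv u hu R' (f ≫ g) = Tam.homEquiv u hu R f ≫ (inclTam TS).map g :=
  (Category.assoc u f.hom g.hom).symm

/-- Ring completion is left adjoint to the inclusion. -/
noncomputable def RingCompletion.adjunction {γ : STam TS ⥤ Tam TS} (r : RingCompletion γ) :
    γ ⊣ inclTam TS :=
  Adjunction.mkOfHomEquiv
    { homEquiv := fun T R => Tam.homEquiv (r.unit.app T) (r.isRingCompletion T) R
      homEquiv_naturality_left_symm := fun {T' T R} f g => by
        rw [Equiv.symm_apply_eq]
        have := congrArg (f ≫ ·)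
          ((Tam.homEquiv (r.unit.app T) (r.isRingCompletion T) R).apply_symm_apply g)
        refine this.symm.trans ?_
        show f ≫ r.unit.app T ≫ _ = r.unit.app T' ≫ (inclTam TS).map (_ ≫ _)
        rw [Functor.map_comp, ← Category.assoc, ← Category.assoc]
        exact congrArg (· ≫ _) (r.unit.naturality f)
      homEquiv_naturality_right := fun f g => Tam.homEquiv_comp _ _ g f }

variable (TS) in
/-- The functor of ring completion. -/
noncomputable def ringCompletionFunctor : STam TS ⥤ Tam TS :=
  Adjunction.leftAdjointOfEquiv (G := inclTam TS)
    (fun T => Tam.homEquiv (toRingCompletion T) (isRingCompletion_kOf T))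
    fun _ _ _ g f => Tam.homEquiv_comp _ _ g f

variable (TS) in
/-- The canonical morphisms to the ring completion. -/
noncomputable def ringCompletionFunctorUnit : RingCompletion (ringCompletionFunctor TS) where
  unit := (Adjunction.adjunctionOfEquivLeft (G := inclTam TS)
    (fun T => Tam.homEquiv (toRingCompletion T) (isRingCompletion_kOf T))
    fun _ _ _ g f => Tam.homEquiv_comp _ _ g f).unit
  isRingCompletion T X := by
    simp only [Adjunction.adjunctionOfEquivLeft, Adjunction.mkOfHomEquiv_unit_app]
    exact isRingCompletion_kOf T X

end RingCompletionAdjunction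

section FibrewiseProducts

variable {X Y Z X' Y' Q : Type u} [CommMonoid Q]

/-- Multiplication along the fibres of `f`. -/
@[to_additive]
noncomputable def fibProd (f : X → Y) (hf : ∀ y, {x | f x = y}.Finite) : (X → Q) →* (Y → Q) where
  toFun m y := ∏ x ∈ (hf y).toFinset, m x
  map_one' := funext fun _ => Finset.prod_const_one
  map_mul' _ _ := funext fun _ => Finset.prod_mul_distrib

@[to_additive]
theorem fibProd_apply (f : X → Y) (hf : ∀ y, {x | f x = y}.Finite) (m : X → Q) (y : Y) :
    fibProd f hf m y = ∏ x ∈ (hf y).toFinset, m x := rfl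

@[to_additive]
theorem fibProd_id (hf : ∀ y, {x : X | x = y}.Finite) (m : X → Q) :
    fibProd (fun x => x) hf m = m := by
  funext y
  rw [fibProd_apply, show (hf y).toFinset = {y} by ext; simp, Finset.prod_singleton]

@[to_additive]
theorem fibProd_comp (f : X → Y) (g : Y → Z) (hf : ∀ y, {x | f x = y}.Finite)
    (hg : ∀ z, {y | g y = z}.Finite) (hgf : ∀ z, {x | g (f x) = z}.Finite) (m : X → Q) :
    fibProd (fun x => g (f x)) hgf m = fibProd g hg (fibProd f hf m) := by
  classical
  funext z
  rw [fibProd_apply, fibProd_apply, ← Finset.prod_fiberwise_of_maps_to (g := f)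
    (t := (hg z).toFinset) (by simp)]
  refine Finset.prod_congr rfl fun y hy => ?_
  rw [fibProd_apply]
  refine Finset.prod_congr ?_ fun _ _ => rfl
  have hy : g y = z := by simpa using hy
  ext x
  simp only [Finset.mem_filter, Set.Finite.mem_toFinset, Set.mem_ofPred_eq, and_iff_right_iff_imp]
  rintro rfl
  exact hy

@[to_additive]
theorem fibProd_pullback {g' : X' → Y'} {f' : X' → X} {f : Y' → Y} {g : X → Y}
    (hg' : ∀ y, {x | g' x = y}.Finite) (hg : ∀ y, {x | g x = y}.Finite)
    (h : ∀ x', f (g' x') = g (f' x'))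
    (h' : ∀ x y', g x = f y' → ∃! x', f' x' = x ∧ g' x' = y') (m : X → Q) (y' : Y') :
    fibProd g hg m (f y') = fibProd g' hg' (fun x' => m (f' x')) y' := by
  rw [fibProd_apply, fibProd_apply]
  refine (Finset.prod_bij (fun x' _ => f' x') (fun x' hx' => ?_) (fun a ha b hb e => ?_)
    (fun x hx => ?_) fun _ _ => rfl).symm
  · have : g' x' = y' := by simpa using hx'
    simp [← h, this]
  · have ha : g' a = y' := by simpa using ha
    have hb : g' b = y' := by simpa using hb
    exact (h' (f' a) y' (by rw [← h, ha])).unique ⟨rfl, ha⟩ ⟨e.symm, hb⟩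
  · obtain ⟨x', ⟨h1, h2⟩, -⟩ := h' x y' (by simpa using hx)
    exact ⟨x', by simpa using h2, h1⟩

end FibrewiseProducts

theorem IsExp.fibSum_fibProd {G : Type u} [Group G] {X Y A X' Y' R : Type u} [MulAction G X]
    [MulAction G Y] [MulAction G A] [MulAction G X'] [MulAction G Y'] [CommSemiring R]
    {η : X →[G] Y} {p : A →[G] X} {ζ : X' →[G] A} {η' : X' →[G] Y'} {υ : Y' →[G] Y}
    (h : IsExp η p ζ η' υ) (hη : ∀ y, {x | η x = y}.Finite) (hp : ∀ x, {a | p a = x}.Finite)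
    (hη' : ∀ y, {x | η' x = y}.Finite) (hυ : ∀ y, {x | υ x = y}.Finite) (m : A → R) :
    fibSum υ hυ (fibProd η' hη' fun x' => m (ζ x')) = fibProd η hη (fibSum p hp m) := by
  classical
  funext y
  simp only [fibSum_apply, fibProd_apply]
  choose L hL hL' using h.lift
  have e {x y'} (hx : x ∈ (hη y).toFinset) (hy' : y' ∈ (hυ y).toFinset) : η x = υ y' := by
    simp only [Set.Finite.mem_toFinset, Set.mem_ofPred_eq] at hx hy'
    rw [hx, hy']
  rw [Finset.prod_sum]
  refine Finset.sum_bij (fun y' hy' x hx => ζ (L x y' (e hx hy'))) (fun y' hy' => ?_)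
    (fun y₁ h₁ y₂ h₂ eq => ?_) (fun σ hσ => ?_) (fun y' hy' => ?_)
  · simp only [Finset.mem_pi, Set.Finite.mem_toFinset, Set.mem_ofPred_eq]
    exact fun x hx => (hL _ _ _).1
  · have k₁ : υ y₁ = y := by simpa using h₁
    have k₂ : υ y₂ = y := by simpa using h₂
    refine (h.sec y (fun x hx => ζ (L x y₁ (hx.trans k₁.symm)))
      fun x hx => (hL _ _ _).1).unique ⟨k₁, ?_⟩ ⟨k₂, ?_⟩
    · rintro x' hx rfl
      exact congrArg ζ (hL' _ _ _ _ ⟨rfl, rfl⟩)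
    · rintro x' hx rfl
      have := congrFun (congrFun eq (p (ζ x'))) (by simpa using hx)
      rw [this]
      exact congrArg ζ (hL' _ _ _ _ ⟨rfl, rfl⟩)
  · simp only [Finset.mem_pi, Set.Finite.mem_toFinset, Set.mem_ofPred_eq] at hσ
    obtain ⟨y', ⟨h1, h2⟩, -⟩ := h.sec y (fun x hx => σ x (by simpa using hx)) fun x hx => hσ x hx
    refine ⟨y', by simpa using h1, funext fun x => funext fun hx => ?_⟩
    have hx' : η x = y := by simpa using hx
    have e1 := hL x y' (hx'.trans h1.symm)
    rw [h2 _ (by rw [e1.1, hx']) e1.2]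
    congr 1
    exact e1.1
  · have k : υ y' = y := by simpa using hy'
    refine Finset.prod_bij (fun x' hx' => ⟨p (ζ x'), ?_⟩) (fun _ _ => Finset.mem_attach _ _)
      (fun a ha b hb e => ?_) (fun x _ => ?_) (fun x' hx' => ?_)
    · have : η' x' = y' := by simpa using hx'
      simp [h.comm, this, k]
    · have ha : η' a = y' := by simpa using ha
      have hb : η' b = y' := by simpa using hb
      exact (h.lift (p (ζ a)) y' (by rw [h.comm, ha])).unique ⟨rfl, ha⟩
        ⟨(congrArg Subtype.val e).symm, hb⟩
    · have e1 := hL x.1 y' (e x.2 hy')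
      exact ⟨_, by simpa using e1.2, Subtype.ext e1.1⟩
    · have : η' x' = y' := by simpa using hx'
      exact congrArg m (congrArg ζ (hL' _ _ _ _ ⟨rfl, this⟩))

section Functions

variable {G : Type u} [Group G]

theorem IsDirectSum.bijective_precomp {C : Set (Subgroup G)} {L : Type u} {X : GSet C}
    {F : L → GSet C} {i : ∀ l, F l →[G] X} (h : IsDirectSum F i) (Q : Type u) :
    Function.Bijective (fun (m : X → Q) (l : L) (x : F l) => m (i l x)) := by
  constructor
  · intro m n e
    funext x
    obtain ⟨⟨l, z⟩, rfl⟩ := h.2 x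
    exact congrFun (congrFun e l) z
  · intro m
    let k := Equiv.ofBijective _ h
    refine ⟨fun x => m (k.symm x).1 (k.symm x).2, funext fun l => funext fun x => ?_⟩
    have : k.symm (i l x) = ⟨l, x⟩ := k.symm_apply_apply ⟨l, x⟩
    show m (k.symm (i l x)).1 (k.symm (i l x)).2 = m l x
    rw [this]

variable (TS : TambaraSystem G)

/-- The semi-Mackey functor of functions with values in `Q`. -/
noncomputable def funMack (Q : Type u) [CommMonoid Q] : SMack TS where
  obj X := X → Q
  pull f := { toFun := fun m x => m (f x), map_one' := rfl, map_mul' := fun _ _ => rfl }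
  push g hg := fibProd g hg.1
  pull_id _ _ := rfl
  pull_comp _ _ _ := rfl
  push_id _ h := fibProd_id h.1
  push_comp f g hf hg hgf := fibProd_comp f g hf.1 hg.1 hgf.1
  mackey _ _ _ _ hg' hg h m := funext (fibProd_pullback hg'.1 hg.1 h.1 h.2 m)
  additive _ _ h := h.bijective_precomp Q

/-- The Tambara functor of functions with values in `R`. -/
noncomputable def funTam (R : Type u) [CommRing R] : Tam TS where
  obj :=
    { obj := fun X => X → R
      pull := fun f =>
        { toFun := fun m x => m (f x)
          map_one' := rfl
          map_mul' := fun _ _ => rfl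
          map_zero' := rfl
          map_add' := fun _ _ => rfl }
      tr := fun g hg => fibSum g hg.1
      nm := fun g hg => fibProd g hg.1
      pull_id := fun _ _ => rfl
      pull_comp := fun _ _ _ => rfl
      tr_id := fun _ h => fibSum_id h.1
      tr_comp := fun f g hf hg hgf => fibSum_comp f g hf.1 hg.1 hgf.1
      nm_id := fun _ h => fibProd_id h.1
      nm_comp := fun f g hf hg hgf => fibProd_comp f g hf.1 hg.1 hgf.1
      tr_mackey := fun _ _ _ _ hg' hg h m => funext (fibSum_pullback hg'.1 hg.1 h.1 h.2 m)
      nm_mackey := fun _ _ _ _ hg' hg h m => funext (fibProd_pullback hg'.1 hg.1 h.1 h.2 m)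
      additive := fun _ _ h => h.bijective_precomp R
      exponential := fun _ _ _ _ _ hη hξ hη' hυ h m =>
        h.isExp.fibSum_fibProd hη.1 hξ.1 hη'.1 hυ.1 m }
  property _ m := ⟨-m, add_neg_cancel m⟩

end Functions

section Trivial

variable {G : Type u} [Group G] {TS : TambaraSystem G}

open TambaraSystem

theorem self_mem_finIndexFamily {C : Set (Subgroup G)} : ∀ H ∈ C, H ∈ finIndexFamily C H :=
  fun H hH => ⟨hH, le_rfl, by rw [Subgroup.relIndex_self]; exact one_ne_zero⟩

variable [Subsingleton G] (h : (⊤ : Subgroup G) ∈ TS.C)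

/-- The inclusion of the point `x`. -/
def ptMap {X : GSet TS.C} (x : X) : point TS h →[G] X where
  toFun _ := x
  map_smul' g _ := by rw [Subsingleton.elim g 1, id, one_smul]

theorem isDirectSum_ptMap (X : GSet TS.C) :
    IsDirectSum (L := X) (fun _ => point TS h) (ptMap h) :=
  ⟨fun a b e => Sigma.ext e (by rfl), fun x => ⟨⟨x, PUnit.unit⟩, rfl⟩⟩

namespace SemiMackey

variable {O : Subgroup G → Set (Subgroup G)} (M N : SemiMackey TS.C O) {X Y : GSet TS.C}

theorem pull_ptMap_pull (f : X →[G] Y) (x : X) (m : M.obj Y) :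
    M.pull (ptMap h x) (M.pull f m) = M.pull (ptMap h (f x)) m :=
  (M.pull_comp (ptMap h x) f m).symm

variable {M} in
theorem ext_of_point {m n : M.obj X} (e : ∀ x, M.pull (ptMap h x) m = M.pull (ptMap h x) n) :
    m = n :=
  M.ext_of_isDirectSum (isDirectSum_ptMap h X) e

theorem pull_ptMap_push (hO : ∀ H ∈ TS.C, H ∈ O H) (g : X →[G] Y) (hg : InO O g) (m : M.obj X)
    (y : Y) :
    M.pull (ptMap h y) (M.push g hg m) = ∏ x ∈ (hg.1 y).toFinset, M.pull (ptMap h x) m := by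
  have := (hg.1 y).fintype
  let i (l : {x | g x = y}) : point TS h →[G] fibreProd (ptMap h y) g :=
    fpLift (MulActionHom.id G) (ptMap h l.1) fun _ => l.2.symm
  have hi : IsDirectSum (fun _ => point TS h) i := by
    refine ⟨?_, fun z => ⟨⟨⟨fpSnd _ _ z, (fp_comm _ _ z).symm⟩, PUnit.unit⟩, rfl⟩⟩
    rintro ⟨a, u⟩ ⟨b, v⟩ e
    obtain rfl : a = b := Subtype.ext (congrArg (fpSnd _ _) e)
    rfl
  have inj (l) : Function.Injective (i l) := fun _ _ _ => rfl
  have hf : InO O (fpFst (ptMap h y) g) := by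
    constructor
    · intro u
      refine Set.Finite.of_injOn (f := fpSnd (ptMap h y) g) (t := {x | g x = y}) (fun z _ => ?_)
        (fun a ha b hb e => fp_ext rfl e) (hg.1 y)
      exact (fp_comm _ _ z).symm
    · intro z
      convert hO _ ((point TS h).stab_mem (fpFst (ptMap h y) g z)) using 1
      ext k
      simp [Subsingleton.elim k 1]
  have hid : InO O (MulActionHom.id G : point TS h →[G] point TS h) :=
    inO_of_injective hO fun _ _ h => h
  rw [M.mackey _ _ _ _ hf hg (isPullbackSquare_fibreProd (ptMap h y) g),
    M.push_eq_prod hi (fun l => inO_of_injective hO (inj l)) _ hf (fun _ => hid)]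
  have e (l : {x | g x = y}) : M.push ((fpFst (ptMap h y) g).comp (i l)) hid
      (M.pull (i l) (M.pull (fpSnd (ptMap h y) g) m)) = M.pull (ptMap h l.1) m :=
    (M.push_id _ hid _).trans (M.pull_comp (i l) _ m).symm
  rw [Finset.prod_congr rfl fun l _ => e l]
  exact (Finset.prod_subtype _ (fun x => Set.Finite.mem_toFinset _) fun x =>
    M.pull (ptMap h x) m).symm

theorem exists_hom_of_point (hO : ∀ H ∈ TS.C, H ∈ O H)
    (f : M.obj (point TS h) →* N.obj (point TS h)) :
    ∃ φ : ∀ X : GSet TS.C, M.obj X →* N.obj X,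
      (∀ X x m, N.pull (ptMap h x) (φ X m) = f (M.pull (ptMap h x) m)) ∧
      φ (point TS h) = f ∧
      (∀ {X Y : GSet TS.C} (g : X →[G] Y) m, φ X (M.pull g m) = N.pull g (φ Y m)) ∧
      ∀ {X Y : GSet TS.C} (g : X →[G] Y) (hg : InO O g) m,
        φ Y (M.push g hg m) = N.push g hg (φ X m) := by
  choose φ hφ using fun (X : GSet TS.C) (m : M.obj X) =>
    (N.additive _ _ (isDirectSum_ptMap h X)).2 fun x => f (M.pull (ptMap h x) m)
  have hφ (X : GSet TS.C) (x : X) m : N.pull (ptMap h x) (φ X m) = f (M.pull (ptMap h x) m) :=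
    congrFun (hφ X m) x
  refine ⟨fun X => ⟨⟨φ X, ?_⟩, fun m n => ?_⟩, hφ, MonoidHom.ext fun m => ?_, fun g m => ?_,
    fun g hg m => ?_⟩
  · exact ext_of_point h fun x => by rw [hφ, map_one, map_one, map_one]
  · exact ext_of_point h fun x => by
      dsimp only
      rw [hφ, map_mul, map_mul, map_mul, hφ, hφ]
  · have e : ptMap h PUnit.unit = MulActionHom.id G := rfl
    have := hφ (point TS h) PUnit.unit m
    rw [e, M.pull_id, N.pull_id] at this
    exact this
  · refine ext_of_point h fun x => ?_
    show N.pull _ (φ _ _) = N.pull _ (N.pull g (φ _ _))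
    rw [hφ, pull_ptMap_pull, pull_ptMap_pull, hφ]
  · refine ext_of_point h fun y => ?_
    show N.pull _ (φ _ _) = N.pull _ (N.push g hg (φ _ _))
    rw [hφ, pull_ptMap_push h _ hO, pull_ptMap_push h _ hO, map_prod]
    exact Finset.prod_congr rfl fun x _ => (hφ _ _ _).symm

end SemiMackey

theorem evSMack_isEquivalence : (evSMack TS h).IsEquivalence where
  faithful := ⟨fun {M N φ ψ} e => SemiMackey.Hom.ext <| funext fun X => MonoidHom.ext fun m =>
    SemiMackey.ext_of_point h fun x => by
      have e1 := ConcreteCategory.congr_hom e (M.pull (ptMap h x) m)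
      exact (φ.app_pull _ _).symm.trans (Eq.trans e1 (ψ.app_pull _ _))⟩
  full := ⟨fun {M N} f => by
    obtain ⟨φ, -, h2, h3, h4⟩ := M.exists_hom_of_point h N TS.self_mem f.hom
    exact ⟨⟨φ, h3, h4⟩, CommMonCat.hom_ext h2⟩⟩
  essSurj := ⟨fun Q => ⟨funMack TS Q, ⟨MulEquiv.toCommMonCatIso
    (X := (funMack TS Q).obj (point TS h)) (Y := Q)
    { toFun := fun m => m PUnit.unit
      invFun := fun q _ => q
      left_inv := fun _ => rfl
      right_inv := fun _ => rfl
      map_mul' := fun _ _ => rfl }⟩⟩⟩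

end Trivial

section Evaluation

variable {G : Type u} [Group G] {TS : TambaraSystem G}

open TambaraSystem

theorem SemiTambara.ext_of_point [Subsingleton G] (h : (⊤ : Subgroup G) ∈ TS.C) {T : STam TS}
    {X : GSet TS.C} {m n : T.obj X} (e : ∀ x, T.pull (ptMap h x) m = T.pull (ptMap h x) n) :
    m = n :=
  T.ext_of_isDirectSum (isDirectSum_ptMap h X) e

theorem SemiTambara.pull_ptMap_tr [Subsingleton G] (h : (⊤ : Subgroup G) ∈ TS.C) (T : STam TS)
    {X Y : GSet TS.C} (g : X →[G] Y) (hg : TS.IsAdd g) (m : T.obj X) (y : Y) :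
    T.pull (ptMap h y) (T.tr g hg m) = ∑ x ∈ (hg.1 y).toFinset, T.pull (ptMap h x) m :=
  (addPart T).pull_ptMap_push h self_mem_finIndexFamily g hg m y

theorem SemiTambara.exists_hom_of_point [Subsingleton G] (h : (⊤ : Subgroup G) ∈ TS.C)
    (T T' : STam TS) (f : T.obj (point TS h) →+* T'.obj (point TS h)) :
    ∃ φ : T ⟶ T', SemiTambara.Hom.app φ (point TS h) = f := by
  obtain ⟨φ, h1, h2, h3, h4⟩ := ((mulPart TS).obj T).exists_hom_of_point h ((mulPart TS).obj T')
    TS.self_mem f.toMonoidHom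
  have h1 (X : GSet TS.C) (x : X) (m : T.obj X) :
    T'.pull (ptMap h x) (φ X m) = f (T.pull (ptMap h x) m) := h1 X x m
  let ψ (X : GSet TS.C) : T.obj X →+* T'.obj X :=
    { φ X with
      map_zero' := SemiTambara.ext_of_point h fun x => by
        refine (h1 X x 0).trans ?_
        rw [map_zero, map_zero, map_zero]
      map_add' := fun m n => SemiTambara.ext_of_point h fun x => by
        refine (h1 X x (m + n)).trans ?_
        rw [map_add, map_add, ← h1, ← h1]
        exact (map_add (T'.pull (ptMap h x)) _ _).symm }
  refine ⟨⟨ψ, h3, fun g hg m => SemiTambara.ext_of_point h fun y => ?_, h4⟩,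
    RingHom.ext fun m => DFunLike.congr_fun h2 m⟩
  rw [T'.pull_ptMap_tr]
  refine (h1 _ y _).trans ?_
  rw [T.pull_ptMap_tr, map_sum]
  exact Finset.sum_congr rfl fun x _ => (h1 _ x m).symm

theorem evTam_isEquivalence [Subsingleton G] (h : (⊤ : Subgroup G) ∈ TS.C) :
    (evTam TS h).IsEquivalence where
  faithful := ⟨fun {T T' φ ψ} e => ObjectProperty.hom_ext _ <| SemiTambara.Hom.ext <|
    funext fun X => RingHom.ext fun m => SemiTambara.ext_of_point h fun x => by
      have e1 := ConcreteCategory.congr_hom e (T.obj.pull (ptMap h x) m)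
      exact (φ.hom.app_pull _ _).symm.trans (Eq.trans e1 (ψ.hom.app_pull _ _))⟩
  full := ⟨fun {T T'} f => by
    obtain ⟨φ, hφ⟩ := T.obj.exists_hom_of_point h T'.obj f.hom
    exact ⟨ObjectProperty.homMk φ, CommRingCat.hom_ext hφ⟩⟩
  essSurj := ⟨fun R => ⟨funTam TS R, ⟨@RingEquiv.toCommRingCatIso
    ((funTam TS R).obj.obj (point TS h)) R (ringOfTambara TS (funTam TS R) (point TS h)) _
    { toFun := fun m => m PUnit.unit
      invFun := fun q _ => q
      left_inv := fun _ => rfl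
      right_inv := fun _ => rfl
      map_mul' := fun _ _ => rfl
      map_add' := fun _ _ => rfl }⟩⟩⟩

/-- Morphisms out of a monoid ring. -/
noncomputable def monoidRingHomEquiv (Q : CommMonCat.{u}) (R : CommRingCat.{u}) :
    (monoidRing.obj Q ⟶ R) ≃ (Q ⟶ (forget₂ CommRingCat.{u} CommMonCat.{u}).obj R) where
  toFun f := CommMonCat.ofHom (f.hom.toMonoidHom.comp (MonoidAlgebra.of ℤ Q))
  invFun f := CommRingCat.ofHom (MonoidAlgebra.lift ℤ R Q f.hom).toRingHom
  left_inv f := CommRingCat.hom_ext <| congrArg AlgHom.toRingHom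
    ((MonoidAlgebra.lift ℤ R Q).apply_symm_apply (RingHom.toIntAlgHom f.hom))
  right_inv f := CommMonCat.hom_ext ((MonoidAlgebra.lift ℤ R Q).symm_apply_apply f.hom)

theorem monoidRingHomEquiv_map_comp {Q Q' : CommMonCat.{u}} {R : CommRingCat.{u}} (f : Q ⟶ Q')
    (g : monoidRing.obj Q' ⟶ R) :
    monoidRingHomEquiv Q R (monoidRing.map f ≫ g) = f ≫ monoidRingHomEquiv Q' R g :=
  CommMonCat.hom_ext <| MonoidHom.ext fun q =>
    congrArg g.hom (MonoidAlgebra.mapDomain_single (f := f.hom) (a := q) (r := (1 : ℤ)))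

/-- The monoid ring functor is left adjoint to the forgetful functor. -/
noncomputable def monoidRingAdjunction : monoidRing.{u} ⊣ forget₂ CommRingCat.{u} CommMonCat.{u} :=
  Adjunction.mkOfHomEquiv
    { homEquiv := monoidRingHomEquiv
      homEquiv_naturality_left_symm := fun f g => by
        rw [Equiv.symm_apply_eq, monoidRingHomEquiv_map_comp, Equiv.apply_symm_apply]
      homEquiv_naturality_right := fun _ _ => rfl }

variable (TS) in
/-- Left adjoints transported along evaluation at the point. -/
theorem nonempty_comp_evTam_iso [Subsingleton G] (h : (⊤ : Subgroup G) ∈ TS.C)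
    {F : SMack TS ⥤ Tam TS} (adj : F ⊣ inclTam TS ⋙ mulPart TS) :
    Nonempty (F ⋙ evTam TS h ≅ evSMack TS h ⋙ monoidRing) := by
  have := evSMack_isEquivalence (TS := TS) h
  have := evTam_isEquivalence (TS := TS) h
  let E := (evTam TS h).asEquivalence
  let E' := (evSMack TS h).asEquivalence
  let i : (inclTam TS ⋙ mulPart TS) ⋙ evSMack TS h ≅ evTam TS h ⋙ forget₂ _ _ := Iso.refl _
  let j : evTam TS h ⋙ forget₂ CommRingCat.{u} CommMonCat.{u} ⋙ E'.inverse ≅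
      inclTam TS ⋙ mulPart TS :=
    (Functor.associator _ _ _).symm ≪≫ Functor.isoWhiskerRight i.symm _ ≪≫
      Functor.associator _ _ _ ≪≫ Functor.isoWhiskerLeft _ E'.unitIso.symm ≪≫
      Functor.rightUnitor _
  let k : E.inverse ⋙ inclTam TS ⋙ mulPart TS ≅ forget₂ _ _ ⋙ E'.inverse :=
    Functor.isoWhiskerLeft _ j.symm ≪≫ (Functor.associator _ _ _).symm ≪≫
      Functor.isoWhiskerRight E.counitIso _ ≪≫ Functor.leftUnitor _
  exact ⟨((adj.comp E.toAdjunction).ofNatIsoRight k).leftAdjointUniq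
    (E'.toAdjunction.comp monoidRingAdjunction)⟩

end Evaluation

end BiTam

theorem mainTheorem4 {G : Type u} [Group G] (TS : BiTam.TambaraSystem G) :
    (∃ S : BiTam.SMack TS ⥤ BiTam.STam TS, Nonempty (BiTam.SemiTambarization S)) ∧
    (∃ γ : BiTam.STam TS ⥤ BiTam.Tam TS, Nonempty (BiTam.RingCompletion γ)) ∧
    ∀ (S : BiTam.SMack TS ⥤ BiTam.STam TS) (_ : BiTam.SemiTambarization S)
      (γ : BiTam.STam TS ⥤ BiTam.Tam TS) (_ : BiTam.RingCompletion γ),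
      Nonempty ((S ⋙ γ) ⊣ (BiTam.inclTam TS ⋙ BiTam.mulPart TS)) ∧
      (Subsingleton G → ∀ h : (⊤ : Subgroup G) ∈ TS.C,
        (BiTam.evSMack TS h).IsEquivalence ∧
        (BiTam.evTam TS h).IsEquivalence ∧
        Nonempty ((S ⋙ γ) ⋙ BiTam.evTam TS h ≅ BiTam.evSMack TS h ⋙ BiTam.monoidRing)) := by
  refine ⟨⟨BiTam.semiTambaraFunctor TS, ⟨BiTam.semiTambarization TS⟩⟩,
    ⟨BiTam.ringCompletionFunctor TS, ⟨BiTam.ringCompletionFunctorUnit TS⟩⟩,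
    fun S s γ r => ?_⟩
  have adj := s.adjunction.comp r.adjunction
  exact ⟨⟨adj⟩, fun _ h => ⟨BiTam.evSMack_isEquivalence h, BiTam.evTam_isEquivalence h,
    BiTam.nonempty_comp_evTam_iso TS h adj⟩⟩
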